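/- Let $n\ge k\ge 0$ be integers and $\delta\in\mathbb{C}$. A partial Brauer diagram is a set partition of $\{1,\dots,n\}\cup\{1',\dots,n'\}$ into pairs and singletons; it is a Brauer diagram if all parts are pairs. Let $\mathfrak{R}_n=\mathfrak{R}_n(\delta,0)$ be the partial Brauer algebra: its basis consists of the partial Brauer diagrams, and the product of $d$ and $d'$ is obtained by juxtaposing $d$ (left) and $d'$ (right), replacing each closed loop in the middle by the factor $\delta$ and each open string in the middle by the factor $\delta'=0$. The Brauer algebra $\mathfrak{B}_n=\mathfrak{B}_n(\delta)$ is the subalgebra spanned by the Brauer diagrams. A part that meets both $\{1,\dots,n\}$ and $\{1',\dots,n'\}$ is a propagating line. Let $\mathcal{L}$ be a left cell of partial Brauer diagrams with propagating number $k$, that is, the set of all diagrams that have the same parts inside $\{1',\dots,n'\}$ as a given diagram with exactly $k$ propagating lines. The cell module $\mathbf{C}_{\mathcal{L}}$ has basis $\mathcal{L}$, and a diagram $d$ sends $d'\in\mathcal{L}$ to $dd'$ if $dd'\in\mathbf{C}_{\mathcal{L}}$ and to $0$ otherwise; $S_k$ acts on it from the right by permuting the right ends of the propagating lines. Similarly,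 a left cell $\mathcal{L}'$ of Brauer diagrams with propagating number $m$ gives a $\mathfrak{B}_n$-module $\mathbf{C}^{\mathfrak{B}}_{\mathcal{L}'}$ with a right action of $S_m$. Let $\mathcal{S}(\lambda)$ be the complex Specht module of a partition $\lambda$, and put $$\Delta(\lambda)=\mathbf{C}_{\mathcal{L}}\otimes_{\mathbb{C}[S_k]}\mathcal{S}(\lambda)\quad(\lambda\vdash k),\qquad \Delta^{\mathfrak{B}}(\mu)=\mathbf{C}^{\mathfrak{B}}_{\mathcal{L}'}\otimes_{\mathbb{C}[S_m]}\mathcal{S}(\mu)\quad(\mu\vdash m).$$ For $l\ge 0$ let $\mathbf{C}^{(l)}_{\mathcal{L}}$ be the span of the diagrams in $\mathcal{L}$ with at least $l$ singletons in $\{1,\dots,n\}$; it is a submodule of $\mathbf{C}_{\mathcal{L}}$, stable under $S_k$. Put $$N_l(\lambda)=\bigl(\mathbf{C}^{(l)}_{\mathcal{L}}/\mathbf{C}^{(l+2)}_{\mathcal{L}}\bigr)\otimes_{\mathbb{C}[S_k]}\mathcal{S}(\lambda).$$ For $\lambda\vdash k$ and $\mu\vdash k+l$ let $m^{l}_{\lambda,\mu}$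 be the multiplicity of $\mathcal{S}(\mu)$ in $\mathrm{Ind}_{S_k\times S_l}^{S_{k+l}}(\mathcal{S}(\lambda)\otimes\mathrm{triv})$. Then for every $\lambda\vdash k$, for all choices of the left cells, and for every $l\in\{n-k,n-k-2,\dots\}$ with $l\ge 0$, there is an isomorphism of $\mathfrak{B}_n$-modules $$N_l(\lambda)\;\cong\;\bigoplus_{\mu\vdash k+l}\Delta^{\mathfrak{B}}(\mu)^{\oplus m^{l}_{\lambda,\mu}}.$$ Consequently the decomposition numbers of $\Delta(\lambda)$ are determined by those of the Brauer algebra: for every simple $\mathfrak{R}_n$-module $E$, $$[\Delta(\lambda):E]_{\mathfrak{R}_n}=\sum_{l}\;\sum_{\mu\vdash k+l}m^{l}_{\lambda,\mu}\,[\Delta^{\mathfrak{B}}(\mu):E|_{\mathfrak{B}_n}]_{\mathfrak{B}_n},$$ where $l$ runs over $\{n-k,n-k-2,\dots\}$, $l\ge 0$, and $[M:E]$ is the composition multiplicity. -/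

import Mathlib

namespace PartialBrauer

section Juxtaposition
variable {A B C : Type*}

/-- The juxtaposition of a set partition `p` of `A ⊕ B` (on the left) and a set partition `q` of
`B ⊕ C` (on the right): the finest set partition of `A ⊕ B ⊕ C` for which the elements of each part
of `p` and of each part of `q` are connected. The middle summand `B` is the equator. -/
def juxt (p : Setoid (A ⊕ B)) (q : Setoid (B ⊕ C)) : Setoid (A ⊕ B ⊕ C) :=
  Relation.EqvGen.setoid fun x y =>
    (∃ a b, p a b ∧ x = Sum.map id Sum.inl a ∧ y = Sum.map id Sum.inl b) ∨
    (∃ a b, q a b ∧ x = Sum.inr a ∧ y = Sum.inr b)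

/-- Inclusion of the exterior `A ⊕ C` into `A ⊕ B ⊕ C`. -/
def outer : A ⊕ C → A ⊕ B ⊕ C := Sum.map id Sum.inr

/-- The set partition of the exterior induced by the juxtaposition. -/
def compRel (p : Setoid (A ⊕ B)) (q : Setoid (B ⊕ C)) : Setoid (A ⊕ C) :=
  (juxt p q).comap outer

/-- `x` forms a part on its own. -/
def IsSingleton {X : Type*} (p : Setoid X) (x : X) : Prop := ∀ y, p x y → y = x

/-- A connected component of the juxtaposition that lies inside the equator. -/
def IsInner (p : Setoid (A ⊕ B)) (q : Setoid (B ⊕ C)) (c : Quotient (juxt p q)) : Prop :=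
  ∀ e : A ⊕ C, (⟦outer e⟧ : Quotient (juxt p q)) ≠ c

/-- A connected component of the juxtaposition that contains a singleton part of `p` or `q`. -/
def HasSingleton (p : Setoid (A ⊕ B)) (q : Setoid (B ⊕ C)) (c : Quotient (juxt p q)) : Prop :=
  (∃ x, IsSingleton p x ∧ (⟦Sum.map id Sum.inl x⟧ : Quotient (juxt p q)) = c) ∨
  (∃ x, IsSingleton q x ∧ (⟦Sum.inr x⟧ : Quotient (juxt p q)) = c)

/-- The number of open strings removed in straightening. -/
noncomputable def strings (p : Setoid (A ⊕ B)) (q : Setoid (B ⊕ C)) : ℕ :=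
  Nat.card {c : Quotient (juxt p q) // IsInner p q c ∧ HasSingleton p q c}

/-- The number of loops removed in straightening. -/
noncomputable def loops (p : Setoid (A ⊕ B)) (q : Setoid (B ⊕ C)) : ℕ :=
  Nat.card {c : Quotient (juxt p q) // IsInner p q c ∧ ¬ HasSingleton p q c}

theorem juxt_compat {p : Setoid (A ⊕ B)} {q : Setoid (B ⊕ C)} {Y : Type*}
    (f : A ⊕ B ⊕ C → Y) :
    (∀ x y, juxt p q x y → f x = f y) ↔
      (∀ x y, p x y → f (Sum.map id Sum.inl x) = f (Sum.map id Sum.inl y)) ∧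
      (∀ x y, q x y → f (Sum.inr x) = f (Sum.inr y)) := by
  constructor
  · intro h
    exact ⟨fun x y hxy => h _ _ (Relation.EqvGen.rel _ _ (Or.inl ⟨x, y, hxy, rfl, rfl⟩)),
      fun x y hxy => h _ _ (Relation.EqvGen.rel _ _ (Or.inr ⟨x, y, hxy, rfl, rfl⟩))⟩
  · rintro ⟨h1, h2⟩ x y hxy
    have hxy' : Relation.EqvGen _ x y := hxy
    induction hxy' with
    | rel x y h =>
      rcases h with ⟨a, b, h, rfl, rfl⟩ | ⟨a, b, h, rfl, rfl⟩
      · exact h1 _ _ h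
      · exact h2 _ _ h
    | refl => rfl
    | symm x y h ih => exact (ih h).symm
    | trans x y z h h' ih ih' => exact (ih h).trans (ih' h')

/-! ### Counting two-colourings -/

open Classical in
/-- Indicator of the colourings that are constant on the parts of `p`. -/
noncomputable def colour (p : Setoid (A ⊕ B)) (s : A → Bool) (u : B → Bool) : ℕ :=
  if ∀ x y, p x y → Sum.elim s u x = Sum.elim s u y then 1 else 0

theorem colour_false (p : Setoid (A ⊕ B)) : colour p (fun _ => false) (fun _ => false) = 1 := by
  unfold colour
  rw [if_pos]
  rintro (x | x) (y | y) _ <;> rfl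

theorem colour_injective {p q : Setoid (A ⊕ B)} (h : ∀ s u, colour p s u = colour q s u) :
    p = q := by
  classical
  have key : ∀ p q : Setoid (A ⊕ B), (∀ s u, colour p s u = colour q s u) →
      ∀ x y, p x y → q x y := by
    intro p q h x y hxy
    by_contra hq
    have h1 := h (fun a => decide (q x (Sum.inl a))) (fun a => decide (q x (Sum.inr a)))
    have he : ∀ z, Sum.elim (fun a => decide (q x (Sum.inl a)))
        (fun a => decide (q x (Sum.inr a))) z = decide (q x z) := by
      rintro (z | z) <;> rfl
    unfold colour at h1
    simp only [he] at h1
    rw [if_neg, if_pos] at h1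
    · exact absurd h1 (by norm_num)
    · intro z w hzw
      exact decide_eq_decide.2 ⟨fun h => q.trans h hzw, fun h => q.trans h (q.symm hzw)⟩
    · intro h'
      have := decide_eq_decide.1 (h' x y hxy)
      exact hq (this.1 (q.refl x))
  ext x y
  exact ⟨key p q h x y, key q p (fun s u => (h s u).symm) x y⟩

theorem sum_colour [Fintype A] [Fintype B] [Fintype C] [DecidableEq B]
    (p : Setoid (A ⊕ B)) (q : Setoid (B ⊕ C))
    (s : A → Bool) (t : C → Bool) :
    ∑ u : B → Bool, colour p s u * colour q u t =
      2 ^ Nat.card {c // IsInner p q c} * colour (compRel p q) s t := by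
  classical
  have h1 : ∀ u : B → Bool, colour p s u * colour q u t =
      if ∀ x y, juxt p q x y → Sum.elim s (Sum.elim u t) x = Sum.elim s (Sum.elim u t) y
      then 1 else 0 := by
    intro u
    simp only [juxt_compat]
    have e1 : ∀ x : A ⊕ B, Sum.elim s (Sum.elim u t) (Sum.map id Sum.inl x) = Sum.elim s u x := by
      rintro (x | x) <;> rfl
    simp only [e1, Sum.elim_inr]
    unfold colour
    by_cases hp : ∀ x y, p x y → Sum.elim s u x = Sum.elim s u y
    · by_cases hq : ∀ x y, q x y → Sum.elim u t x = Sum.elim u t y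
      · rw [if_pos hp, if_pos hq, if_pos ⟨hp, hq⟩]
      · rw [if_neg hq, if_neg (c := _ ∧ _) fun h => hq h.2, mul_zero]
    · rw [if_neg hp, if_neg (c := _ ∧ _) fun h => hp h.1, zero_mul]
  simp only [h1]
  rw [Finset.sum_boole]
  have e2 : ∀ (u : B → Bool) (x : A ⊕ C), Sum.elim s (Sum.elim u t) (outer x) = Sum.elim s t x := by
    rintro u (x | x) <;> rfl
  unfold colour
  split_ifs with hc
  · rw [mul_one, Nat.cast_id, ← Fintype.card_subtype]
    have : Fintype.card {u : B → Bool // ∀ x y, juxt p q x y →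
        Sum.elim s (Sum.elim u t) x = Sum.elim s (Sum.elim u t) y} =
        Fintype.card ({c // IsInner p q c} → Bool) := by
      apply Fintype.card_congr
      let val : ({c // IsInner p q c} → Bool) → Quotient (juxt p q) → Bool := fun φ c =>
        if h : IsInner p q c then φ ⟨c, h⟩ else
          Sum.elim s t (Classical.choose (not_forall.1 h))
      have hval : ∀ φ e, val φ ⟦outer e⟧ = Sum.elim s t e := by
        intro φ e
        have hn : ¬ IsInner p q ⟦outer e⟧ := fun h => h e rfl
        simp only [val, dif_neg hn]
        have := Classical.choose_spec (not_forall.1 hn)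
        rw [not_not] at this
        exact hc _ _ (show juxt p q _ _ from Quotient.exact this)
      have hv2 : ∀ φ x, Sum.elim s (Sum.elim (fun b => val φ ⟦Sum.inr (Sum.inl b)⟧) t) x =
          val φ ⟦x⟧ := by
        rintro φ (x | x | x)
        · exact (hval φ (Sum.inl x)).symm
        · rfl
        · exact (hval φ (Sum.inr x)).symm
      refine ⟨fun u c => Quotient.lift (Sum.elim s (Sum.elim u.1 t)) u.2 c.1,
        fun φ => ⟨fun b => val φ ⟦Sum.inr (Sum.inl b)⟧, ?_⟩, ?_, ?_⟩
      · intro x y hxy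
        rw [hv2, hv2]
        exact congrArg _ (Quotient.sound hxy)
      · rintro ⟨u, hu⟩
        apply Subtype.ext
        funext b
        simp only
        set φ := fun c : {c // IsInner p q c} =>
          Quotient.lift (Sum.elim s (Sum.elim u t)) hu c.1 with hφ
        by_cases h : IsInner p q ⟦Sum.inr (Sum.inl b)⟧
        · simp only [val, dif_pos h]
          rfl
        · obtain ⟨e, he⟩ := not_forall.1 h
          rw [not_not] at he
          rw [← he, hval, ← e2 u]
          exact hu _ _ (Quotient.exact he)
      · intro φ
        funext ⟨c, hc'⟩
        induction c using Quotient.inductionOn with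
        | h x =>
          simp only [Quotient.lift_mk]
          rw [hv2]
          simp only [val, dif_pos hc']
    rw [this, Fintype.card_fun, Fintype.card_bool, Nat.card_eq_fintype_card]
  · rw [mul_zero, Nat.cast_id, Finset.card_eq_zero, Finset.filter_eq_empty_iff]
    intro u _ hu
    apply hc
    intro x y hxy
    have := hu _ _ hxy
    rwa [e2, e2] at this

theorem loops_add_strings [Finite A] [Finite B] [Finite C]
    (p : Setoid (A ⊕ B)) (q : Setoid (B ⊕ C)) :
    loops p q + strings p q = Nat.card {c // IsInner p q c} := by
  classical
  unfold loops strings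
  rw [add_comm, ← Nat.card_sum]
  refine Nat.card_congr (((Equiv.subtypeSubtypeEquivSubtypeInter _ _).symm.sumCongr
    (Equiv.subtypeSubtypeEquivSubtypeInter _ (fun c => ¬ HasSingleton p q c)).symm).trans
    (Equiv.sumCompl (fun c : {c // IsInner p q c} => HasSingleton p q c.1)))

theorem eq_of_scaled {p q : Setoid (A ⊕ B)} {a b : ℕ}
    (h : ∀ s u, 2 ^ a * colour p s u = 2 ^ b * colour q s u) : p = q ∧ a = b := by
  have h0 := h (fun _ => false) (fun _ => false)
  rw [colour_false, colour_false, mul_one, mul_one] at h0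
  have hab : a = b := Nat.pow_right_injective le_rfl h0
  subst hab
  exact ⟨colour_injective fun s u => Nat.eq_of_mul_eq_mul_left (by positivity) (h s u), rfl⟩

theorem comp_assoc_aux {D : Type*} [Fintype A] [Fintype B] [Fintype C] [Fintype D]
    (p : Setoid (A ⊕ B)) (q : Setoid (B ⊕ C)) (r : Setoid (C ⊕ D)) :
    compRel (compRel p q) r = compRel p (compRel q r) ∧
    Nat.card {c // IsInner p q c} + Nat.card {c // IsInner (compRel p q) r c} =
      Nat.card {c // IsInner q r c} + Nat.card {c // IsInner p (compRel q r) c} := by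
  classical
  apply eq_of_scaled
  intro s t
  rw [pow_add, pow_add, mul_assoc, mul_assoc, ← sum_colour, ← sum_colour,
    Finset.mul_sum, Finset.mul_sum]
  have h1 : ∀ v, 2 ^ Nat.card {c // IsInner p q c} * (colour (compRel p q) s v * colour r v t)
      = ∑ u : B → Bool, colour p s u * colour q u v * colour r v t := by
    intro v
    rw [← mul_assoc, ← sum_colour, Finset.sum_mul]
  have h2 : ∀ u, 2 ^ Nat.card {c // IsInner q r c} * (colour p s u * colour (compRel q r) u t)
      = ∑ v : C → Bool, colour p s u * colour q u v * colour r v t := by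
    intro u
    rw [mul_left_comm, ← sum_colour, Finset.mul_sum]
    simp only [mul_assoc]
  simp only [h1, h2]
  exact Finset.sum_comm
end Juxtaposition

section Ends
variable {V : Type*}

/-- The orbits of the group generated by the two involutions `f false` and `f true`. -/
def orb (f : Bool → V → V) : Setoid V :=
  Relation.EqvGen.setoid fun x y => ∃ b, y = f b x

theorem orb_step (f : Bool → V → V) (b : Bool) (x : V) : orb f x (f b x) :=
  Relation.EqvGen.rel _ _ ⟨b, rfl⟩

/-- An orbit of two involutions that contains a fixed point of one of them contains exactly one
other such fixed point (where a point fixed by both involutions is counted twice). -/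
theorem exists_unique_end [Finite V] {f : Bool → V → V} (hf : ∀ b, Function.Involutive (f b))
    {x : V} {b : Bool} (hx : f b x = x) :
    ∃! e : V × Bool, e ≠ (x, b) ∧ orb f x e.1 ∧ f e.2 e.1 = e.1 := by
  set σ : V → V := fun y => f b (f (!b) y) with hσ
  have hinj : Function.Injective σ := (hf b).injective.comp (hf !b).injective
  have hper : x ∈ Function.periodicPts σ := hinj.mem_periodicPts x
  set m := Function.minimalPeriod σ x with hm
  have hmpos : 0 < m := Function.minimalPeriod_pos_of_mem_periodicPts hper
  have hmx : σ^[m] x = x := Function.iterate_minimalPeriod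
  have hFG : ∀ y, f (!b) y = f b (σ y) := fun y => by simp only [hσ, (hf b) _]
  have hrev : ∀ i, σ^[i] (f b (σ^[i] x)) = x := by
    intro i
    induction i with
    | zero => simpa using hx
    | succ i ih =>
      rw [Function.iterate_succ_apply, Function.iterate_succ_apply' σ i x, ← hFG]
      rw [show σ (f (!b) (σ^[i] x)) = f b (σ^[i] x) by simp only [hσ, (hf (!b)) _]]
      exact ih
  have hG : ∀ i ≤ m, f b (σ^[i] x) = σ^[m - i] x := by
    intro i hi
    apply hinj.iterate i
    rw [hrev, ← Function.iterate_add_apply, Nat.add_sub_cancel' hi, hmx]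
  have hF : ∀ i < m, f (!b) (σ^[i] x) = σ^[m - 1 - i] x := by
    intro i hi
    rw [hFG, ← Function.iterate_succ_apply' σ i x, hG _ hi]
    congr 1; omega
  have horb : ∀ i, orb f x (σ^[i] x) := by
    intro i
    induction i with
    | zero => exact (orb f).refl x
    | succ i ih =>
      rw [Function.iterate_succ_apply']
      exact (orb f).trans ih ((orb f).trans (orb_step f (!b) _) (orb_step f b _))
  have hmem : ∀ y, orb f x y → ∃ i < m, y = σ^[i] x := by
    intro y hy
    have hcl : ∀ c z, (∃ i < m, z = σ^[i] x) → ∃ i < m, f c z = σ^[i] x := by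
      rintro c z ⟨i, hi, rfl⟩
      by_cases hc : c = b
      · subst hc
        rcases Nat.eq_zero_or_pos i with rfl | h0
        · exact ⟨0, hmpos, by simpa using hx⟩
        · exact ⟨m - i, by omega, hG i hi.le⟩
      · have : c = !b := Bool.eq_not_iff.2 hc
        subst this
        exact ⟨m - 1 - i, by omega, hF i hi⟩
    have key : ∀ u v, orb f u v → ((∃ i < m, u = σ^[i] x) ↔ ∃ i < m, v = σ^[i] x) := by
      intro u v huv
      have huv' : Relation.EqvGen _ u v := huv
      induction huv' with
      | rel u v h =>
        obtain ⟨c, rfl⟩ := h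
        refine ⟨hcl c u, fun h => ?_⟩
        have := hcl c _ h
        rwa [hf c u] at this
      | refl => rfl
      | symm u v h ih => exact (ih h).symm
      | trans u v w h h' ih ih' => exact (ih h).trans (ih' h')
    exact (key x y hy).1 ⟨0, hmpos, rfl⟩
  have hdist : ∀ i < m, ∀ j < m, σ^[i] x = σ^[j] x → i = j := fun i hi j hj h =>
    Function.iterate_injOn_Iio_minimalPeriod hi hj h
  have hbn : b ≠ !b := by cases b <;> simp
  -- characterisation of the ends in the orbit
  have hendG : ∀ i < m, f b (σ^[i] x) = σ^[i] x → i = 0 ∨ 2 * i = m := by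
    intro i hi h
    rcases Nat.eq_zero_or_pos i with h0 | h0
    · exact Or.inl h0
    · rw [hG i hi.le] at h
      have := hdist _ (by omega) _ hi h
      omega
  have hendF : ∀ i < m, f (!b) (σ^[i] x) = σ^[i] x → 2 * i + 1 = m := by
    intro i hi h
    rw [hF i hi] at h
    have := hdist _ (by omega) _ hi h
    omega
  rcases Nat.even_or_odd' m with ⟨j, hj | hj⟩
  · refine ⟨(σ^[j] x, b), ⟨?_, horb j, ?_⟩, ?_⟩
    · intro h
      have := hdist j (by omega) 0 hmpos (congrArg Prod.fst h)
      omega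
    · change f b (σ^[j] x) = σ^[j] x
      rw [hG j (by omega)]
      congr 1; omega
    · rintro ⟨y, c⟩ ⟨hne, hy, hfix⟩
      obtain ⟨i, hi, rfl⟩ := hmem y hy
      by_cases hc : c = b
      · subst hc
        rcases hendG i hi hfix with rfl | h
        · exact absurd rfl hne
        · have : i = j := by omega
          rw [this]
      · have : c = !b := Bool.eq_not_iff.2 hc
        subst this
        have := hendF i hi hfix
        omega
  · refine ⟨(σ^[j] x, !b), ⟨?_, horb j, ?_⟩, ?_⟩
    · intro h
      exact hbn (congrArg Prod.snd h).symm
    · change f (!b) (σ^[j] x) = σ^[j] x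
      rw [hF j (by omega)]
      congr 1; omega
    · rintro ⟨y, c⟩ ⟨hne, hy, hfix⟩
      obtain ⟨i, hi, rfl⟩ := hmem y hy
      by_cases hc : c = b
      · subst hc
        rcases hendG i hi hfix with rfl | h
        · exact absurd rfl hne
        · omega
      · have : c = !b := Bool.eq_not_iff.2 hc
        subst this
        have := hendF i hi hfix
        have : i = j := by omega
        rw [this]
end Ends

section Thin
variable {A B C : Type*}

/-- All parts of the set partition have at most two elements. -/
def Thin {X : Type*} (p : Setoid X) : Prop :=
  ∀ x y z, p x y → p x z → x = y ∨ x = z ∨ y = z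

/-- The number of singleton parts. -/
noncomputable def singletons {X : Type*} (p : Setoid X) : ℕ := Nat.card {x // IsSingleton p x}

open Classical in
/-- The other element of the part of `x` (or `x` itself if `x` is a singleton). -/
noncomputable def mate {X : Type*} (p : Setoid X) (x : X) : X :=
  if h : ∃ y, y ≠ x ∧ p x y then h.choose else x

theorem mate_rel {X : Type*} (p : Setoid X) (x : X) : p x (mate p x) := by
  unfold mate
  split_ifs with h
  · exact h.choose_spec.2
  · exact p.refl x

theorem mate_eq {X : Type*} {p : Setoid X} (hp : Thin p) {x y : X} (h : p x y) (hne : y ≠ x) :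
    mate p x = y := by
  have hex : ∃ y, y ≠ x ∧ p x y := ⟨y, hne, h⟩
  unfold mate
  rw [dif_pos hex]
  rcases hp x _ _ hex.choose_spec.2 h with h1 | h1 | h1
  · exact absurd h1.symm hex.choose_spec.1
  · exact absurd h1.symm hne
  · exact h1

theorem mate_fix {X : Type*} (p : Setoid X) (x : X) : mate p x = x ↔ IsSingleton p x := by
  constructor
  · intro h y hy
    by_contra hne
    have hex : ∃ y, y ≠ x ∧ p x y := ⟨y, hne, hy⟩
    unfold mate at h
    rw [dif_pos hex] at h
    exact hex.choose_spec.1 h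
  · intro h
    exact h _ (mate_rel p x)

theorem mate_mate {X : Type*} {p : Setoid X} (hp : Thin p) : Function.Involutive (mate p) := by
  intro x
  by_cases h : mate p x = x
  · rw [h, h]
  · exact mate_eq hp (p.symm (mate_rel p x)) (Ne.symm h)

/-- One step along an edge of the juxtaposition. -/
noncomputable def step (p : Setoid (A ⊕ B)) (q : Setoid (B ⊕ C)) : Bool → A ⊕ B ⊕ C → A ⊕ B ⊕ C
  | true, Sum.inl a => Sum.map id Sum.inl (mate p (Sum.inl a))
  | true, Sum.inr (Sum.inl b) => Sum.map id Sum.inl (mate p (Sum.inr b))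
  | true, Sum.inr (Sum.inr c) => Sum.inr (Sum.inr c)
  | false, Sum.inl a => Sum.inl a
  | false, Sum.inr y => Sum.inr (mate q y)

theorem step_true (p : Setoid (A ⊕ B)) (q : Setoid (B ⊕ C)) (x : A ⊕ B) :
    step p q true (Sum.map id Sum.inl x) = Sum.map id Sum.inl (mate p x) := by
  rcases x with x | x <;> rfl

theorem map_inl_injective : Function.Injective (Sum.map id Sum.inl : A ⊕ B → A ⊕ B ⊕ C) :=
  Function.Injective.sumMap Function.injective_id Sum.inl_injective

theorem step_involutive {p : Setoid (A ⊕ B)} {q : Setoid (B ⊕ C)} (hp : Thin p) (hq : Thin q)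
    (b : Bool) : Function.Involutive (step p q b) := by
  intro x
  cases b
  · rcases x with x | x
    · rfl
    · change Sum.inr (mate q (mate q x)) = _
      rw [mate_mate hq]
  · rcases x with x | x | x
    · change step p q true (Sum.map id Sum.inl (mate p (Sum.inl x))) = _
      rw [step_true, mate_mate hp]; rfl
    · change step p q true (Sum.map id Sum.inl (mate p (Sum.inr x))) = _
      rw [step_true, mate_mate hp]; rfl
    · rfl

theorem orb_step_eq {p : Setoid (A ⊕ B)} {q : Setoid (B ⊕ C)} (hp : Thin p) (hq : Thin q) :
    orb (step p q) = juxt p q := by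
  apply le_antisymm
  · apply Setoid.eqvGen_le
    rintro x y ⟨b, rfl⟩
    cases b
    · rcases x with x | x
      · exact (juxt p q).refl _
      · exact Relation.EqvGen.rel _ _ (Or.inr ⟨x, mate q x, mate_rel q x, rfl, rfl⟩)
    · rcases x with x | x | x
      · exact Relation.EqvGen.rel _ _ (Or.inl ⟨Sum.inl x, _, mate_rel p _, rfl, rfl⟩)
      · exact Relation.EqvGen.rel _ _ (Or.inl ⟨Sum.inr x, _, mate_rel p _, rfl, rfl⟩)
      · exact (juxt p q).refl _
  · apply Setoid.eqvGen_le
    rintro x y (⟨a, b, h, rfl, rfl⟩ | ⟨a, b, h, rfl, rfl⟩)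
    · by_cases hab : b = a
      · subst hab; exact (orb _).refl _
      · rw [← mate_eq hp h hab, ← step_true p q]
        exact orb_step _ _ _
    · by_cases hab : b = a
      · subst hab; exact (orb _).refl _
      · rw [← mate_eq hq h hab]
        exact orb_step (step p q) false (Sum.inr a)

/-- The ends of the strings in a juxtaposition: exterior vertices and singletons. -/
abbrev Ends (p : Setoid (A ⊕ B)) (q : Setoid (B ⊕ C)) : Type _ :=
  (A ⊕ C) ⊕ ({x // IsSingleton p x} ⊕ {x // IsSingleton q x})

/-- The vertex at which an end is located, with the side on which it is an end. -/
def tag (p : Setoid (A ⊕ B)) (q : Setoid (B ⊕ C)) : Ends p q → (A ⊕ B ⊕ C) × Bool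
  | Sum.inl (Sum.inl a) => (Sum.inl a, false)
  | Sum.inl (Sum.inr c) => (Sum.inr (Sum.inr c), true)
  | Sum.inr (Sum.inl x) => (Sum.map id Sum.inl x.1, true)
  | Sum.inr (Sum.inr x) => (Sum.inr x.1, false)

theorem tag_outer (p : Setoid (A ⊕ B)) (q : Setoid (B ⊕ C)) (e : A ⊕ C) :
    (tag p q (Sum.inl e)).1 = outer e := by
  rcases e with e | e <;> rfl

theorem tag_injective (p : Setoid (A ⊕ B)) (q : Setoid (B ⊕ C)) :
    Function.Injective (tag p q) := by
  rintro ((a | c) | (⟨x | x, hx⟩ | ⟨x | x, hx⟩)) ((a' | c') | (⟨x' | x', hx'⟩ | ⟨x' | x', hx'⟩)) h <;>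
    simp_all [tag]

theorem tag_range (p : Setoid (A ⊕ B)) (q : Setoid (B ⊕ C)) (e : (A ⊕ B ⊕ C) × Bool) :
    step p q e.2 e.1 = e.1 ↔ e ∈ Set.range (tag p q) := by
  constructor
  · rcases e with ⟨x, b⟩
    cases b
    · rcases x with x | x
      · intro _
        exact ⟨Sum.inl (Sum.inl x), rfl⟩
      · intro h
        exact ⟨Sum.inr (Sum.inr ⟨x, (mate_fix q x).1 (Sum.inr_injective h)⟩), rfl⟩
    · rcases x with x | x | x
      · intro h
        exact ⟨Sum.inr (Sum.inl ⟨Sum.inl x, (mate_fix p _).1 (map_inl_injective h)⟩), rfl⟩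
      · intro h
        exact ⟨Sum.inr (Sum.inl ⟨Sum.inr x, (mate_fix p _).1 (map_inl_injective h)⟩), rfl⟩
      · intro _
        exact ⟨Sum.inl (Sum.inr x), rfl⟩
  · rintro ⟨((a | c) | (x | x)), rfl⟩
    · rfl
    · rfl
    · change step p q true (Sum.map id Sum.inl x.1) = Sum.map id Sum.inl x.1
      rw [step_true, (mate_fix p _).2 x.2]
    · change Sum.inr (mate q x.1) = Sum.inr x.1
      rw [(mate_fix q _).2 x.2]

theorem exists_unique_partner [Finite A] [Finite B] [Finite C] {p : Setoid (A ⊕ B)}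
    {q : Setoid (B ⊕ C)} (hp : Thin p) (hq : Thin q) (e : Ends p q) :
    ∃! e' : Ends p q, e' ≠ e ∧ juxt p q (tag p q e).1 (tag p q e').1 := by
  have he := (tag_range p q (tag p q e)).2 ⟨e, rfl⟩
  obtain ⟨y, ⟨h1, h2, h3⟩, h4⟩ := exists_unique_end (step_involutive hp hq) he
  obtain ⟨e', rfl⟩ := (tag_range p q y).1 h3
  rw [orb_step_eq hp hq] at h2 h4
  refine ⟨e', ⟨fun h => h1 (by rw [h]), h2⟩, ?_⟩
  rintro e'' ⟨h5, h6⟩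
  exact tag_injective p q (h4 _ ⟨fun h => h5 (tag_injective p q h), h6,
    (tag_range p q _).2 ⟨e'', rfl⟩⟩)

theorem thin_compRel [Finite A] [Finite B] [Finite C] {p : Setoid (A ⊕ B)}
    {q : Setoid (B ⊕ C)} (hp : Thin p) (hq : Thin q) : Thin (compRel p q) := by
  intro x y z hxy hxz
  by_contra! h
  obtain ⟨e, -, he⟩ := exists_unique_partner hp hq (Sum.inl x)
  have hy := he (Sum.inl y) ⟨fun h' => h.1 (Sum.inl_injective h').symm, by
    rw [tag_outer, tag_outer]; exact hxy⟩
  have hz := he (Sum.inl z) ⟨fun h' => h.2.1 (Sum.inl_injective h').symm, by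
    rw [tag_outer, tag_outer]; exact hxz⟩
  exact h.2.2 (Sum.inl_injective (hy.trans hz.symm))

/-- Every singleton of `p` or `q` ends up in an open string or in a singleton of the product. -/
theorem singletons_comp [Finite A] [Finite B] [Finite C] {p : Setoid (A ⊕ B)}
    {q : Setoid (B ⊕ C)} (hp : Thin p) (hq : Thin q) :
    2 * strings p q + singletons (compRel p q) = singletons p + singletons q := by
  classical
  choose τ hτ hτu using exists_unique_partner hp hq
  have hττ : ∀ e, τ (τ e) = e := fun e =>
    (hτu (τ e) e ⟨(hτ e).1.symm, (juxt p q).symm (hτ e).2⟩).symm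
  have hcls : ∀ e e', juxt p q (tag p q e).1 (tag p q e').1 → e' = e ∨ e' = τ e := by
    intro e e' h
    by_cases hne : e' = e
    · exact Or.inl hne
    · exact Or.inr (hτu e e' ⟨hne, h⟩)
  have h1 : singletons p + singletons q =
      Nat.card ({x // IsSingleton p x} ⊕ {x // IsSingleton q x}) := Nat.card_sum.symm
  rw [h1, ← Nat.card_congr (Equiv.sumCompl
    (fun s : {x // IsSingleton p x} ⊕ {x // IsSingleton q x} => (τ (Sum.inr s)).isRight)),
    Nat.card_sum]
  congr 1
  · let g : {s : {x // IsSingleton p x} ⊕ {x // IsSingleton q x} // (τ (Sum.inr s)).isRight} →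
        {c : Quotient (juxt p q) // IsInner p q c ∧ HasSingleton p q c} := fun s =>
      ⟨⟦(tag p q (Sum.inr s.1)).1⟧, by
        refine ⟨fun e he => ?_, ?_⟩
        · have := hcls (Sum.inr s.1) (Sum.inl e) (by
            rw [tag_outer]; exact (juxt p q).symm (Quotient.exact he))
          rcases this with h | h
          · cases h
          · have h2 := s.2
            rw [← h] at h2
            cases h2
        · rcases s with ⟨s | s, hs⟩
          · exact Or.inl ⟨s.1, s.2, rfl⟩
          · exact Or.inr ⟨s.1, s.2, rfl⟩⟩
    have hfib : ∀ c, Nat.card {s // g s = c} = 2 := by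
      rintro ⟨c, hc1, hc2⟩
      have : ∃ s : {x // IsSingleton p x} ⊕ {x // IsSingleton q x},
          (⟦(tag p q (Sum.inr s)).1⟧ : Quotient (juxt p q)) = c := by
        rcases hc2 with ⟨x, hx, h⟩ | ⟨x, hx, h⟩
        · exact ⟨Sum.inl ⟨x, hx⟩, h⟩
        · exact ⟨Sum.inr ⟨x, hx⟩, h⟩
      obtain ⟨s, hs⟩ := this
      have hr : ∃ t, τ (Sum.inr s) = Sum.inr t := by
        rcases ht : τ (Sum.inr s) with e | t
        · exfalso
          apply hc1 e
          rw [← hs, ← tag_outer p q, ← ht]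
          exact Quotient.sound ((juxt p q).symm (hτ (Sum.inr s)).2)
        · exact ⟨t, rfl⟩
      obtain ⟨t, ht⟩ := hr
      have ht' : τ (Sum.inr t) = Sum.inr s := by rw [← ht, hττ]
      have hts : t ≠ s := fun h => (hτ (Sum.inr s)).1 (by rw [ht, h])
      have htc : (⟦(tag p q (Sum.inr t)).1⟧ : Quotient (juxt p q)) = c := by
        rw [← hs, ← ht]
        exact Quotient.sound ((juxt p q).symm (hτ (Sum.inr s)).2)
      rw [Nat.card_eq_two_iff]
      refine ⟨⟨⟨s, by rw [ht]; rfl⟩, Subtype.ext hs⟩, ⟨⟨t, by rw [ht']; rfl⟩, Subtype.ext htc⟩,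
        fun h => hts (congrArg (fun z => z.1.1) h).symm, ?_⟩
      rw [Set.eq_univ_iff_forall]
      rintro ⟨⟨u, hu⟩, huc⟩
      have huc' : (⟦(tag p q (Sum.inr u)).1⟧ : Quotient (juxt p q)) = c :=
        congrArg Subtype.val huc
      rcases hcls (Sum.inr s) (Sum.inr u) (Quotient.exact (hs.trans huc'.symm)) with h | h
      · left
        exact Subtype.ext (Subtype.ext (Sum.inr_injective h))
      · right
        rw [ht] at h
        exact Subtype.ext (Subtype.ext (Sum.inr_injective h))
    have := Fintype.ofFinite {c : Quotient (juxt p q) // IsInner p q c ∧ HasSingleton p q c}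
    rw [← Nat.card_congr (Equiv.sigmaFiberEquiv g), Nat.card_sigma]
    simp only [hfib, Finset.sum_const, Finset.card_univ, smul_eq_mul]
    rw [strings, Nat.card_eq_fintype_card, mul_comm]
  · have hl : ∀ s : {s : {x // IsSingleton p x} ⊕ {x // IsSingleton q x} //
        ¬ (τ (Sum.inr s)).isRight}, ∃ e, τ (Sum.inr s.1) = Sum.inl e := by
      rintro ⟨s, hs⟩
      rcases h : τ (Sum.inr s) with e | t
      · exact ⟨e, rfl⟩
      · rw [h] at hs
        exact absurd rfl hs
    choose g hg using hl
    have hg' : ∀ s, τ (Sum.inl (g s)) = Sum.inr s.1 := fun s => by rw [← hg, hττ]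
    refine (Nat.card_congr (Equiv.ofBijective
      (fun s => (⟨g s, ?_⟩ : {x // IsSingleton (compRel p q) x})) ⟨?_, ?_⟩)).symm
    · intro e he
      rcases hcls (Sum.inl (g s)) (Sum.inl e) (by rw [tag_outer, tag_outer]; exact he) with h | h
      · exact Sum.inl_injective h
      · rw [hg'] at h
        cases h
    · intro s t h
      have h' : g s = g t := congrArg Subtype.val h
      apply Subtype.ext
      apply Sum.inr_injective (α := A ⊕ C)
      rw [← hg', ← hg', h']
    · rintro ⟨e, he⟩
      rcases h : τ (Sum.inl e) with e' | s
      · exfalso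
        have h2 := hτ (Sum.inl e)
        rw [h, tag_outer, tag_outer] at h2
        exact h2.1 (by rw [he e' h2.2])
      · have h2 : τ (Sum.inr s) = Sum.inl e := by rw [← h, hττ]
        refine ⟨⟨s, by rw [h2]; simp⟩, Subtype.ext ?_⟩
        apply Sum.inl_injective (β := {x // IsSingleton p x} ⊕ {x // IsSingleton q x})
        rw [← hg, h2]
end Thin

/-! ### Partial Brauer diagrams -/

/-- A partial Brauer partition: a set partition of `{1, …, n} ∪ {1', …, n'}` into pairs and
singletons. The vertex `i` is `Sum.inl i`, the vertex `i'` is `Sum.inr i`. -/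
@[ext]
structure Diagram (n : ℕ) where
  /-- the set partition -/
  rel : Setoid (Fin n ⊕ Fin n)
  /-- all parts have at most two elements -/
  thin : Thin rel

namespace Diagram
variable {n : ℕ}

/-- The diagram of a permutation `π`, with the propagating lines `{π j, j'}`. -/
def perm (π : Equiv.Perm (Fin n)) : Diagram n where
  rel := Setoid.ker (Sum.elim id π)
  thin := by
    rintro (x | x) (y | y) (z | z) h1 h2 <;> simp_all [Setoid.ker_def]

theorem perm_rel_iff (π : Equiv.Perm (Fin n)) (x y : Fin n ⊕ Fin n) :
    (perm π).rel x y ↔ Sum.elim id π x = Sum.elim id π y := Iff.rfl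

/-- `d * e` is the diagram obtained by juxtaposing `d` (on the left) and `e` (on the right) and
removing all components inside the equator. -/
instance : Mul (Diagram n) := ⟨fun d e => ⟨compRel d.rel e.rel, thin_compRel d.thin e.thin⟩⟩

instance : One (Diagram n) := ⟨perm 1⟩

/-- The right vertices of `d` are renamed along `π`. -/
def relabel (d : Diagram n) (π : Equiv.Perm (Fin n)) : Diagram n where
  rel := d.rel.comap (Sum.map id π)
  thin := by
    intro x y z h1 h2
    have hinj : Function.Injective (Sum.map id π : Fin n ⊕ Fin n → Fin n ⊕ Fin n) :=
      Function.Injective.sumMap Function.injective_id π.injective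
    rcases d.thin _ _ _ h1 h2 with h | h | h
    · exact Or.inl (hinj h)
    · exact Or.inr (Or.inl (hinj h))
    · exact Or.inr (Or.inr (hinj h))

theorem mul_rel (d e : Diagram n) : (d * e).rel = compRel d.rel e.rel := rfl

theorem colour_perm (π : Equiv.Perm (Fin n)) (s t : Fin n → Bool) :
    colour (perm π).rel s t = if s = t ∘ π.symm then 1 else 0 := by
  classical
  unfold colour
  congr 1
  apply propext
  constructor
  · intro h
    funext i
    exact h (Sum.inl i) (Sum.inr (π.symm i)) (by simp [perm_rel_iff])
  · rintro rfl x y h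
    have hs : ∀ x, Sum.elim (t ∘ π.symm) t x = t (π.symm (Sum.elim id π x)) := by
      rintro (x | x) <;> simp
    rw [hs, hs, (perm_rel_iff π x y).1 h]

theorem mul_perm_aux (d : Diagram n) (π : Equiv.Perm (Fin n)) :
    compRel d.rel (perm π).rel = (d.relabel π).rel ∧
      Nat.card {c // IsInner d.rel (perm π).rel c} = 0 := by
  classical
  apply eq_of_scaled
  intro s t
  rw [← sum_colour, pow_zero, one_mul]
  simp only [colour_perm, mul_ite, mul_one, mul_zero, Finset.sum_ite_eq', Finset.mem_univ, if_true]
  unfold colour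
  congr 1
  apply propext
  have hs : ∀ x, Sum.elim s (t ∘ π.symm) (Sum.map id π x) = Sum.elim s t x := by
    rintro (x | x) <;> simp
  constructor
  · intro h x y hxy
    have := h _ _ hxy
    rwa [hs, hs] at this
  · intro h x y hxy
    have hs' : ∀ x : Fin n ⊕ Fin n, Sum.map id π (Sum.map id π.symm x) = x := by
      rintro (x | x) <;> simp
    have := h (Sum.map id π.symm x) (Sum.map id π.symm y) (by
      change d.rel _ _
      rwa [hs', hs'])
    rwa [← hs, ← hs, hs', hs'] at this

theorem one_mul_aux (d : Diagram n) :
    compRel (1 : Diagram n).rel d.rel = d.rel ∧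
      Nat.card {c // IsInner (1 : Diagram n).rel d.rel c} = 0 := by
  classical
  apply eq_of_scaled
  intro s t
  rw [← sum_colour, pow_zero, one_mul]
  have : ∀ u, colour (1 : Diagram n).rel s u = if s = u then 1 else 0 := fun u => colour_perm 1 s u
  simp only [this, ite_mul, one_mul, zero_mul, Finset.sum_ite_eq, Finset.mem_univ, if_true]

theorem mul_perm (d : Diagram n) (π : Equiv.Perm (Fin n)) : d * perm π = d.relabel π :=
  Diagram.ext (mul_perm_aux d π).1

instance : Monoid (Diagram n) where
  mul_assoc d e f := Diagram.ext (comp_assoc_aux d.rel e.rel f.rel).1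
  one_mul d := Diagram.ext (one_mul_aux d).1
  mul_one d := by
    change d * perm 1 = d
    rw [mul_perm]
    apply Diagram.ext
    ext x y
    change d.rel _ _ ↔ _
    rcases x with x | x <;> rcases y with y | y <;> rfl

theorem strings_assoc (d e f : Diagram n) :
    strings d.rel e.rel + strings (d * e).rel f.rel =
      strings e.rel f.rel + strings d.rel (e * f).rel := by
  have h1 := singletons_comp d.thin e.thin
  have h2 := singletons_comp (d * e).thin f.thin
  have h3 := singletons_comp e.thin f.thin
  have h4 := singletons_comp d.thin (e * f).thin
  have h5 : compRel (d * e).rel f.rel = compRel d.rel (e * f).rel :=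
    (comp_assoc_aux d.rel e.rel f.rel).1
  rw [h5] at h2
  rw [← mul_rel] at h1 h3
  omega

theorem loops_assoc (d e f : Diagram n) :
    loops d.rel e.rel + loops (d * e).rel f.rel =
      loops e.rel f.rel + loops d.rel (e * f).rel := by
  have h := (comp_assoc_aux d.rel e.rel f.rel).2
  have hs := strings_assoc d e f
  rw [← mul_rel, ← mul_rel, ← loops_add_strings, ← loops_add_strings, ← loops_add_strings,
    ← loops_add_strings] at h
  omega

/-- The straightening factor: `δ` for each removed loop, `ε` for each removed open string. -/
noncomputable def factor (δ ε : ℂ) (d e : Diagram n) : ℂ :=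
  δ ^ loops d.rel e.rel * ε ^ strings d.rel e.rel

theorem factor_assoc (δ ε : ℂ) (d e f : Diagram n) :
    factor δ ε d e * factor δ ε (d * e) f = factor δ ε e f * factor δ ε d (e * f) := by
  unfold factor
  rw [mul_mul_mul_comm, ← pow_add, ← pow_add, strings_assoc, loops_assoc, pow_add, pow_add,
    mul_mul_mul_comm]

theorem factor_perm (δ ε : ℂ) (d : Diagram n) (π : Equiv.Perm (Fin n)) :
    factor δ ε d (perm π) = 1 := by
  have h := (mul_perm_aux d π).2
  rw [← loops_add_strings] at h
  unfold factor
  rw [(by omega : loops d.rel (perm π).rel = 0), (by omega : strings d.rel (perm π).rel = 0)]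
  simp

theorem factor_one_left (δ ε : ℂ) (d : Diagram n) : factor δ ε 1 d = 1 := by
  have h := (one_mul_aux d).2
  rw [← loops_add_strings] at h
  unfold factor
  rw [(by omega : loops (1 : Diagram n).rel d.rel = 0),
    (by omega : strings (1 : Diagram n).rel d.rel = 0)]
  simp

theorem factor_one_right (δ ε : ℂ) (d : Diagram n) : factor δ ε d 1 = 1 := factor_perm δ ε d 1

/-- A Brauer diagram: all parts are pairs. -/
def IsBrauer (d : Diagram n) : Prop := ∀ x, ¬ IsSingleton d.rel x

theorem isBrauer_iff (d : Diagram n) : d.IsBrauer ↔ singletons d.rel = 0 := by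
  unfold singletons
  rw [Finite.card_eq_zero_iff, isEmpty_subtype]
  rfl

theorem IsBrauer.mul {d e : Diagram n} (hd : d.IsBrauer) (he : e.IsBrauer) :
    (d * e).IsBrauer := by
  have h := singletons_comp d.thin e.thin
  rw [isBrauer_iff] at *
  rw [mul_rel]
  omega

theorem isBrauer_perm (π : Equiv.Perm (Fin n)) : (perm π).IsBrauer := by
  rintro (x | x) h
  · have := h (Sum.inr (π.symm x)) (by simp [perm_rel_iff])
    cases this
  · have := h (Sum.inl (π x)) (by simp [perm_rel_iff])
    cases this

theorem isBrauer_one : (1 : Diagram n).IsBrauer := isBrauer_perm 1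

open Classical in
/-- The right ends of the propagating lines of `d`. -/
noncomputable def rightEnds (d : Diagram n) : Finset (Fin n) :=
  {j | ∃ i, d.rel (Sum.inl i) (Sum.inr j)}

/-- The propagating number: the number of propagating lines. -/
noncomputable abbrev propNumber (d : Diagram n) : ℕ := d.rightEnds.card

/-- The number of singletons among the left vertices `1, …, n`. -/
noncomputable def leftSingletons (d : Diagram n) : ℕ :=
  Nat.card {i : Fin n // IsSingleton d.rel (Sum.inl i)}

/-- Two diagrams lie in the same left cell if they have the same parts inside `{1', …, n'}`. -/
def leftCell (n : ℕ) : Setoid (Diagram n) where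
  r d e := ∀ X : Set (Fin n), Sum.inr '' X ∈ d.rel.classes ↔ Sum.inr '' X ∈ e.rel.classes
  iseqv := ⟨fun _ _ => Iff.rfl, fun h X => (h X).symm, fun h h' X => (h X).trans (h' X)⟩

end Diagram

/-! ### The algebras -/

/-- The partial Brauer algebra with parameters `δ` (for loops) and `ε` (for open strings). -/
def PBAlgebra (n : ℕ) (_δ _ε : ℂ) : Type := Diagram n →₀ ℂ

namespace PBAlgebra
variable {n : ℕ} {δ ε : ℂ}

noncomputable instance : AddCommGroup (PBAlgebra n δ ε) :=
  inferInstanceAs (AddCommGroup (Diagram n →₀ ℂ))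

noncomputable instance : Module ℂ (PBAlgebra n δ ε) :=
  inferInstanceAs (Module ℂ (Diagram n →₀ ℂ))

/-- A diagram as an element of the algebra. -/
noncomputable def of (d : Diagram n) : PBAlgebra n δ ε := (Finsupp.single d 1 : Diagram n →₀ ℂ)

/-- The diagrams form a basis. -/
noncomputable def basis (n : ℕ) (δ ε : ℂ) : Module.Basis (Diagram n) ℂ (PBAlgebra n δ ε) :=
  ⟨LinearEquiv.refl ℂ (Diagram n →₀ ℂ)⟩

theorem basis_apply (d : Diagram n) : basis n δ ε d = of d := rfl

/-- The bilinear multiplication with `d · e = factor d e • (d * e)`. -/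
noncomputable def mulHom (n : ℕ) (δ ε : ℂ) :
    PBAlgebra n δ ε →ₗ[ℂ] PBAlgebra n δ ε →ₗ[ℂ] PBAlgebra n δ ε :=
  (basis n δ ε).constr ℂ fun d => (basis n δ ε).constr ℂ fun e =>
    Diagram.factor δ ε d e • of (d * e)

theorem mulHom_of (d e : Diagram n) :
    mulHom n δ ε (of d) (of e) = Diagram.factor δ ε d e • of (d * e) := by
  unfold mulHom
  rw [← basis_apply, ← basis_apply, Module.Basis.constr_basis, Module.Basis.constr_basis]

noncomputable instance : Mul (PBAlgebra n δ ε) := ⟨fun a b => mulHom n δ ε a b⟩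

noncomputable instance : One (PBAlgebra n δ ε) := ⟨of 1⟩

theorem mul_def (a b : PBAlgebra n δ ε) : a * b = mulHom n δ ε a b := rfl

theorem one_def : (1 : PBAlgebra n δ ε) = of 1 := rfl

theorem of_mul_of (d e : Diagram n) :
    (of d * of e : PBAlgebra n δ ε) = Diagram.factor δ ε d e • of (d * e) := mulHom_of d e

/-- Induction over the diagram basis. -/
theorem induction {P : PBAlgebra n δ ε → Prop} (h0 : P 0) (hadd : ∀ a b, P a → P b → P (a + b))
    (hsmul : ∀ (c : ℂ) a, P a → P (c • a)) (hof : ∀ d, P (of d)) (a : PBAlgebra n δ ε) : P a := by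
  have ha : a ∈ Submodule.span ℂ (Set.range (basis n δ ε)) := by
    rw [(basis n δ ε).span_eq]; trivial
  induction ha using Submodule.span_induction with
  | mem x hx => obtain ⟨d, rfl⟩ := hx; exact hof d
  | zero => exact h0
  | add x y _ _ hx hy => exact hadd x y hx hy
  | smul c x _ hx => exact hsmul c x hx

noncomputable instance : Ring (PBAlgebra n δ ε) :=
  { (inferInstance : AddCommGroup (PBAlgebra n δ ε)),
    (inferInstance : Mul (PBAlgebra n δ ε)), (inferInstance : One (PBAlgebra n δ ε)) with
    left_distrib := fun a b c => by simp only [mul_def, map_add]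
    right_distrib := fun a b c => by simp only [mul_def, map_add, LinearMap.add_apply]
    zero_mul := fun a => by simp only [mul_def, map_zero, LinearMap.zero_apply]
    mul_zero := fun a => by simp only [mul_def, map_zero]
    mul_assoc := fun a b c => by
      induction a using induction with
      | h0 => simp only [mul_def, map_zero, LinearMap.zero_apply]
      | hadd a a' h h' => simp only [mul_def, map_add, LinearMap.add_apply] at *; rw [h, h']
      | hsmul r a h => simp only [mul_def, map_smul, LinearMap.smul_apply] at *; rw [h]
      | hof d =>
        induction b using induction with
        | h0 => simp only [mul_def, map_zero, LinearMap.zero_apply]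
        | hadd a a' h h' => simp only [mul_def, map_add, LinearMap.add_apply] at *; rw [h, h']
        | hsmul r a h => simp only [mul_def, map_smul, LinearMap.smul_apply] at *; rw [h]
        | hof e =>
          induction c using induction with
          | h0 => simp only [mul_def, map_zero]
          | hadd a a' h h' => simp only [mul_def, map_add] at *; rw [h, h']
          | hsmul r a h => simp only [mul_def, map_smul] at *; rw [h]
          | hof f =>
            rw [of_mul_of, of_mul_of, mul_def, mul_def, map_smul, map_smul, LinearMap.smul_apply,
              mulHom_of, mulHom_of, smul_smul, smul_smul, Diagram.factor_assoc, mul_assoc]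
    one_mul := fun a => by
      induction a using induction with
      | h0 => simp only [mul_def, map_zero]
      | hadd a a' h h' => simp only [mul_def, map_add] at *; rw [h, h']
      | hsmul r a h => simp only [mul_def, map_smul] at *; rw [h]
      | hof f => rw [one_def, of_mul_of, Diagram.factor_one_left, one_mul, one_smul]
    mul_one := fun a => by
      induction a using induction with
      | h0 => simp only [mul_def, map_zero, LinearMap.zero_apply]
      | hadd a a' h h' => simp only [mul_def, map_add, LinearMap.add_apply] at *; rw [h, h']
      | hsmul r a h => simp only [mul_def, map_smul, LinearMap.smul_apply] at *; rw [h]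
      | hof f => rw [one_def, of_mul_of, Diagram.factor_one_right, mul_one, one_smul] }

noncomputable instance : Algebra ℂ (PBAlgebra n δ ε) :=
  Algebra.ofModule
    (fun r a b => by simp only [mul_def, map_smul, LinearMap.smul_apply])
    (fun r a b => by simp only [mul_def, map_smul])

end PBAlgebra

/-- The Brauer algebra, as the subalgebra spanned by the Brauer diagrams (its multiplication
does not depend on `ε`, as no open strings occur). -/
noncomputable def brauer (n : ℕ) (δ ε : ℂ) : Subalgebra ℂ (PBAlgebra n δ ε) :=
  (Submodule.span ℂ (PBAlgebra.of '' {d : Diagram n | d.IsBrauer})).toSubalgebra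
    (Submodule.subset_span ⟨1, Diagram.isBrauer_one, rfl⟩)
    (fun a b ha hb => by
      induction ha, hb using Submodule.span_induction₂ with
      | mem_mem x y hx hy =>
        obtain ⟨d, hd, rfl⟩ := hx
        obtain ⟨e, he, rfl⟩ := hy
        rw [PBAlgebra.of_mul_of]
        exact Submodule.smul_mem _ _ (Submodule.subset_span ⟨_, hd.mul he, rfl⟩)
      | zero_left y hy => rw [zero_mul]; exact Submodule.zero_mem _
      | zero_right y hy => rw [mul_zero]; exact Submodule.zero_mem _
      | add_left x y z _ _ _ h h' => rw [add_mul]; exact Submodule.add_mem _ h h'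
      | add_right x y z _ _ _ h h' => rw [mul_add]; exact Submodule.add_mem _ h h'
      | smul_left r x y _ _ h => rw [smul_mul_assoc]; exact Submodule.smul_mem _ _ h
      | smul_right r x y _ _ h => rw [mul_smul_comm]; exact Submodule.smul_mem _ _ h)

/-! ### Left cells -/

namespace Diagram
variable {n : ℕ}

theorem mem_classes_mul (d e : Diagram n) {X : Set (Fin n)}
    (h : Sum.inr '' X ∈ e.rel.classes) : Sum.inr '' X ∈ (d * e).rel.classes := by
  obtain ⟨y, hy⟩ := h
  have hyX : y ∈ Sum.inr '' X := by rw [hy]; exact e.rel.refl y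
  obtain ⟨j, hj, rfl⟩ := hyX
  refine ⟨Sum.inr j, ?_⟩
  ext x
  constructor
  · rintro ⟨i, hi, rfl⟩
    have : e.rel (Sum.inr i) (Sum.inr j) := by
      have : (Sum.inr i : Fin n ⊕ Fin n) ∈ Sum.inr '' X := ⟨i, hi, rfl⟩
      rw [hy] at this
      exact this
    exact Relation.EqvGen.rel _ _ (Or.inr ⟨_, _, this, rfl, rfl⟩)
  · intro hx
    have key := (juxt_compat (p := d.rel) (q := e.rel)
      (fun v => ∃ i ∈ X, v = Sum.inr (Sum.inr i))).2 ⟨?_, ?_⟩ _ _ hx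
    · have : ∃ i ∈ X, outer x = (Sum.inr (Sum.inr i) : Fin n ⊕ Fin n ⊕ Fin n) := by
        rw [key]; exact ⟨j, hj, rfl⟩
      obtain ⟨i, hi, h⟩ := this
      rcases x with x | x
      · cases h
      · exact ⟨i, hi, (Sum.inr_injective h).symm⟩
    · have : ∀ x : Fin n ⊕ Fin n, ¬ ∃ i ∈ X, (Sum.map id Sum.inl x : Fin n ⊕ Fin n ⊕ Fin n) =
          Sum.inr (Sum.inr i) := by
        rintro (x | x) ⟨i, hi, h⟩ <;> cases h
      intro x y _
      exact propext ⟨fun h => absurd h (this x), fun h => absurd h (this y)⟩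
    · have : ∀ x : Fin n ⊕ Fin n, (∃ i ∈ X, (Sum.inr x : Fin n ⊕ Fin n ⊕ Fin n) =
          Sum.inr (Sum.inr i)) ↔ e.rel x (Sum.inr j) := by
        intro x
        have : x ∈ Sum.inr '' X ↔ e.rel x (Sum.inr j) := by rw [hy]; rfl
        rw [← this]
        constructor
        · rintro ⟨i, hi, h⟩
          exact ⟨i, hi, (Sum.inr_injective h).symm⟩
        · rintro ⟨i, hi, rfl⟩
          exact ⟨i, hi, rfl⟩
      intro x y hxy
      simp only [this]
      exact propext ⟨fun h => e.rel.trans (e.rel.symm hxy) h, fun h => e.rel.trans hxy h⟩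

theorem leftCell_of_mul {d₀ d e x : Diagram n} (hx : leftCell n d₀ x)
    (h : leftCell n d₀ (d * (e * x))) : leftCell n d₀ (e * x) := fun X =>
  ⟨fun hX => mem_classes_mul _ _ ((hx X).1 hX), fun hX => (h X).2 (mem_classes_mul _ _ hX)⟩

theorem mem_rightEnds {d : Diagram n} {j : Fin n} :
    j ∈ d.rightEnds ↔ ∀ X : Set (Fin n), Sum.inr '' X ∈ d.rel.classes → j ∉ X := by
  classical
  unfold rightEnds
  rw [Finset.mem_filter_univ]
  constructor
  · rintro ⟨i, hi⟩ X ⟨y, hy⟩ hj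
    have h1 : d.rel (Sum.inr j) y := by
      have : (Sum.inr j : Fin n ⊕ Fin n) ∈ Sum.inr '' X := ⟨j, hj, rfl⟩
      rw [hy] at this
      exact this
    have h2 : (Sum.inl i : Fin n ⊕ Fin n) ∈ Sum.inr '' X := by
      rw [hy]; exact d.rel.trans hi h1
    obtain ⟨_, _, h⟩ := h2
    cases h
  · intro h
    by_contra! hn
    refine h {i | d.rel (Sum.inr i) (Sum.inr j)} ⟨Sum.inr j, ?_⟩ (d.rel.refl _)
    ext x
    constructor
    · rintro ⟨i, hi, rfl⟩
      exact hi
    · intro hx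
      rcases x with x | x
      · exact absurd hx (hn x)
      · exact ⟨x, hx, rfl⟩

theorem rightEnds_eq {d e : Diagram n} (h : leftCell n d e) : e.rightEnds = d.rightEnds := by
  ext j
  rw [mem_rightEnds, mem_rightEnds]
  exact forall_congr' fun X => by rw [h X]

theorem isSingleton_inr (d : Diagram n) (j : Fin n) :
    IsSingleton d.rel (Sum.inr j) ↔ Sum.inr '' {j} ∈ d.rel.classes := by
  constructor
  · intro h
    refine ⟨Sum.inr j, ?_⟩
    ext x
    rw [Set.image_singleton, Set.mem_singleton_iff]
    constructor
    · rintro rfl; exact d.rel.refl _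
    · intro hx; exact h x (d.rel.symm hx)
  · rintro ⟨y, hy⟩ x hx
    rw [Set.image_singleton] at hy
    have h1 : (Sum.inr j : Fin n ⊕ Fin n) ∈ {x | d.rel x y} := by rw [← hy]; rfl
    have h2 : x ∈ {x | d.rel x y} := d.rel.trans (d.rel.symm hx) h1
    rw [← hy] at h2
    exact h2

theorem singletons_eq (d : Diagram n) : singletons d.rel =
    d.leftSingletons + Nat.card {j : Fin n // IsSingleton d.rel (Sum.inr j)} := by
  unfold singletons leftSingletons
  rw [← Nat.card_sum]
  exact Nat.card_congr Equiv.subtypeSum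

/-- The number of left singletons cannot decrease inside a left cell if no open string occurs. -/
theorem leftSingletons_le {d₀ d x : Diagram n} (hx : leftCell n d₀ x)
    (h : leftCell n d₀ (d * x)) (hs : strings d.rel x.rel = 0) :
    x.leftSingletons ≤ (d * x).leftSingletons := by
  have h1 := singletons_comp d.thin x.thin
  have h2 := singletons_eq x
  have h3 := singletons_eq (d * x)
  have h4 : Nat.card {j : Fin n // IsSingleton x.rel (Sum.inr j)} =
      Nat.card {j : Fin n // IsSingleton (d * x).rel (Sum.inr j)} := by
    simp only [isSingleton_inr, ← hx _, ← h _]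
  rw [← mul_rel] at h1
  omega

theorem relabel_relabel (d : Diagram n) (π ρ : Equiv.Perm (Fin n)) :
    (d.relabel π).relabel ρ = d.relabel (π * ρ) := by
  apply Diagram.ext
  ext x y
  change d.rel _ _ ↔ d.rel _ _
  rcases x with x | x <;> rcases y with y | y <;> rfl

theorem relabel_one (d : Diagram n) : d.relabel 1 = d := by
  rw [← mul_perm]
  exact mul_one d

theorem mem_classes_relabel {d : Diagram n} {π : Equiv.Perm (Fin n)}
    (hπ : ∀ j ∉ d.rightEnds, π j = j) {X : Set (Fin n)} (hX : Sum.inr '' X ∈ d.rel.classes) :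
    Sum.inr '' X ∈ (d.relabel π).rel.classes := by
  have hfix : ∀ j ∈ X, π j = j := fun j hj => hπ j fun h => mem_rightEnds.1 h X hX hj
  obtain ⟨y, hy⟩ := hX
  have hyX : y ∈ Sum.inr '' X := by rw [hy]; exact d.rel.refl y
  obtain ⟨j, hj, rfl⟩ := hyX
  refine ⟨Sum.inr j, ?_⟩
  ext x
  change _ ↔ d.rel (Sum.map id π x) (Sum.inr (π j))
  rw [hfix j hj]
  have : d.rel (Sum.map id π x) (Sum.inr j) ↔ Sum.map id π x ∈ Sum.inr '' X := by rw [hy]; rfl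
  rw [this]
  constructor
  · rintro ⟨i, hi, rfl⟩
    exact ⟨i, hi, by simp [hfix i hi]⟩
  · rintro ⟨i, hi, h⟩
    rcases x with x | x
    · cases h
    · have h' : i = π x := Sum.inr_injective h
      have : π i = π x := by rw [hfix i hi, h']
      exact ⟨i, hi, by rw [π.injective this]⟩

theorem leftCell_relabel {d : Diagram n} {π : Equiv.Perm (Fin n)}
    (hπ : ∀ j ∉ d.rightEnds, π j = j) : leftCell n d (d.relabel π) := by
  intro X
  refine ⟨mem_classes_relabel hπ, fun hX => ?_⟩
  have h := mem_classes_relabel (d := d.relabel π) (π := π⁻¹) ?_ hX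
  · rwa [relabel_relabel, mul_inv_cancel, relabel_one] at h
  · intro j hj
    have hj' : π j ∉ d.rightEnds := by
      intro h
      apply hj
      classical
      unfold rightEnds at h ⊢
      rw [Finset.mem_filter_univ] at h ⊢
      exact h
    have := π.injective (hπ _ hj')
    rw [Equiv.Perm.inv_eq_iff_eq]
    exact this.symm

/-- `σ ∈ S_k` as a permutation of the right ends `r_1 < ⋯ < r_k` of the propagating lines in the
left cell of `d₀`; it fixes all other vertices. -/
noncomputable def permEnds (d₀ : Diagram n) {k : ℕ} (hk : d₀.propNumber = k)
    (σ : Equiv.Perm (Fin k)) : Equiv.Perm (Fin n) :=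
  σ.viaEmbedding (d₀.rightEnds.orderEmbOfFin hk).toEmbedding

theorem permEnds_fix (d₀ : Diagram n) {k : ℕ} (hk : d₀.propNumber = k)
    (σ : Equiv.Perm (Fin k)) (j : Fin n) (hj : j ∉ d₀.rightEnds) : d₀.permEnds hk σ j = j := by
  apply Equiv.Perm.viaEmbedding_apply_of_notMem
  change j ∉ Set.range (d₀.rightEnds.orderEmbOfFin hk)
  rwa [Finset.range_orderEmbOfFin]

theorem leftCell_permEnds {d₀ x : Diagram n} (hx : leftCell n d₀ x) {k : ℕ}
    (hk : d₀.propNumber = k) (σ : Equiv.Perm (Fin k)) :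
    leftCell n d₀ (x.relabel (d₀.permEnds hk σ)) :=
  (leftCell n).trans hx (leftCell_relabel fun j hj =>
    permEnds_fix d₀ hk σ j (by rwa [rightEnds_eq hx] at hj))

theorem leftSingletons_relabel (d : Diagram n) (π : Equiv.Perm (Fin n)) :
    (d.relabel π).leftSingletons = d.leftSingletons := by
  unfold leftSingletons
  refine Nat.card_congr (Equiv.subtypeEquivRight fun i => ?_)
  have hinj : Function.Injective (Sum.map id π : Fin n ⊕ Fin n → Fin n ⊕ Fin n) :=
    Function.Injective.sumMap Function.injective_id π.injective
  have hs' : ∀ x : Fin n ⊕ Fin n, Sum.map id π (Sum.map id π.symm x) = x := by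
    rintro (x | x) <;> simp
  constructor
  · intro h y hy
    have := h (Sum.map id π.symm y) (by
      change d.rel _ _
      rw [hs']
      exact hy)
    rw [← hs' y, this]
    rfl
  · intro h y hy
    exact hinj (h _ hy)

theorem IsBrauer.relabel {d : Diagram n} (hd : d.IsBrauer) (π : Equiv.Perm (Fin n)) :
    (d.relabel π).IsBrauer := by
  rw [← mul_perm]
  exact hd.mul (isBrauer_perm π)

theorem factor_relabel (δ ε : ℂ) (d e : Diagram n) (π : Equiv.Perm (Fin n)) :
    factor δ ε d (e.relabel π) = factor δ ε d e := by
  have h := factor_assoc δ ε d e (perm π)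
  rw [factor_perm, factor_perm, mul_one, one_mul, mul_perm] at h
  exact h.symm

theorem mul_relabel (d e : Diagram n) (π : Equiv.Perm (Fin n)) :
    d * e.relabel π = (d * e).relabel π := by
  rw [← mul_perm, ← mul_perm, mul_assoc]

end Diagram

/-! ### Cell modules -/

/-- The cell module: its basis is the left cell of `d₀`. -/
def CellModule {n : ℕ} (_δ _ε : ℂ) (d₀ : Diagram n) : Type :=
  {d : Diagram n // Diagram.leftCell n d₀ d} →₀ ℂ

namespace CellModule
variable {n : ℕ} {δ ε : ℂ} {d₀ : Diagram n}
open Diagram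

noncomputable instance : AddCommGroup (CellModule δ ε d₀) :=
  inferInstanceAs (AddCommGroup ({d : Diagram n // leftCell n d₀ d} →₀ ℂ))

noncomputable instance : Module ℂ (CellModule δ ε d₀) :=
  inferInstanceAs (Module ℂ ({d : Diagram n // leftCell n d₀ d} →₀ ℂ))

/-- The left cell is a basis of the cell module. -/
noncomputable def basis (δ ε : ℂ) (d₀ : Diagram n) :
    Module.Basis {d : Diagram n // leftCell n d₀ d} ℂ (CellModule δ ε d₀) :=
  ⟨LinearEquiv.refl ℂ ({d : Diagram n // leftCell n d₀ d} →₀ ℂ)⟩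

theorem induction {P : CellModule δ ε d₀ → Prop} (h0 : P 0)
    (hadd : ∀ a b, P a → P b → P (a + b))
    (hsmul : ∀ (c : ℂ) a, P a → P (c • a)) (hof : ∀ d, P (basis δ ε d₀ d))
    (a : CellModule δ ε d₀) : P a := by
  have ha : a ∈ Submodule.span ℂ (Set.range (basis δ ε d₀)) := by
    rw [(basis δ ε d₀).span_eq]; trivial
  induction ha using Submodule.span_induction with
  | mem x hx => obtain ⟨d, rfl⟩ := hx; exact hof d
  | zero => exact h0
  | add x y _ _ hx hy => exact hadd x y hx hy
  | smul c x _ hx => exact hsmul c x hx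

open Classical in
/-- The action of a diagram on an element of the left cell: the product in the algebra if this
lies in the cell module, and `0` otherwise. -/
noncomputable def actBasis (δ ε : ℂ) (d₀ d : Diagram n) (x : {d : Diagram n // leftCell n d₀ d}) :
    CellModule δ ε d₀ :=
  if h : leftCell n d₀ (d * x.1) then factor δ ε d x.1 • basis δ ε d₀ ⟨d * x.1, h⟩ else 0

/-- The bilinear extension of `actBasis`. -/
noncomputable def actHom (δ ε : ℂ) (d₀ : Diagram n) :
    PBAlgebra n δ ε →ₗ[ℂ] CellModule δ ε d₀ →ₗ[ℂ] CellModule δ ε d₀ :=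
  (PBAlgebra.basis n δ ε).constr ℂ fun d => (basis δ ε d₀).constr ℂ fun x => actBasis δ ε d₀ d x

theorem actHom_of (d : Diagram n) (x : {d : Diagram n // leftCell n d₀ d}) :
    actHom δ ε d₀ (PBAlgebra.of d) (basis δ ε d₀ x) = actBasis δ ε d₀ d x := by
  unfold actHom
  rw [← PBAlgebra.basis_apply, Module.Basis.constr_basis, Module.Basis.constr_basis]

theorem actHom_mul (a b : PBAlgebra n δ ε) (x : CellModule δ ε d₀) :
    actHom δ ε d₀ (a * b) x = actHom δ ε d₀ a (actHom δ ε d₀ b x) := by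
  induction a using PBAlgebra.induction with
  | h0 => simp only [zero_mul, map_zero, LinearMap.zero_apply]
  | hadd a a' h h' => simp only [add_mul, map_add, LinearMap.add_apply, h, h']
  | hsmul r a h => simp only [smul_mul_assoc, map_smul, LinearMap.smul_apply, h]
  | hof d =>
    induction b using PBAlgebra.induction with
    | h0 => simp only [mul_zero, map_zero, LinearMap.zero_apply]
    | hadd a a' h h' => simp only [mul_add, map_add, LinearMap.add_apply, h, h']
    | hsmul r a h => simp only [mul_smul_comm, map_smul, LinearMap.smul_apply, h]
    | hof e =>
      induction x using induction with
      | h0 => simp only [map_zero]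
      | hadd a a' h h' => simp only [map_add, h, h']
      | hsmul r a h => simp only [map_smul, h]
      | hof x =>
        rw [PBAlgebra.of_mul_of, map_smul, LinearMap.smul_apply, actHom_of, actHom_of]
        unfold actBasis
        by_cases h : leftCell n d₀ (d * e * x.1)
        · have h' : leftCell n d₀ (e * x.1) := leftCell_of_mul x.2 (by rwa [← mul_assoc])
          have h'' : leftCell n d₀ (d * (e * x.1)) := by rwa [← mul_assoc]
          rw [dif_pos h, dif_pos h', map_smul, actHom_of]
          unfold actBasis
          rw [dif_pos h'', smul_smul, smul_smul, factor_assoc]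
          simp only [mul_assoc]
        · rw [dif_neg h, smul_zero]
          by_cases h' : leftCell n d₀ (e * x.1)
          · rw [dif_pos h', map_smul, actHom_of]
            unfold actBasis
            rw [dif_neg (by rwa [← mul_assoc]), smul_zero]
          · rw [dif_neg h', map_zero]

theorem actHom_one (x : CellModule δ ε d₀) : actHom δ ε d₀ 1 x = x := by
  induction x using induction with
  | h0 => simp only [map_zero]
  | hadd a a' h h' => simp only [map_add, h, h']
  | hsmul r a h => simp only [map_smul, h]
  | hof x =>
    rw [PBAlgebra.one_def, actHom_of]
    unfold actBasis
    have h : leftCell n d₀ (1 * x.1) := by rw [one_mul]; exact x.2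
    rw [dif_pos h, factor_one_left, one_smul]
    simp only [one_mul]

noncomputable instance : Module (PBAlgebra n δ ε) (CellModule δ ε d₀) where
  smul a x := actHom δ ε d₀ a x
  one_smul x := actHom_one x
  mul_smul a b x := actHom_mul a b x
  smul_zero a := map_zero (actHom δ ε d₀ a)
  smul_add a x y := map_add (actHom δ ε d₀ a) x y
  add_smul a b x := by
    change actHom δ ε d₀ (a + b) x = actHom δ ε d₀ a x + actHom δ ε d₀ b x
    rw [map_add, LinearMap.add_apply]
  zero_smul x := by
    change actHom δ ε d₀ 0 x = 0
    rw [map_zero, LinearMap.zero_apply]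

theorem smul_def (a : PBAlgebra n δ ε) (x : CellModule δ ε d₀) : a • x = actHom δ ε d₀ a x := rfl

instance : IsScalarTower ℂ (PBAlgebra n δ ε) (CellModule δ ε d₀) where
  smul_assoc r a x := by
    rw [smul_def, smul_def, map_smul, LinearMap.smul_apply]

theorem of_smul_basis (d : Diagram n) (x : {d : Diagram n // leftCell n d₀ d}) :
    (PBAlgebra.of d : PBAlgebra n δ ε) • basis δ ε d₀ x = actBasis δ ε d₀ d x := actHom_of d x

/-- The right action of `σ ∈ S_k` on the cell module, permuting the right ends of the propagating
lines: in `x · σ` the right end `r_j` is connected with what `r_(σ j)` is connected with in `x`. -/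
noncomputable def rightAct (δ ε : ℂ) (d₀ : Diagram n) {k : ℕ} (hk : d₀.propNumber = k)
    (σ : Equiv.Perm (Fin k)) : CellModule δ ε d₀ →ₗ[PBAlgebra n δ ε] CellModule δ ε d₀ :=
  let f : CellModule δ ε d₀ →ₗ[ℂ] CellModule δ ε d₀ := (basis δ ε d₀).constr ℂ fun x =>
    basis δ ε d₀ ⟨x.1.relabel (d₀.permEnds hk σ), leftCell_permEnds x.2 hk σ⟩
  { f with
    map_smul' := fun a x => by
      change f (a • x) = a • f x
      have hf : ∀ x, f (basis δ ε d₀ x) =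
          basis δ ε d₀ ⟨x.1.relabel (d₀.permEnds hk σ), leftCell_permEnds x.2 hk σ⟩ :=
        fun x => (basis δ ε d₀).constr_basis ℂ _ x
      induction a using PBAlgebra.induction with
      | h0 => simp only [zero_smul, map_zero]
      | hadd a a' h h' => simp only [add_smul, map_add, h, h']
      | hsmul r a h => simp only [smul_assoc, map_smul, h]
      | hof d =>
        induction x using induction with
        | h0 => simp only [smul_zero, map_zero]
        | hadd a a' h h' => simp only [smul_add, map_add, h, h']
        | hsmul r a h => simp only [smul_comm _ r, map_smul, h]
        | hof x =>
          rw [hf, of_smul_basis, of_smul_basis]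
          unfold actBasis
          have hiff : leftCell n d₀ (d * x.1.relabel (d₀.permEnds hk σ)) ↔
              leftCell n d₀ (d * x.1) := by
            rw [mul_relabel]
            constructor
            · intro h
              have h' := (leftCell n).trans h (leftCell_relabel (π := (d₀.permEnds hk σ)⁻¹)
                fun j hj => by
                  rw [rightEnds_eq h] at hj
                  rw [Equiv.Perm.inv_eq_iff_eq]
                  exact (permEnds_fix d₀ hk σ j hj).symm)
              rwa [relabel_relabel, mul_inv_cancel, relabel_one] at h'
            · intro h
              exact leftCell_permEnds h hk σ
          by_cases h : leftCell n d₀ (d * x.1)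
          · rw [dif_pos h, dif_pos (hiff.2 h), map_smul, hf, factor_relabel]
            simp only [mul_relabel]
          · rw [dif_neg h, dif_neg fun h' => h (hiff.1 h'), map_zero] }

theorem rightAct_basis {k : ℕ} (hk : d₀.propNumber = k) (σ : Equiv.Perm (Fin k))
    (x : {d : Diagram n // leftCell n d₀ d}) :
    rightAct δ ε d₀ hk σ (basis δ ε d₀ x) =
      basis δ ε d₀ ⟨x.1.relabel (d₀.permEnds hk σ), leftCell_permEnds x.2 hk σ⟩ :=
  (basis δ ε d₀).constr_basis ℂ _ x

end CellModule

section Filtration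
variable {n : ℕ}
open Diagram CellModule

/-- The span of all diagrams in the left cell of `d₀` with at least `l` singletons among the left
vertices. For `ε = 0` it is a submodule of the cell module. -/
noncomputable def filt (δ : ℂ) (d₀ : Diagram n) (l : ℕ) :
    Submodule (PBAlgebra n δ 0) (CellModule δ 0 d₀) where
  __ := Submodule.span ℂ (basis δ 0 d₀ '' {x | l ≤ x.1.leftSingletons})
  smul_mem' a x hx := by
    change a • x ∈ Submodule.span ℂ (basis δ 0 d₀ '' {x | l ≤ x.1.leftSingletons})
    change x ∈ Submodule.span ℂ (basis δ 0 d₀ '' {x | l ≤ x.1.leftSingletons}) at hx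
    induction a using PBAlgebra.induction with
    | h0 => rw [zero_smul]; exact Submodule.zero_mem _
    | hadd a a' h h' => rw [add_smul]; exact Submodule.add_mem _ h h'
    | hsmul r a h => rw [smul_assoc]; exact Submodule.smul_mem _ _ h
    | hof d =>
      induction hx using Submodule.span_induction with
      | zero => rw [smul_zero]; exact Submodule.zero_mem _
      | add x y _ _ hx hy => rw [smul_add]; exact Submodule.add_mem _ hx hy
      | smul c x _ hx => rw [smul_comm]; exact Submodule.smul_mem _ _ hx
      | mem x hx =>
        obtain ⟨x, hx, rfl⟩ := hx
        rw [of_smul_basis]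
        unfold actBasis
        split_ifs with h
        · by_cases hs : strings d.rel x.1.rel = 0
          · exact Submodule.smul_mem _ _ (Submodule.subset_span
              ⟨_, le_trans hx (leftSingletons_le x.2 h hs), rfl⟩)
          · unfold factor
            rw [zero_pow hs, mul_zero, zero_smul]
            exact Submodule.zero_mem _
        · exact Submodule.zero_mem _

theorem rightAct_mem_filt (δ : ℂ) (d₀ : Diagram n) {k : ℕ} (hk : d₀.propNumber = k)
    (σ : Equiv.Perm (Fin k)) (l : ℕ) {x : CellModule δ 0 d₀} (hx : x ∈ filt δ d₀ l) :
    rightAct δ 0 d₀ hk σ x ∈ filt δ d₀ l := by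
  change x ∈ Submodule.span ℂ (basis δ 0 d₀ '' {x | l ≤ x.1.leftSingletons}) at hx
  change _ ∈ Submodule.span ℂ (basis δ 0 d₀ '' {x | l ≤ x.1.leftSingletons})
  induction hx using Submodule.span_induction with
  | zero => rw [map_zero]; exact Submodule.zero_mem _
  | add x y _ _ hx hy => rw [map_add]; exact Submodule.add_mem _ hx hy
  | smul c x _ hx =>
    rw [LinearMap.map_smul_of_tower]; exact Submodule.smul_mem _ _ hx
  | mem x hx =>
    obtain ⟨x, hx, rfl⟩ := hx
    rw [rightAct_basis]
    refine Submodule.subset_span ⟨_, ?_, rfl⟩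
    rw [Set.mem_ofPred_eq, leftSingletons_relabel]
    exact hx

/-- The section of the filtration of the cell module by the number of left singletons. -/
abbrev CellSection (δ : ℂ) (d₀ : Diagram n) (l : ℕ) : Type :=
  filt δ d₀ l ⧸ (filt δ d₀ (l + 2)).submoduleOf (filt δ d₀ l)

/-- The right action of `S_k` on a section. -/
noncomputable def sectionRightAct (δ : ℂ) (d₀ : Diagram n) {k : ℕ} (hk : d₀.propNumber = k)
    (l : ℕ) (σ : Equiv.Perm (Fin k)) :
    CellSection δ d₀ l →ₗ[PBAlgebra n δ 0] CellSection δ d₀ l :=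
  Submodule.mapQ _ _
    ((rightAct δ 0 d₀ hk σ).restrict fun _ hx => rightAct_mem_filt δ d₀ hk σ l hx)
    (fun _ hx => rightAct_mem_filt δ d₀ hk σ (l + 2) hx)

/-- The cell module of the Brauer algebra: the span of the Brauer diagrams in the left cell. -/
noncomputable def brauerCell (δ ε : ℂ) (d₀ : Diagram n) :
    Submodule (brauer n δ ε) (CellModule δ ε d₀) where
  __ := Submodule.span ℂ (basis δ ε d₀ '' {x | x.1.IsBrauer})
  smul_mem' a x hx := by
    obtain ⟨a, ha⟩ := a
    change a • x ∈ Submodule.span ℂ (basis δ ε d₀ '' {x | x.1.IsBrauer})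
    change x ∈ Submodule.span ℂ (basis δ ε d₀ '' {x | x.1.IsBrauer}) at hx
    change a ∈ Submodule.span ℂ (PBAlgebra.of '' {d : Diagram n | d.IsBrauer}) at ha
    induction ha using Submodule.span_induction with
    | zero => rw [zero_smul]; exact Submodule.zero_mem _
    | add a a' _ _ h h' => rw [add_smul]; exact Submodule.add_mem _ h h'
    | smul r a _ h => rw [smul_assoc]; exact Submodule.smul_mem _ _ h
    | mem d hd =>
      obtain ⟨d, hd, rfl⟩ := hd
      induction hx using Submodule.span_induction with
      | zero => rw [smul_zero]; exact Submodule.zero_mem _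
      | add x y _ _ hx hy => rw [smul_add]; exact Submodule.add_mem _ hx hy
      | smul c x _ hx => rw [smul_comm]; exact Submodule.smul_mem _ _ hx
      | mem x hx =>
        obtain ⟨x, hx, rfl⟩ := hx
        rw [of_smul_basis]
        unfold actBasis
        split_ifs with h
        · exact Submodule.smul_mem _ _ (Submodule.subset_span ⟨_, IsBrauer.mul hd hx, rfl⟩)
        · exact Submodule.zero_mem _

theorem rightAct_mem_brauerCell (δ ε : ℂ) (d₀ : Diagram n) {k : ℕ} (hk : d₀.propNumber = k)
    (σ : Equiv.Perm (Fin k)) {x : CellModule δ ε d₀} (hx : x ∈ brauerCell δ ε d₀) :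
    rightAct δ ε d₀ hk σ x ∈ brauerCell δ ε d₀ := by
  change x ∈ Submodule.span ℂ (basis δ ε d₀ '' {x | x.1.IsBrauer}) at hx
  change _ ∈ Submodule.span ℂ (basis δ ε d₀ '' {x | x.1.IsBrauer})
  induction hx using Submodule.span_induction with
  | zero => rw [map_zero]; exact Submodule.zero_mem _
  | add x y _ _ hx hy => rw [map_add]; exact Submodule.add_mem _ hx hy
  | smul c x _ hx =>
    rw [LinearMap.map_smul_of_tower]; exact Submodule.smul_mem _ _ hx
  | mem x hx =>
    obtain ⟨x, hx, rfl⟩ := hx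
    rw [rightAct_basis]
    exact Submodule.subset_span ⟨_, IsBrauer.relabel hx _, rfl⟩

/-- The right action of `S_k` on the cell module of the Brauer algebra. -/
noncomputable def brauerRightAct (δ ε : ℂ) (d₀ : Diagram n) {k : ℕ} (hk : d₀.propNumber = k)
    (σ : Equiv.Perm (Fin k)) :
    brauerCell δ ε d₀ →ₗ[brauer n δ ε] brauerCell δ ε d₀ :=
  ((rightAct δ ε d₀ hk σ).restrictScalars (brauer n δ ε)).restrict
    fun _ hx => rightAct_mem_brauerCell δ ε d₀ hk σ hx

end Filtration

/-! ### Specht modules -/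

section Specht
variable {k : ℕ}

/-- The lengths of the rows of the Young diagram of `lam`, in decreasing order. -/
def rows (lam : k.Partition) : List ℕ := lam.parts.sort (· ≥ ·)

/-- The boxes of the Young diagram of `lam`: a row together with a position in that row. -/
abbrev Box (lam : k.Partition) : Type := Σ i : Fin (rows lam).length, Fin ((rows lam).get i)

theorem card_box (lam : k.Partition) : Fintype.card (Box lam) = k := by
  rw [Fintype.card_sigma]
  simp only [Fintype.card_fin, List.get_eq_getElem, Fin.sum_univ_getElem]
  rw [← Multiset.sum_coe, rows, Multiset.sort_eq, lam.parts_sum]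

/-- A Young tableau of shape `lam`: a bijective filling of the boxes. -/
noncomputable def tableau (lam : k.Partition) : Box lam ≃ Fin k :=
  Fintype.equivFinOfCardEq (card_box lam)

open Classical in
/-- The sum of the row stabilizer of the tableau. -/
noncomputable def rowSum (lam : k.Partition) : MonoidAlgebra ℂ (Equiv.Perm (Fin k)) :=
  ∑ σ : Equiv.Perm (Fin k) with
    ∀ x, ((tableau lam).symm (σ x)).1 = ((tableau lam).symm x).1, MonoidAlgebra.of ℂ _ σ

open Classical in
/-- The signed sum of the column stabilizer of the tableau. -/
noncomputable def colSum (lam : k.Partition) : MonoidAlgebra ℂ (Equiv.Perm (Fin k)) :=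
  ∑ σ : Equiv.Perm (Fin k) with
    ∀ x, ((tableau lam).symm (σ x)).2.val = ((tableau lam).symm x).2.val,
    ((Equiv.Perm.sign σ : ℤ) : ℂ) • MonoidAlgebra.of ℂ _ σ

/-- The Specht module of `lam`. The left ideal generated by `rowSum` is the permutation module on
tabloids, `rowSum` being the tabloid of the tableau; `colSum * rowSum` is the polytabloid. -/
def Specht (lam : k.Partition) : Type :=
  Submodule.span (MonoidAlgebra ℂ (Equiv.Perm (Fin k))) {colSum lam * rowSum lam}

noncomputable instance (lam : k.Partition) : AddCommGroup (Specht lam) :=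
  inferInstanceAs (AddCommGroup (Submodule.span (MonoidAlgebra ℂ (Equiv.Perm (Fin k)))
    {colSum lam * rowSum lam}))

noncomputable instance (lam : k.Partition) :
    Module (MonoidAlgebra ℂ (Equiv.Perm (Fin k))) (Specht lam) :=
  inferInstanceAs (Module (MonoidAlgebra ℂ (Equiv.Perm (Fin k)))
    (Submodule.span (MonoidAlgebra ℂ (Equiv.Perm (Fin k))) {colSum lam * rowSum lam}))

noncomputable instance (lam : k.Partition) : Module ℂ (Specht lam) :=
  inferInstanceAs (Module ℂ (Submodule.span (MonoidAlgebra ℂ (Equiv.Perm (Fin k)))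
    {colSum lam * rowSum lam}))

instance (lam : k.Partition) :
    IsScalarTower ℂ (MonoidAlgebra ℂ (Equiv.Perm (Fin k))) (Specht lam) :=
  inferInstanceAs (IsScalarTower ℂ (MonoidAlgebra ℂ (Equiv.Perm (Fin k)))
    (Submodule.span (MonoidAlgebra ℂ (Equiv.Perm (Fin k))) {colSum lam * rowSum lam}))

/-- The Specht module as a representation of `S_k`. -/
noncomputable def spechtRep (lam : k.Partition) :
    Representation ℂ (Equiv.Perm (Fin k)) (Specht lam) :=
  Representation.ofModule' (Specht lam)

/-- The inclusion of `S_k × S_l` in `S_(k+l)`. -/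
def youngEmb (k l : ℕ) : Equiv.Perm (Fin k) × Equiv.Perm (Fin l) →* Equiv.Perm (Fin (k + l)) :=
  (finSumFinEquiv.permCongrHom.toMonoidHom).comp (Equiv.Perm.sumCongrHom (Fin k) (Fin l))

/-- The outer tensor product of a representation of `S_k` and the trivial representation of
`S_l`, a representation of `S_k × S_l`. -/
noncomputable def outerRep {S : Type} [AddCommGroup S] [Module ℂ S]
    (rho : Representation ℂ (Equiv.Perm (Fin k)) S) (l : ℕ) :
    Representation ℂ (Equiv.Perm (Fin k) × Equiv.Perm (Fin l)) (TensorProduct ℂ S ℂ) :=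
  Representation.tprod
    (rho.comp (MonoidHom.fst (Equiv.Perm (Fin k)) (Equiv.Perm (Fin l))))
    ((Representation.trivial ℂ (Equiv.Perm (Fin l)) ℂ).comp
      (MonoidHom.snd (Equiv.Perm (Fin k)) (Equiv.Perm (Fin l))))

/-- The multiplicity of the (irreducible) Specht module of `mu` in the representation of `S_(k+l)`
induced from the outer tensor product of the Specht module of `lam` and the trivial representation
of `S_l`, that is, the dimension of the space of homomorphisms between them. -/
noncomputable def mult (lam : k.Partition) {l : ℕ} (mu : (k + l).Partition) : ℕ :=
  Module.finrank ℂ (Representation.IntertwiningMap (spechtRep mu)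
    (Representation.ind (youngEmb k l) (outerRep (spechtRep lam) l)))

end Specht

/-! ### Specht modules for the diagram algebras -/

/-- The tensor product `M ⊗_{ℂ[G]} S` of an `A`-module `M` with a right action `act` of `G` by
`A`-linear maps and a representation `S` of `G`, as an `A`-module: the quotient of `M ⊗ S` by the
elements `m · g ⊗ v - m ⊗ g · v`. -/
abbrev BalancedTensor (A : Type*) [Ring A] [Algebra ℂ A] {M : Type*} [AddCommGroup M] [Module ℂ M]
    [Module A M] [IsScalarTower ℂ A M] {G : Type*} [Group G] (act : G → M →ₗ[A] M)
    {S : Type*} [AddCommGroup S] [Module ℂ S] (rho : Representation ℂ G S) : Type _ :=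
  TensorProduct ℂ M S ⧸ Submodule.span A
    {z : TensorProduct ℂ M S | ∃ g m v, z = act g m ⊗ₜ[ℂ] v - m ⊗ₜ[ℂ] rho g v}

section Modules
variable {n k : ℕ}
open TensorProduct

/-- The cell module `Δ(lam)` of the partial Brauer algebra. -/
abbrev Delta (δ : ℂ) (d₀ : Diagram n) (hk : d₀.propNumber = k) (lam : k.Partition) : Type :=
  BalancedTensor (PBAlgebra n δ 0) (CellModule.rightAct δ 0 d₀ hk) (spechtRep lam)

/-- The section `N_l(lam)`. -/
abbrev DeltaSection (δ : ℂ) (d₀ : Diagram n) (hk : d₀.propNumber = k) (l : ℕ)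
    (lam : k.Partition) : Type :=
  BalancedTensor (PBAlgebra n δ 0) (sectionRightAct δ d₀ hk l) (spechtRep lam)

/-- The Brauer-Specht module of `lam`, constructed from the left cell of the Brauer diagram `d₀`. -/
abbrev BrauerSpecht (δ : ℂ) (d₀ : Diagram n) (hk : d₀.propNumber = k) (lam : k.Partition) : Type :=
  BalancedTensor (brauer n δ 0) (brauerRightAct δ 0 d₀ hk) (spechtRep lam)

end Modules

/-- The numbers `l ∈ {n - k, n - k - 2, …}`, down to `1` or `0`. -/
def sectionIndices (n k : ℕ) : Finset ℕ :=
  {l ∈ Finset.range (n + 1) | k + l ≤ n ∧ Even (n - (k + l))}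

open Classical in
/-- The composition multiplicity of the simple module `E` in a module `M` of finite length: the
number of factors isomorphic to `E` in a composition series of `M`. (By the Jordan-Hölder theorem
the choice of the series does not matter.) -/
noncomputable def compMult (R M E : Type*) [Ring R] [AddCommGroup M] [Module R M]
    [AddCommGroup E] [Module R E] : ℕ :=
  if h : ∃ s : CompositionSeries (Submodule R M), s.head = ⊥ ∧ s.last = ⊤ then
    Nat.card {i : Fin h.choose.length //
      Nonempty ((h.choose i.succ ⧸ (h.choose i.castSucc).submoduleOf (h.choose i.succ)) ≃ₗ[R] E)}
  else 0

end PartialBrauer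

/-! Let a Brauer diagram d act on a diagram x of the left cell. Counting singletons gives 2 · (open
strings) + singletons(dx) = singletons(x). Inside the cell the right singletons are fixed, so either
dx has as many left singletons as x, or an open string occurs and the product vanishes because δ' =
0 (`strings_eq_zero_iff`). Hence over the Brauer algebra the cell module is not only filtered but
graded by the number l of left singletons.

A diagram with l left singletons is a Brauer diagram with k + l propagating lines of which l have
been cut. Cutting is right multiplication by the diagram `cut`, which joins the first k right ends
of a Brauer diagram `e` to the right ends of `d₀`. The resulting map `glue` from the Brauer cell
module is linear over the Brauer algebra (`factor_mul_cut`, `leftCell_of_mul_cut`), reaches every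
diagram with l left singletons (`exists_mul_cut_eq`), and identifies two Brauer diagrams exactly
when they differ by a permutation of the l cut lines (`perm_mul_cut`, `exists_eq_relabel`). So the
part of degree l is the space of S_l-coinvariants of the Brauer cell module, compatibly with S_k.
Tensoring these coinvariants with a representation S over S_k is the same as tensoring the whole
Brauer cell module over S_(k+l) with the representation induced from S ⊗ triv
(`nonempty_pi_ind_equiv`). Applied to one l this describes the section; applied to all l at once it
describes the restriction of Δ(λ).

It remains to split the induced representation into Specht modules. The multiplicities are
dimensions of homomorphism spaces, so the Specht modules have to be known as a complete irredundant
list of irreducibles. They are simple by von Neumann's argument with row and column sums, pairwise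
non-isomorphic by the dominance order, and complete because the irreducible characters are linearly
independent class functions and there are only as many cycle types as partitions.

For the decomposition numbers, δ' = 0 makes the diagrams with singletons span a nilpotent ideal,
since in a nonzero product the numbers of singletons add up. This ideal kills every simple module
(`of_smul_eq_zero`), so a composition series over the partial Brauer algebra is also one over the
Brauer algebra, with the same coincidences among its factors (`compMult_restrict`). Additivity of
composition multiplicities on direct sums then gives the formula. -/

namespace PartialBrauer

/-! ### Rows and columns of the standard tableau -/

section Tableau
variable {k : ℕ}

/-- The index of the row of the tableau that contains `x`. -/
noncomputable def rowOf (lam : k.Partition) (x : Fin k) : ℕ := ((tableau lam).symm x).1.val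

/-- The index of the column of the tableau that contains `x`. -/
noncomputable def colOf (lam : k.Partition) (x : Fin k) : ℕ := ((tableau lam).symm x).2.val

theorem eq_of_rowOf_of_colOf {lam : k.Partition} {x y : Fin k} (hr : rowOf lam x = rowOf lam y)
    (hc : colOf lam x = colOf lam y) : x = y := by
  apply (tableau lam).symm.injective
  have key : ∀ b b' : Box lam, b.1.val = b'.1.val → b.2.val = b'.2.val → b = b' := by
    rintro ⟨i, j⟩ ⟨i', j'⟩ h h'
    obtain rfl : i = i' := Fin.ext h
    obtain rfl : j = j' := Fin.ext h'
    rfl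
  exact key _ _ hr hc

theorem rowOf_tableau (lam : k.Partition) (b : Box lam) : rowOf lam (tableau lam b) = b.1 :=
  congrArg (fun b : Box lam => b.1.val) ((tableau lam).symm_apply_apply b)

theorem colOf_tableau (lam : k.Partition) (b : Box lam) : colOf lam (tableau lam b) = b.2 :=
  congrArg (fun b : Box lam => b.2.val) ((tableau lam).symm_apply_apply b)

theorem exists_rowOf_colOf (lam : k.Partition) (i : Fin (rows lam).length) (j : ℕ)
    (hj : j < (rows lam).get i) : ∃ x, rowOf lam x = i ∧ colOf lam x = j :=
  ⟨tableau lam ⟨i, j, hj⟩, rowOf_tableau lam _, colOf_tableau lam _⟩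

theorem rows_antitone (lam : k.Partition) {i i' : Fin (rows lam).length} (h : i ≤ i') :
    (rows lam).get i' ≤ (rows lam).get i := by
  have hs : (rows lam).Pairwise (· ≥ ·) := Multiset.pairwise_sort _ _
  rcases h.lt_or_eq with h | rfl
  · exact List.pairwise_iff_get.1 hs i i' h
  · exact le_rfl

/-- Row lengths decrease weakly, so columns have no gaps. -/
theorem exists_above (lam : k.Partition) (x : Fin k) {i : ℕ} (hi : i ≤ rowOf lam x) :
    ∃ y, rowOf lam y = i ∧ colOf lam y = colOf lam x := by
  set b := (tableau lam).symm x with hb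
  have hi' : i < (rows lam).length := lt_of_le_of_lt hi b.1.2
  exact exists_rowOf_colOf lam ⟨i, hi'⟩ _
    (lt_of_lt_of_le b.2.2 (rows_antitone lam (i := ⟨i, hi'⟩) (i' := b.1) hi))

theorem card_rowOf_eq (lam : k.Partition) (i : ℕ) :
    (Finset.univ.filter fun x => rowOf lam x = i).card = (rows lam).getD i 0 := by
  classical
  by_cases hi : i < (rows lam).length
  · rw [List.getD_eq_getElem _ _ hi]
    have : (Finset.univ.filter fun x => rowOf lam x = i) =
        Finset.univ.map ⟨fun j : Fin ((rows lam).get ⟨i, hi⟩) => tableau lam ⟨⟨i, hi⟩, j⟩,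
          fun j j' h => by simpa using h⟩ := by
      ext x
      rw [Finset.mem_filter_univ, Finset.mem_map]
      constructor
      · intro h
        refine ⟨⟨colOf lam x, ?_⟩, Finset.mem_univ _, ?_⟩
        · have := ((tableau lam).symm x).2.2
          subst h
          exact this
        · exact eq_of_rowOf_of_colOf ((rowOf_tableau lam _).trans h.symm) (colOf_tableau lam _)
      · rintro ⟨j, -, rfl⟩
        exact rowOf_tableau lam _
    rw [this, Finset.card_map, Finset.card_univ, Fintype.card_fin]
    rfl
  · rw [List.getD_eq_default _ _ (by omega), Finset.card_eq_zero, Finset.filter_eq_empty_iff]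
    intro x _ h
    exact hi (h ▸ ((tableau lam).symm x).1.2)

theorem card_rowOf_lt (lam : k.Partition) (i : ℕ) :
    (Finset.univ.filter fun x => rowOf lam x < i + 1).card =
      (Finset.univ.filter fun x => rowOf lam x < i).card +
        (Finset.univ.filter fun x => rowOf lam x = i).card := by
  classical
  rw [← Finset.card_union_of_disjoint]
  · congr 1
    ext x
    simp only [Finset.mem_filter_univ, Finset.mem_union]
    omega
  · rw [Finset.disjoint_filter]
    intro x _ h
    omega

/-- Differences of consecutive counts are the row lengths. All parts are positive, so the number of
rows is the first index at which the length, extended by `0`, vanishes. -/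
theorem partition_eq_of_card_rowOf_lt {lam mu : k.Partition}
    (h : ∀ i, (Finset.univ.filter fun x => rowOf lam x < i).card =
      (Finset.univ.filter fun x => rowOf mu x < i).card) : lam = mu := by
  have hget : ∀ i, (rows lam).getD i 0 = (rows mu).getD i 0 := fun i => by
    rw [← card_rowOf_eq, ← card_rowOf_eq]
    have h1 := card_rowOf_lt lam i
    have h2 := card_rowOf_lt mu i
    have h3 := h i
    have h4 := h (i + 1)
    omega
  have hpos : ∀ nu : k.Partition, ∀ i, i < (rows nu).length ↔ 0 < (rows nu).getD i 0 := by
    intro nu i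
    constructor
    · intro hi
      rw [List.getD_eq_getElem _ _ hi]
      apply nu.parts_pos
      rw [← Multiset.mem_sort (· ≥ ·)]
      exact List.getElem_mem hi
    · intro hi
      by_contra hn
      rw [List.getD_eq_default _ _ (by omega)] at hi
      exact lt_irrefl _ hi
  have hlen : (rows lam).length = (rows mu).length := by
    apply Nat.le_antisymm <;> by_contra! hlt
    · exact lt_irrefl _ ((hpos mu _).2 (hget _ ▸ (hpos lam _).1 hlt))
    · exact lt_irrefl _ ((hpos lam _).2 (hget _ ▸ (hpos mu _).1 hlt))
  have hrows : rows lam = rows mu := by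
    apply List.ext_getElem hlen
    intro i h1 h2
    have := hget i
    rwa [List.getD_eq_getElem _ _ h1, List.getD_eq_getElem _ _ h2] at this
  apply Nat.Partition.ext
  rw [← Multiset.sort_eq lam.parts (· ≥ ·), ← Multiset.sort_eq mu.parts (· ≥ ·)]
  exact congrArg _ hrows

/-- No two elements in the same row of the tableau of `mu` are mapped by `g` into the same column of
the tableau of `lam`. -/
def Transverse (lam mu : k.Partition) (g : Equiv.Perm (Fin k)) : Prop :=
  ∀ x y, rowOf mu x = rowOf mu y → colOf lam (g x) = colOf lam (g y) → x = y

/-- By transversality each of the first `i` rows of `mu` sends at most one entry into column `j`, so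
the left side is at most `i`. If column `j` of `lam` reaches below its first `i` rows, the right
side is at least `i`. Otherwise the right side counts the whole column, and `g` maps the left set
injectively into it. -/
theorem Transverse.card_col_le {lam mu : k.Partition} {g : Equiv.Perm (Fin k)}
    (h : Transverse lam mu g) (i j : ℕ) :
    (Finset.univ.filter fun x => rowOf mu x < i ∧ colOf lam (g x) = j).card ≤
      (Finset.univ.filter fun x => rowOf lam x < i ∧ colOf lam x = j).card := by
  classical
  by_cases hex : ∃ x, colOf lam x = j ∧ i ≤ rowOf lam x
  · obtain ⟨x, rfl, hx⟩ := hex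
    trans i
    · rw [← Finset.card_range i]
      refine Finset.card_le_card_of_injOn (rowOf mu) ?_ ?_
      · intro y hy
        simp only [Finset.coe_filter, Finset.mem_univ, true_and, Set.mem_ofPred_eq] at hy
        simpa using hy.1
      · intro y hy z hz hyz
        simp only [Finset.coe_filter, Finset.mem_univ, true_and, Set.mem_ofPred_eq] at hy hz
        exact h y z hyz (hy.2.trans hz.2.symm)
    · rw [← Finset.card_range i]
      have hy : ∀ a : ℕ, ∃ y, a < i → rowOf lam y = a ∧ colOf lam y = colOf lam x := by
        intro a
        by_cases ha : a < i
        · obtain ⟨y, hy⟩ := exists_above lam x (i := a) (by omega)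
          exact ⟨y, fun _ => hy⟩
        · exact ⟨x, fun h => absurd h ha⟩
      choose f hf using hy
      refine Finset.card_le_card_of_injOn f ?_ ?_
      · intro a ha
        have ha := Finset.mem_range.1 (Finset.mem_coe.1 ha)
        simp only [Finset.coe_filter, Finset.mem_univ, true_and, Set.mem_ofPred_eq]
        exact ⟨by rw [(hf a ha).1, Finset.card_range]; exact ha, (hf a ha).2⟩
      · intro a ha b hb hab
        have ha := Finset.mem_range.1 (Finset.mem_coe.1 ha)
        have hb := Finset.mem_range.1 (Finset.mem_coe.1 hb)
        rw [← (hf a ha).1, ← (hf b hb).1, hab]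
  · push Not at hex
    refine Finset.card_le_card_of_injOn g ?_ g.injective.injOn
    intro y hy
    simp only [Finset.coe_filter, Finset.mem_univ, true_and, Set.mem_ofPred_eq] at hy ⊢
    exact ⟨hex _ hy.2, hy.2⟩

theorem card_filter_eq_sum_cols (c : Fin k → ℕ) (p : Fin k → Prop) [DecidablePred p]
    (t : Finset ℕ) (ht : ∀ x, c x ∈ t) :
    (Finset.univ.filter p).card =
      ∑ j ∈ t, (Finset.univ.filter fun x => p x ∧ c x = j).card := by
  rw [Finset.card_eq_sum_card_fiberwise (f := c) (t := t) fun x _ => ht x]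
  simp only [Finset.filter_filter]

/-- Summing the column estimates over all columns shows that `lam` dominates `mu`. -/
theorem Transverse.card_rowOf_lt_le {lam mu : k.Partition} {g : Equiv.Perm (Fin k)}
    (h : Transverse lam mu g) (i : ℕ) :
    (Finset.univ.filter fun x => rowOf mu x < i).card ≤
      (Finset.univ.filter fun x => rowOf lam x < i).card := by
  classical
  have ht : ∀ x, colOf lam x ∈ Finset.univ.image (colOf lam) := fun x =>
    Finset.mem_image_of_mem _ (Finset.mem_univ x)
  rw [card_filter_eq_sum_cols (fun x => colOf lam (g x)) _ _ fun x => ht _,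
    card_filter_eq_sum_cols (colOf lam) _ _ ht]
  exact Finset.sum_le_sum fun j _ => h.card_col_le i j

/-- For equal shapes the column estimates add up to an equality, so each of them is an equality. If
the required box did not exist, the column of `g x` would end above the row of `x`. Equality would
then force every entry that `g` sends into this column to lie strictly above the row of `x`, and `x`
itself contradicts this. -/
theorem Transverse.exists_rowOf_colOf {lam : k.Partition} {g : Equiv.Perm (Fin k)}
    (h : Transverse lam lam g) (x : Fin k) :
    ∃ y, rowOf lam y = rowOf lam x ∧ colOf lam y = colOf lam (g x) := by
  classical
  by_contra hn
  have ht : ∀ x, colOf lam x ∈ Finset.univ.image (colOf lam) := fun x =>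
    Finset.mem_image_of_mem _ (Finset.mem_univ x)
  have hsum := card_filter_eq_sum_cols (fun x => colOf lam (g x))
    (fun y => rowOf lam y < rowOf lam x) _ fun x => ht _
  rw [card_filter_eq_sum_cols (colOf lam) _ _ ht] at hsum
  have heq := (Finset.sum_eq_sum_iff_of_le fun j _ => h.card_col_le (rowOf lam x) j).1 hsum.symm
    _ (ht (g x))
  have hlt : ∀ y, colOf lam y = colOf lam (g x) → rowOf lam y < rowOf lam x := by
    intro y hy
    by_contra! hle
    obtain ⟨z, hz1, hz2⟩ := exists_above lam y hle
    exact hn ⟨z, hz1, hz2.trans hy⟩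
  have h1 : (Finset.univ.filter fun y => rowOf lam y < rowOf lam x ∧
      colOf lam y = colOf lam (g x)) =
      (Finset.univ.filter fun y => colOf lam (g y) = colOf lam (g x)).map g.toEmbedding := by
    ext y
    simp only [Finset.mem_filter_univ, Finset.mem_map_equiv, Equiv.apply_symm_apply]
    exact ⟨fun h => h.2, fun h => ⟨hlt y h, h⟩⟩
  rw [h1, Finset.card_map] at heq
  refine absurd heq (ne_of_lt (Finset.card_lt_card ?_))
  rw [Finset.ssubset_iff_of_subset (fun y hy => by
    rw [Finset.mem_filter_univ] at hy ⊢; exact hy.2)]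
  exact ⟨x, by simp, by simp⟩

/-- A permutation that is transverse for a tableau is the product of a column permutation and a
row permutation. -/
theorem Transverse.exists_eq_mul {lam : k.Partition} {g : Equiv.Perm (Fin k)}
    (h : Transverse lam lam g) : ∃ q p : Equiv.Perm (Fin k),
      (∀ x, colOf lam (q x) = colOf lam x) ∧ (∀ x, rowOf lam (p x) = rowOf lam x) ∧
        g = q⁻¹ * p := by
  choose f hf1 hf2 using h.exists_rowOf_colOf
  have hinj : Function.Injective f := fun x y hxy =>
    h x y ((hf1 x).symm.trans (hxy ▸ hf1 y)) ((hf2 x).symm.trans (hxy ▸ hf2 y))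
  -- `p` moves `x` within its row to the column of `g x`; it is injective by transversality. Thus `p
  -- * g⁻¹` preserves columns.
  set p : Equiv.Perm (Fin k) := Equiv.ofBijective f (Finite.injective_iff_bijective.1 hinj)
  refine ⟨p * g⁻¹, p, fun x => ?_, hf1, by group⟩
  change colOf lam (f (g⁻¹ x)) = _
  rw [hf2]
  exact congrArg _ (g.apply_symm_apply x)

end Tableau
end PartialBrauer

namespace PartialBrauer

/-! ### Specht modules are simple -/

section SpechtSimple
variable {k : ℕ}

open MonoidAlgebra

theorem mem_rowStabilizer {lam : k.Partition} {σ : Equiv.Perm (Fin k)} :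
    (∀ x, ((tableau lam).symm (σ x)).1 = ((tableau lam).symm x).1) ↔
      ∀ x, rowOf lam (σ x) = rowOf lam x :=
  forall_congr' fun _ => Fin.ext_iff

theorem of_mul_rowSum {lam : k.Partition} {p : Equiv.Perm (Fin k)}
    (hp : ∀ x, rowOf lam (p x) = rowOf lam x) : of ℂ _ p * rowSum lam = rowSum lam := by
  classical
  unfold rowSum
  rw [Finset.mul_sum]
  refine Finset.sum_equiv (Equiv.mulLeft p) (fun σ => ?_) fun σ _ => (map_mul _ _ _).symm
  rw [Finset.mem_filter_univ, Finset.mem_filter_univ, mem_rowStabilizer, mem_rowStabilizer]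
  exact forall_congr' fun x => by rw [Equiv.coe_mulLeft, Equiv.Perm.mul_apply, hp]

theorem colSum_mul_of {lam : k.Partition} {q : Equiv.Perm (Fin k)}
    (hq : ∀ x, colOf lam (q x) = colOf lam x) :
    colSum lam * of ℂ _ q = ((Equiv.Perm.sign q : ℤ) : ℂ) • colSum lam := by
  classical
  unfold colSum
  rw [Finset.sum_mul, Finset.smul_sum]
  refine Finset.sum_equiv (Equiv.mulRight q) (fun σ => ?_) fun σ _ => ?_
  · rw [Finset.mem_filter_univ, Finset.mem_filter_univ]
    change (∀ x, colOf lam (σ x) = colOf lam x) ↔ ∀ x, colOf lam (σ (q x)) = colOf lam x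
    constructor
    · intro h x
      rw [h, hq]
    · intro h x
      have := h (q.symm x)
      rw [q.apply_symm_apply] at this
      rw [this, ← hq, q.apply_symm_apply]
  · rw [smul_mul_assoc, ← map_mul, Equiv.coe_mulRight, smul_smul, Equiv.Perm.sign_mul]
    congr 1
    rcases Int.units_eq_one_or (Equiv.Perm.sign q) with h | h <;> simp [h]

theorem of_mul_colSum {lam : k.Partition} {q : Equiv.Perm (Fin k)}
    (hq : ∀ x, colOf lam (q x) = colOf lam x) :
    of ℂ _ q * colSum lam = ((Equiv.Perm.sign q : ℤ) : ℂ) • colSum lam := by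
  classical
  unfold colSum
  rw [Finset.mul_sum, Finset.smul_sum]
  refine Finset.sum_equiv (Equiv.mulLeft q) (fun σ => ?_) fun σ _ => ?_
  · rw [Finset.mem_filter_univ, Finset.mem_filter_univ]
    change (∀ x, colOf lam (σ x) = colOf lam x) ↔ ∀ x, colOf lam (q (σ x)) = colOf lam x
    exact forall_congr' fun x => by rw [hq]
  · rw [mul_smul_comm, ← map_mul, Equiv.coe_mulLeft, smul_smul, Equiv.Perm.sign_mul]
    congr 1
    rcases Int.units_eq_one_or (Equiv.Perm.sign q) with h | h <;> simp [h]

/-- Each element of the column stabilizer reproduces `colSum` up to its sign, which cancels against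
its coefficient; `c` is the order of the stabilizer. -/
theorem exists_colSum_mul_colSum (lam : k.Partition) :
    ∃ c : ℂ, c ≠ 0 ∧ colSum lam * colSum lam = c • colSum lam := by
  classical
  refine ⟨((Finset.univ.filter fun σ : Equiv.Perm (Fin k) => ∀ x,
    ((tableau lam).symm (σ x)).2.val = ((tableau lam).symm x).2.val).card : ℂ), ?_, ?_⟩
  · rw [Nat.cast_ne_zero]
    exact Finset.card_ne_zero_of_mem (a := 1) (by simp)
  · nth_rw 1 [colSum]
    rw [Finset.sum_mul, Nat.cast_smul_eq_nsmul, ← Finset.sum_const]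
    refine Finset.sum_congr rfl fun σ hσ => ?_
    rw [Finset.mem_filter_univ] at hσ
    rw [smul_mul_assoc, of_mul_colSum hσ, smul_smul]
    rcases Int.units_eq_one_or (Equiv.Perm.sign σ) with h | h <;> rw [h] <;> simp

/-- Two elements of one row of `mu` are sent into one column of `lam`. Their transposition is
absorbed by `rowSum mu`; moved past `g` it becomes a column transposition, which `colSum lam`
absorbs with sign `-1`. The product thus equals its own negative. -/
theorem colSum_mul_of_mul_rowSum_eq_zero {lam mu : k.Partition} {g : Equiv.Perm (Fin k)}
    (h : ¬ Transverse lam mu g) : colSum lam * of ℂ _ g * rowSum mu = 0 := by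
  classical
  unfold Transverse at h
  push Not at h
  obtain ⟨x, y, hr, hc, hne⟩ := h
  have hp : ∀ z, rowOf mu (Equiv.swap x y z) = rowOf mu z := by
    intro z
    rcases em (z = x) with rfl | h1
    · rw [Equiv.swap_apply_left, hr]
    · rcases em (z = y) with rfl | h2
      · rw [Equiv.swap_apply_right, hr]
      · rw [Equiv.swap_apply_of_ne_of_ne h1 h2]
  have hq : ∀ z, colOf lam (Equiv.swap (g x) (g y) z) = colOf lam z := by
    intro z
    rcases em (z = g x) with rfl | h1
    · rw [Equiv.swap_apply_left, hc]
    · rcases em (z = g y) with rfl | h2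
      · rw [Equiv.swap_apply_right, hc]
      · rw [Equiv.swap_apply_of_ne_of_ne h1 h2]
  have hg : g * Equiv.swap x y = Equiv.swap (g x) (g y) * g := by
    rw [← Equiv.mul_swap_eq_swap_mul]
  have key : colSum lam * of ℂ _ g * rowSum mu = -(colSum lam * of ℂ _ g * rowSum mu) := by
    conv_lhs => rw [← of_mul_rowSum hp, ← mul_assoc, mul_assoc (colSum lam), ← map_mul, hg,
      map_mul, ← mul_assoc, colSum_mul_of hq, Equiv.Perm.sign_swap (g.injective.ne hne)]
    simp
  have h2 : (2 : ℂ) • (colSum lam * of ℂ _ g * rowSum mu) = 0 := by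
    rw [two_smul]
    nth_rw 1 [key]
    exact neg_add_cancel _
  exact (smul_eq_zero.1 h2).resolve_left two_ne_zero

theorem colSum_mul_mul_rowSum_eq_zero {lam mu : k.Partition}
    (h : ∀ g, ¬ Transverse lam mu g) (a : MonoidAlgebra ℂ (Equiv.Perm (Fin k))) :
    colSum lam * a * rowSum mu = 0 := by
  induction a using MonoidAlgebra.induction_on with
  | of g => exact colSum_mul_of_mul_rowSum_eq_zero (h g)
  | add a b ha hb => rw [mul_add, add_mul, ha, hb, add_zero]
  | smul r a ha => rw [mul_smul_comm, smul_mul_assoc, ha, smul_zero]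

/-- Von Neumann's lemma. A group element is either not transverse and contributes `0`, or it is a
column permutation times a row permutation, which the two outer factors absorb up to a sign. -/
theorem exists_colSum_mul_mul_rowSum (lam : k.Partition)
    (a : MonoidAlgebra ℂ (Equiv.Perm (Fin k))) :
    ∃ c : ℂ, colSum lam * a * rowSum lam = c • (colSum lam * rowSum lam) := by
  induction a using MonoidAlgebra.induction_on with
  | of g =>
    by_cases h : Transverse lam lam g
    · obtain ⟨q, p, hq, hp, rfl⟩ := h.exists_eq_mul
      have hq' : ∀ x, colOf lam (q⁻¹ x) = colOf lam x := fun x => by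
        rw [← hq]
        exact congrArg _ (q.apply_symm_apply x)
      exact ⟨_, by rw [map_mul, ← mul_assoc, mul_assoc _ _ (rowSum lam), of_mul_rowSum hp,
        colSum_mul_of hq', smul_mul_assoc]⟩
    · exact ⟨0, by rw [colSum_mul_of_mul_rowSum_eq_zero h, zero_smul]⟩
  | add a b ha hb =>
    obtain ⟨c, hc⟩ := ha
    obtain ⟨d, hd⟩ := hb
    exact ⟨c + d, by rw [mul_add, add_mul, hc, hd, add_smul]⟩
  | smul r a ha =>
    obtain ⟨c, hc⟩ := ha
    exact ⟨r * c, by rw [mul_smul_comm, smul_mul_assoc, hc, mul_smul]⟩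

/-- The coefficient of the identity is `1`: if `q * p = 1` with `q` preserving columns and `p`
preserving rows, then `q` preserves both and is trivial. -/
theorem colSum_mul_rowSum_ne_zero (lam : k.Partition) : colSum lam * rowSum lam ≠ 0 := by
  classical
  intro h0
  have h1 : (colSum lam * rowSum lam).coeff 1 = 1 := by
    unfold colSum rowSum
    simp only [Finset.sum_mul_sum, MonoidAlgebra.coeff_sum, Finsupp.finsetSum_apply,
      smul_mul_assoc, ← map_mul, MonoidAlgebra.coeff_smul, Finsupp.smul_apply]
    rw [Finset.sum_eq_single 1, Finset.sum_eq_single 1]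
    · simp
    · intro p _ hp
      simp [MonoidAlgebra.of_apply, hp]
    · intro h
      exact absurd (by simp) h
    · intro q hq hq1
      refine Finset.sum_eq_zero fun p hp => ?_
      rw [Finset.mem_filter_univ] at hq hp
      have hqp : q * p ≠ 1 := by
        intro hqp
        apply hq1
        ext x
        congr 1
        refine eq_of_rowOf_of_colOf (lam := lam) ?_ (hq x)
        have h2 := mem_rowStabilizer.1 hp (q x)
        rw [show p (q x) = x by
          rw [← Equiv.Perm.mul_apply, mul_eq_one_comm.1 hqp, Equiv.Perm.one_apply]] at h2
        exact h2.symm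
      simp [MonoidAlgebra.of_apply, hqp]
    · intro h
      exact absurd (by simp) h
  rw [h0] at h1
  simp at h1

theorem neZero_card_perm : NeZero (Nat.card (Equiv.Perm (Fin k)) : ℂ) :=
  ⟨Nat.cast_ne_zero.2 Nat.card_pos.ne'⟩

/-- Put z = `colSum lam * rowSum lam`. For w = y z in a proper submodule W, the element z w = z y z
is a multiple of z by von Neumann's lemma, and a nonzero multiple would bring z into W. So z W = 0,
and therefore W W = 0. In the semisimple group algebra this forces W = 0. -/
theorem isAtom_span_colSum_mul_rowSum (lam : k.Partition) :
    IsAtom (Submodule.span (MonoidAlgebra ℂ (Equiv.Perm (Fin k))) {colSum lam * rowSum lam}) := by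
  have := neZero_card_perm (k := k)
  refine ⟨fun h => colSum_mul_rowSum_ne_zero lam (Submodule.span_singleton_eq_bot.1 h), ?_⟩
  intro W hW
  have hmul : ∀ w ∈ W, colSum lam * rowSum lam * w = 0 := by
    intro w hw
    obtain ⟨y, rfl⟩ := Submodule.mem_span_singleton.1 (hW.le hw)
    obtain ⟨c, hc⟩ := exists_colSum_mul_mul_rowSum lam (rowSum lam * y * colSum lam)
    have he : colSum lam * rowSum lam * y • (colSum lam * rowSum lam) =
        c • (colSum lam * rowSum lam) := by
      rw [← hc, smul_eq_mul]
      simp only [mul_assoc]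
    rw [he]
    by_cases hc0 : c = 0
    · rw [hc0, zero_smul]
    · exfalso
      apply hW.not_ge
      rw [Submodule.span_singleton_le_iff_mem]
      have h1 := W.smul_mem (colSum lam * rowSum lam) hw
      rw [smul_eq_mul, he] at h1
      have h2 := W.smul_mem (algebraMap ℂ _ c⁻¹) h1
      rwa [algebraMap_smul, smul_smul, inv_mul_cancel₀ hc0, one_smul] at h2
  -- Maschke's theorem provides an idempotent generator of `W`; as a left multiple of the
  -- polytabloid it squares to zero by `hmul`.
  obtain ⟨e, he, rfl⟩ := IsSemisimpleRing.ideal_eq_span_idempotent W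
  have hmem : e ∈ Ideal.span {e} := Ideal.mem_span_singleton_self e
  obtain ⟨y, hy⟩ := Submodule.mem_span_singleton.1 (hW.le hmem)
  have h0 : e * e = 0 := by
    nth_rw 1 [← hy]
    rw [smul_eq_mul, mul_assoc, hmul e hmem, mul_zero]
  rw [he.eq] at h0
  rw [h0]
  simp

instance isSimpleModule_specht (lam : k.Partition) :
    IsSimpleModule (MonoidAlgebra ℂ (Equiv.Perm (Fin k))) (Specht lam) :=
  isSimpleModule_iff_isAtom.2 (isAtom_span_colSum_mul_rowSum lam)

/-- `colSum lam` multiplies the generator of the first module by a nonzero scalar. Without a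
transverse permutation it would annihilate the second module. -/
theorem exists_transverse {lam mu : k.Partition}
    (f : Specht lam ≃ₗ[MonoidAlgebra ℂ (Equiv.Perm (Fin k))] Specht mu) :
    ∃ g, Transverse lam mu g := by
  by_contra! hn
  set v : Specht lam := (⟨_, Submodule.mem_span_singleton_self _⟩ :
    Submodule.span (MonoidAlgebra ℂ (Equiv.Perm (Fin k))) {colSum lam * rowSum lam}) with hv
  obtain ⟨c, hc0, hc⟩ := exists_colSum_mul_colSum lam
  have hv0 : v ≠ 0 := fun h => colSum_mul_rowSum_ne_zero lam (congrArg Subtype.val h)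
  have h1 : colSum lam • v = (algebraMap ℂ (MonoidAlgebra ℂ (Equiv.Perm (Fin k))) c) • v := by
    apply Subtype.ext
    change colSum lam * (colSum lam * rowSum lam) = algebraMap ℂ _ c • (colSum lam * rowSum lam)
    rw [algebraMap_smul, ← mul_assoc, hc, smul_mul_assoc]
  have h2 : colSum lam • f v = 0 := by
    obtain ⟨y, hy⟩ := Submodule.mem_span_singleton.1 (f v).2
    apply Subtype.ext
    change colSum lam * (f v).1 = 0
    rw [← hy, smul_eq_mul, ← mul_assoc, ← mul_assoc, mul_assoc _ y]
    exact colSum_mul_mul_rowSum_eq_zero hn _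
  rw [← map_smul, h1, map_eq_zero_iff f f.injective] at h2
  apply hv0
  have h3 := congrArg (fun w => (algebraMap ℂ (MonoidAlgebra ℂ (Equiv.Perm (Fin k))) c⁻¹) • w) h2
  simpa only [smul_smul, ← map_mul, inv_mul_cancel₀ hc0, map_one, one_smul, smul_zero] using h3

/-- The isomorphism and its inverse give dominance in both directions, which is antisymmetric. -/
theorem specht_injective {lam mu : k.Partition}
    (f : Specht lam ≃ₗ[MonoidAlgebra ℂ (Equiv.Perm (Fin k))] Specht mu) : lam = mu := by
  obtain ⟨g, hg⟩ := exists_transverse f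
  obtain ⟨g', hg'⟩ := exists_transverse f.symm
  exact partition_eq_of_card_rowOf_lt fun i =>
    le_antisymm (hg'.card_rowOf_lt_le i) (hg.card_rowOf_lt_le i)

end SpechtSimple
end PartialBrauer

namespace PartialBrauer

/-! ### Decomposition of representations of symmetric groups into Specht modules -/

section Decomposition
variable {k : ℕ}

open Representation

/-- The module associated with `ofModule' M` is `M`. -/
noncomputable def asModuleOfModuleEquiv {G : Type*} [Group G] (M : Type*) [AddCommGroup M]
    [Module ℂ M] [Module (MonoidAlgebra ℂ G) M] [IsScalarTower ℂ (MonoidAlgebra ℂ G) M] :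
    (ofModule' (k := ℂ) (G := G) M).asModule ≃ₗ[MonoidAlgebra ℂ G] M :=
  { (ofModule' (k := ℂ) (G := G) M).asModuleEquiv with
    map_smul' := fun r x => by
      change (ofModule' (k := ℂ) (G := G) M).asModuleEquiv (r • x) = r • _
      rw [asModuleEquiv_map_smul]
      have : (ofModule' (k := ℂ) (G := G) M).asAlgebraHom = Algebra.lsmul ℂ ℂ M := by
        unfold asAlgebraHom ofModule'
        exact Equiv.apply_symm_apply _ _
      rw [this]
      rfl }

instance isIrreducible_spechtRep (lam : k.Partition) : IsIrreducible (spechtRep lam) := by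
  rw [irreducible_iff_isSimpleModule_asModule]
  exact IsSimpleModule.congr (asModuleOfModuleEquiv (Specht lam))

instance (lam : k.Partition) : FiniteDimensional ℂ (Specht lam) :=
  inferInstanceAs (FiniteDimensional ℂ ((Submodule.span (MonoidAlgebra ℂ (Equiv.Perm (Fin k)))
    {colSum lam * rowSum lam}).restrictScalars ℂ))

/-- An equivalence of representations as an isomorphism of modules over the group algebra. -/
noncomputable def asModuleCongr {G V W : Type*} [Group G] [AddCommGroup V] [Module ℂ V]
    [AddCommGroup W] [Module ℂ W] {ρ : Representation ℂ G V} {σ : Representation ℂ G W}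
    (e : ρ.Equiv σ) : ρ.asModule ≃ₗ[MonoidAlgebra ℂ G] σ.asModule :=
  LinearEquiv.ofBijective (IntertwiningMap.equivLinearMapAsModule ρ σ e.toIntertwiningMap)
    (EquivLike.bijective e)

theorem spechtRep_injective {lam mu : k.Partition}
    (h : Nonempty ((spechtRep lam).Equiv (spechtRep mu))) : lam = mu :=
  specht_injective ((asModuleOfModuleEquiv (Specht lam)).symm.trans
    ((asModuleCongr h.some).trans (asModuleOfModuleEquiv (Specht mu))))

/-- Every irreducible representation of the symmetric group is a Specht module. -/
theorem exists_equiv_spechtRep {V : Type} [AddCommGroup V] [Module ℂ V] [FiniteDimensional ℂ V]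
    (ρ : Representation ℂ (Equiv.Perm (Fin k)) V) [IsIrreducible ρ] :
    ∃ mu : k.Partition, Nonempty ((spechtRep mu).Equiv ρ) := by
  classical
  by_contra! hn
  have := invertibleOfNonzero (neZero_card_perm (k := k)).out
  -- If `ρ` were a further irreducible, there would be one irreducible character more than
  -- partitions; `none` stands for `ρ`.
  let χ : Option k.Partition → Equiv.Perm (Fin k) → ℂ := fun o =>
    o.elim ρ.character fun mu => (spechtRep mu).character
  have horth : ∀ o o', (Nat.card (Equiv.Perm (Fin k)) : ℂ)⁻¹ * ∑ g, χ o g * χ o' g⁻¹ =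
      if o = o' then 1 else 0 := by
    rintro (_ | mu) (_ | nu)
    · refine (char_orthonormal ρ ρ).trans ?_
      rw [if_pos ⟨Representation.Equiv.refl ρ⟩, if_pos rfl]
    · refine (char_orthonormal ρ (spechtRep nu)).trans ?_
      rw [if_neg (not_nonempty_iff.2 (hn nu)), if_neg (by simp)]
    · refine (char_orthonormal (spechtRep mu) ρ).trans ?_
      rw [if_neg (fun h => (hn mu).false h.some.symm), if_neg (by simp)]
    · refine (char_orthonormal (spechtRep mu) (spechtRep nu)).trans ?_
      by_cases h : mu = nu
      · subst h
        rw [if_pos ⟨Representation.Equiv.refl _⟩, if_pos rfl]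
      · rw [if_neg (fun h' => h (spechtRep_injective h').symm), if_neg (by simpa using h)]
  -- Orthonormal families are independent: pairing a relation with `χ o` isolates the coefficient of
  -- `o`.
  have hind : LinearIndependent ℂ χ := by
    rw [Fintype.linearIndependent_iff]
    intro c hc o
    have h1 : ∑ o', c o' * ((Nat.card (Equiv.Perm (Fin k)) : ℂ)⁻¹ * ∑ g, χ o' g * χ o g⁻¹) = 0 := by
      calc _ = (Nat.card (Equiv.Perm (Fin k)) : ℂ)⁻¹ *
            ∑ g, (∑ o', c o' • χ o') g * χ o g⁻¹ := by
            simp only [Finset.sum_apply, Pi.smul_apply, smul_eq_mul, Finset.sum_mul,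
              Finset.mul_sum]
            rw [Finset.sum_comm]
            exact Finset.sum_congr rfl fun g _ => Finset.sum_congr rfl fun o' _ => by ring
        _ = 0 := by rw [hc]; simp
    simpa only [horth, mul_ite, mul_one, mul_zero, Finset.sum_ite_eq', Finset.mem_univ,
      if_true] using h1
  have hconst : ∀ o g g', g.partition = g'.partition → χ o g = χ o g' := by
    intro o g g' h
    obtain ⟨c, hc⟩ := isConj_iff.1 (Equiv.Perm.partition_eq_of_isConj.2 h)
    rw [← hc]
    rcases o with _ | mu
    · exact (char_conj ρ g c).symm
    · exact (char_conj (spechtRep mu) g c).symm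
  -- Characters depend only on the cycle type, so they lie in the image of the functions on
  -- partitions. The dimension of this image is at most the number of partitions, one less than the
  -- number of characters in `χ`.
  let pull := LinearMap.funLeft ℂ ℂ
    (fun g : Equiv.Perm (Fin k) => (g.partition : (Fintype.card (Fin k)).Partition))
  have hrange : ∀ o, χ o ∈ LinearMap.range pull := by
    intro o
    refine ⟨fun p => if h : ∃ g : Equiv.Perm (Fin k), g.partition = p then χ o h.choose else 0, ?_⟩
    funext g
    have hex : ∃ g' : Equiv.Perm (Fin k), g'.partition = g.partition := ⟨g, rfl⟩
    simp only [pull, LinearMap.funLeft_apply, dif_pos hex]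
    exact hconst o _ _ hex.choose_spec
  have hind' : LinearIndependent ℂ (fun o => (⟨χ o, hrange o⟩ : LinearMap.range pull)) :=
    LinearIndependent.of_comp (LinearMap.range pull).subtype hind
  have h1 := hind'.fintype_card_le_finrank
  have h2 := LinearMap.finrank_range_le pull
  rw [Module.finrank_fintype_fun_eq_card] at h2
  have h3 : Fintype.card (Fintype.card (Fin k)).Partition = Fintype.card k.Partition := by
    rw [Fintype.card_fin]
  rw [Fintype.card_option] at h1
  omega

/-- Schur's lemma over ℂ, together with the fact that distinct partitions give non-isomorphic Specht
modules. -/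
theorem finrank_intertwiningMap_spechtRep (lam mu : k.Partition) :
    Module.finrank ℂ (IntertwiningMap (spechtRep lam) (spechtRep mu)) =
      if mu = lam then 1 else 0 := by
  split_ifs with h
  · subst h
    exact IsIrreducible.finrank_intertwiningMap_self _
  · have : IsEmpty ((spechtRep lam).Equiv (spechtRep mu)) :=
      not_nonempty_iff.1 fun h' => h (spechtRep_injective h').symm
    exact Module.finrank_zero_of_subsingleton

/-- Homomorphisms into a representation that is identified with a product of representations. -/
noncomputable def intertwiningMapPi {G V W ι : Type*} [Group G] [AddCommGroup V]
    [Module ℂ V] [AddCommGroup W] [Module ℂ W] {U : ι → Type*}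
    [∀ i, AddCommGroup (U i)] [∀ i, Module ℂ (U i)] (ρ : Representation ℂ G V)
    (σ : Representation ℂ G W) (τ : ∀ i, Representation ℂ G (U i)) (e : W ≃ₗ[ℂ] ∀ i, U i)
    (he : ∀ g w i, e (σ g w) i = τ i g (e w i)) :
    IntertwiningMap ρ σ ≃ₗ[ℂ] ∀ i, IntertwiningMap ρ (τ i) where
  toFun f i := ⟨LinearMap.proj i ∘ₗ e.toLinearMap ∘ₗ f.toLinearMap, fun g => by
    ext v
    change e (f (ρ g v)) i = τ i g (e (f v) i)
    rw [f.isIntertwining, he]⟩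
  map_add' f f' := by
    funext i
    ext v
    exact congrFun (map_add e (f v) (f' v)) i
  map_smul' c f := by
    funext i
    ext v
    exact congrFun (map_smul e c (f v)) i
  invFun φ := ⟨e.symm.toLinearMap ∘ₗ LinearMap.pi fun i => (φ i).toLinearMap, fun g => by
    ext v
    change e.symm (fun i => φ i (ρ g v)) = σ g (e.symm fun i => φ i v)
    rw [LinearEquiv.symm_apply_eq]
    funext i
    rw [he, e.apply_symm_apply, (φ i).isIntertwining]⟩
  left_inv f := by
    ext v
    exact e.symm_apply_apply (f v)
  right_inv φ := by
    funext i
    ext v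
    exact congrFun (e.apply_symm_apply fun i => φ i v) i

/-- A finite dimensional representation of the symmetric group is the direct sum of Specht modules,
each as often as the dimension of the homomorphism space says. -/
theorem exists_specht_decomposition {V : Type} [AddCommGroup V] [Module ℂ V]
    [FiniteDimensional ℂ V] (ρ : Representation ℂ (Equiv.Perm (Fin k)) V) :
    ∃ e : V ≃ₗ[ℂ] ∀ i : Σ mu : k.Partition,
        Fin (Module.finrank ℂ (IntertwiningMap (spechtRep mu) ρ)), Specht i.1,
      ∀ g v i, e (ρ g v) i = spechtRep i.1 g (e v i) := by
  classical
  have := neZero_card_perm (k := k)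
  have : Module.Finite (MonoidAlgebra ℂ (Equiv.Perm (Fin k))) ρ.asModule :=
    Module.Finite.of_restrictScalars_finite ℂ _ _
  -- Maschke's theorem gives a finite sum of simple modules, each of which is then identified with
  -- some Specht module.
  obtain ⟨N, S, φ, hS⟩ := IsSemisimpleModule.exists_linearEquiv_fin_dfinsupp
    (MonoidAlgebra ℂ (Equiv.Perm (Fin k))) ρ.asModule
  have hS' : ∀ i, ∃ mu : k.Partition,
      Nonempty (S i ≃ₗ[MonoidAlgebra ℂ (Equiv.Perm (Fin k))] Specht mu) := by
    intro i
    have := hS i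
    have : FiniteDimensional ℂ (S i) :=
      inferInstanceAs (FiniteDimensional ℂ ((S i).restrictScalars ℂ))
    let τ := ofModule' (k := ℂ) (G := Equiv.Perm (Fin k)) (S i)
    have : IsIrreducible τ := by
      rw [irreducible_iff_isSimpleModule_asModule]
      exact IsSimpleModule.congr (asModuleOfModuleEquiv (S i))
    obtain ⟨mu, ⟨f⟩⟩ := exists_equiv_spechtRep τ
    exact ⟨mu, ⟨(asModuleOfModuleEquiv (S i)).symm.trans
      ((asModuleCongr f.symm).trans (asModuleOfModuleEquiv (Specht mu)))⟩⟩
  choose μ ψ using hS'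
  let Φ : ρ.asModule ≃ₗ[MonoidAlgebra ℂ (Equiv.Perm (Fin k))] ∀ i, Specht (μ i) :=
    φ.trans ((DFinsupp.mapRange.linearEquiv fun i => (ψ i).some).trans
      DFinsupp.linearEquivFunOnFintype)
  let e : V ≃ₗ[ℂ] ∀ i, Specht (μ i) := ρ.asModuleEquiv.symm.trans (Φ.restrictScalars ℂ)
  have he : ∀ g v i, e (ρ g v) i = spechtRep (μ i) g (e v i) := by
    intro g v i
    change Φ (ρ.asModuleEquiv.symm (ρ g v)) i = _
    rw [asModuleEquiv_symm_map_rho, map_smul]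
    rfl
  -- Homomorphisms from the Specht module of `mu` into the sum contribute one dimension for each
  -- summand of type `mu`, by Schur's lemma.
  have hcard : ∀ mu, Fintype.card {i // μ i = mu} =
      Module.finrank ℂ (IntertwiningMap (spechtRep mu) ρ) := by
    intro mu
    rw [(intertwiningMapPi (spechtRep mu) ρ (fun i => spechtRep (μ i)) e he).finrank_eq,
      Module.finrank_pi_fintype, Fintype.card_subtype, Finset.card_filter]
    exact Finset.sum_congr rfl fun i _ => (finrank_intertwiningMap_spechtRep mu (μ i)).symm
  let E : Fin N ≃ Σ mu : k.Partition, Fin (Module.finrank ℂ (IntertwiningMap (spechtRep mu) ρ)) :=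
    (Equiv.sigmaFiberEquiv μ).symm.trans
      (Equiv.sigmaCongrRight fun mu => Fintype.equivFinOfCardEq (hcard mu))
  have hE : ∀ j, μ (E.symm j) = j.1 := by
    intro j
    obtain ⟨i, rfl⟩ := E.surjective j
    rw [E.symm_apply_apply]
    rfl
  -- The summands `Specht (μ (E.symm j))` and `Specht j.1` agree only along the equation `hE j`, so
  -- an explicit equivariant transport is needed.
  let c : ∀ {mu nu : k.Partition}, mu = nu → (Specht mu ≃ₗ[ℂ] Specht nu) := fun h =>
    h ▸ LinearEquiv.refl ℂ _
  have hc : ∀ {mu nu : k.Partition} (h : mu = nu) g v,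
      c h (spechtRep mu g v) = spechtRep nu g (c h v) := by
    rintro mu _ rfl g v
    rfl
  refine ⟨e.trans ((LinearEquiv.piCongrLeft' ℂ (fun i => Specht (μ i)) E).trans
    (LinearEquiv.piCongrRight fun j => c (hE j))), ?_⟩
  intro g v j
  change c (hE j) (e (ρ g v) (E.symm j)) = spechtRep j.1 g (c (hE j) (e v (E.symm j)))
  rw [he, hc]

end Decomposition
end PartialBrauer

namespace PartialBrauer

/-! ### Composition multiplicities -/

section CompMult
variable {R M N Q E : Type*} [Ring R] [AddCommGroup M] [Module R M] [AddCommGroup N] [Module R N]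
  [AddCommGroup Q] [Module R Q] [AddCommGroup E] [Module R E]

theorem nat_card_subtype_eq_sum {n : ℕ} (p : Fin n → Prop) [DecidablePred p] :
    Nat.card {i // p i} = ∑ i, if p i then 1 else 0 := by
  rw [Nat.card_eq_fintype_card, Fintype.card_subtype, Finset.card_filter]

/-- By Jordan–Hölder the series picked by choice in `compMult` may be replaced by any other. -/
theorem compMult_eq_card (s : CompositionSeries (Submodule R M)) (h0 : s.head = ⊥)
    (h1 : s.last = ⊤) : compMult R M E = Nat.card {i : Fin s.length //
      Nonempty ((s i.succ ⧸ (s i.castSucc).submoduleOf (s i.succ)) ≃ₗ[R] E)} := by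
  have hex : ∃ s : CompositionSeries (Submodule R M), s.head = ⊥ ∧ s.last = ⊤ := ⟨s, h0, h1⟩
  rw [compMult, dif_pos hex]
  obtain ⟨f, hf⟩ := CompositionSeries.jordan_holder hex.choose s
    (hex.choose_spec.1.trans h0.symm) (hex.choose_spec.2.trans h1.symm)
  refine Nat.card_congr (f.subtypeEquiv fun i => ?_)
  have e := (hf i).linearEquiv
  exact ⟨fun ⟨g⟩ => ⟨e.symm.trans g⟩, fun ⟨g⟩ => ⟨e.trans g⟩⟩

/-- An injective linear map induces isomorphisms of subquotients. -/
noncomputable def subquotientMapEquiv (f : N →ₗ[R] M) (hf : Function.Injective f)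
    (A B : Submodule R N) :
    (B ⧸ A.submoduleOf B) ≃ₗ[R] (B.map f ⧸ (A.map f).submoduleOf (B.map f)) :=
  Submodule.Quotient.equiv _ _ (Submodule.equivMapOfInjective f hf B) (by
    ext ⟨y, hy⟩
    rw [Submodule.mem_map]
    constructor
    · rintro ⟨x, hx, h⟩
      rw [← h]
      exact ⟨x.1, hx, rfl⟩
    · rintro ⟨x, hx, h⟩
      obtain ⟨z, hz, h'⟩ := hy
      have : x = z := hf (h.trans h'.symm)
      subst this
      exact ⟨⟨x, hz⟩, hx, Subtype.ext h'⟩)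

theorem map_covBy_map {f : N →ₗ[R] M} (hf : Function.Injective f) {A B : Submodule R N}
    (h : A ⋖ B) : A.map f ⋖ B.map f := by
  have h1 : IsSimpleModule R (B ⧸ A.submoduleOf B) := (covBy_iff_quot_is_simple h.le).1 h
  exact (covBy_iff_quot_is_simple (Submodule.map_mono h.le)).2
    (IsSimpleModule.congr (subquotientMapEquiv f hf A B).symm)

/-- The top factor of a module. -/
noncomputable def topQuotientEquiv (A : Submodule R M) :
    ((⊤ : Submodule R M) ⧸ A.submoduleOf ⊤) ≃ₗ[R] M ⧸ A :=
  Submodule.Quotient.equiv _ _ Submodule.topEquiv (by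
    ext x
    rw [Submodule.mem_map]
    exact ⟨fun ⟨y, hy, h⟩ => h ▸ hy, fun hx => ⟨⟨x, trivial⟩, hx, rfl⟩⟩)

open Classical in
-- A composition series of `N`, pushed forward along `f` and extended by `⊤`, is one of `M`; its
-- only new factor is `Q`.
theorem compMult_of_simple_quotient {f : N →ₗ[R] M} (hf : Function.Injective f) {g : M →ₗ[R] Q}
    (hg : Function.Surjective g) (hfg : LinearMap.range f = LinearMap.ker g) [IsSimpleModule R Q]
    (hN : IsFiniteLength R N) :
    compMult R M E = compMult R N E + if Nonempty (Q ≃ₗ[R] E) then 1 else 0 := by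
  obtain ⟨s, h0, h1⟩ := isFiniteLength_iff_exists_compositionSeries.1 hN
  have hQ : ((⊤ : Submodule R M) ⧸ (LinearMap.range f).submoduleOf ⊤) ≃ₗ[R] Q :=
    (topQuotientEquiv _).trans ((Submodule.quotEquivOfEq _ _ hfg).trans
      (g.quotKerEquivOfSurjective hg))
  have hlast : (s (Fin.last s.length)).map f = LinearMap.range f := by
    change s.last.map f = _
    rw [h1, Submodule.map_top]
  have hcov : LinearMap.range f ⋖ ⊤ := (covBy_iff_quot_is_simple le_top).2 (IsSimpleModule.congr hQ)
  let T : Fin (s.length + 1 + 1) → Submodule R M :=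
    Fin.snoc (α := fun _ => Submodule R M) (fun i => (s i).map f) ⊤
  have hT1 : ∀ i, T (Fin.castSucc i) = (s i).map f := fun i => Fin.snoc_castSucc ..
  have hT2 : T (Fin.last _) = ⊤ := Fin.snoc_last ..
  have hT3 : ∀ i : Fin s.length, T (Fin.castSucc i).succ = (s i.succ).map f := fun i => by
    rw [Fin.succ_castSucc, hT1]
  have hT4 : T (Fin.last s.length).succ = ⊤ := by rw [Fin.succ_last, hT2]
  let t : CompositionSeries (Submodule R M) := ⟨s.length + 1, T, fun i => by
    change T i.castSucc ⋖ T i.succ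
    induction i using Fin.lastCases with
    | last => rw [hT1, hT4, hlast]; exact hcov
    | cast i => rw [hT1, hT3]; exact map_covBy_map hf (s.step i)⟩
  have ht0 : t.head = ⊥ := by
    change T (Fin.castSucc 0) = ⊥
    rw [hT1]
    change s.head.map f = ⊥
    rw [h0, Submodule.map_bot]
  rw [compMult_eq_card t ht0 hT2, compMult_eq_card s h0 h1, nat_card_subtype_eq_sum,
    nat_card_subtype_eq_sum]
  change ∑ i : Fin (s.length + 1), (if Nonempty ((T i.succ ⧸
    (T i.castSucc).submoduleOf (T i.succ)) ≃ₗ[R] E) then 1 else 0) = _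
  rw [Fin.sum_univ_castSucc]
  congr 1
  · refine Finset.sum_congr rfl fun i _ => ?_
    congr 1
    rw [hT1, hT3]
    exact propext ⟨fun ⟨e⟩ => ⟨(subquotientMapEquiv f hf _ _).trans e⟩,
      fun ⟨e⟩ => ⟨(subquotientMapEquiv f hf _ _).symm.trans e⟩⟩
  · congr 1
    rw [hT1, hT4, hlast]
    exact propext ⟨fun ⟨e⟩ => ⟨hQ.symm.trans e⟩, fun ⟨e⟩ => ⟨hQ.trans e⟩⟩

theorem compMult_of_subsingleton [Subsingleton M] : compMult R M E = 0 := by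
  have : Subsingleton (Submodule R M) := inferInstance
  let s : CompositionSeries (Submodule R M) := RelSeries.singleton _ ⊥
  rw [compMult_eq_card s rfl (Subsingleton.elim _ _), Nat.card_eq_zero]
  exact Or.inl ⟨fun i => i.1.elim0⟩

theorem compMult_congr (e : M ≃ₗ[R] N) (hM : IsFiniteLength R M) :
    compMult R M E = compMult R N E := by
  obtain ⟨s, h0, h1⟩ := isFiniteLength_iff_exists_compositionSeries.1 hM
  let t : CompositionSeries (Submodule R N) := ⟨s.length, fun i => (s i).map e.toLinearMap,
    fun i => map_covBy_map e.injective (s.step i)⟩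
  have ht0 : t.head = ⊥ := by
    change s.head.map e.toLinearMap = ⊥
    rw [h0, Submodule.map_bot]
  have ht1 : t.last = ⊤ := by
    change s.last.map e.toLinearMap = ⊤
    rw [h1, Submodule.map_top, LinearEquiv.range]
  rw [compMult_eq_card t ht0 ht1, compMult_eq_card s h0 h1]
  refine Nat.card_congr (Equiv.subtypeEquivRight fun i => ?_)
  have c := subquotientMapEquiv e.toLinearMap e.injective (s i.castSucc) (s i.succ)
  exact ⟨fun ⟨g⟩ => ⟨c.symm.trans g⟩, fun ⟨g⟩ => ⟨c.trans g⟩⟩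

theorem isFiniteLength_prod (hM : IsFiniteLength R M) (hN : IsFiniteLength R N) :
    IsFiniteLength R (M × N) := by
  rw [isFiniteLength_iff_isNoetherian_isArtinian] at *
  obtain ⟨_, _⟩ := hM
  obtain ⟨_, _⟩ := hN
  exact ⟨inferInstance, inferInstance⟩

/-- Induction on the length of `N`: a maximal submodule `A` of `N` gives `M × A` inside `M × N` with
the same simple quotient `N ⧸ A`. -/
theorem compMult_prod (hM : IsFiniteLength R M) (hN : IsFiniteLength R N) :
    compMult R (M × N) E = compMult R M E + compMult R N E := by
  classical
  induction hN with
  | @of_subsingleton N _ _ _ =>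
    rw [compMult_of_subsingleton (M := N), add_zero]
    exact (compMult_congr (LinearEquiv.prodUnique.symm.trans
      ((LinearEquiv.refl R M).prodCongr (0 : PUnit ≃ₗ[R] N))) hM).symm
  | @of_simple_quotient N _ _ A hA hA' ih =>
    have h1 := compMult_of_simple_quotient (E := E)
      (f := LinearMap.prodMap (LinearMap.id : M →ₗ[R] M) A.subtype)
      (g := A.mkQ ∘ₗ LinearMap.snd R M N)
      (Function.Injective.prodMap Function.injective_id A.injective_subtype)
      (A.mkQ_surjective.comp Prod.snd_surjective) (by
        ext ⟨x, y⟩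
        simp only [LinearMap.mem_range, LinearMap.mem_ker, LinearMap.coe_comp, Function.comp_apply,
          LinearMap.snd_apply, Submodule.mkQ_apply, Submodule.Quotient.mk_eq_zero]
        constructor
        · rintro ⟨⟨x', y'⟩, h⟩
          rw [Prod.ext_iff] at h
          rw [← show (y' : N) = y from h.2]
          exact y'.2
        · intro h
          exact ⟨(x, ⟨y, h⟩), rfl⟩) (isFiniteLength_prod hM hA')
    have h2 := compMult_of_simple_quotient (E := E) A.injective_subtype A.mkQ_surjective
      (by rw [Submodule.range_subtype, Submodule.ker_mkQ]) hA'
    rw [h1, h2, ih, add_assoc]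

theorem isFiniteLength_pi {ι : Type*} [Finite ι] {U : ι → Type*} [∀ i, AddCommGroup (U i)]
    [∀ i, Module R (U i)] (hU : ∀ i, IsFiniteLength R (U i)) : IsFiniteLength R (∀ i, U i) := by
  simp only [isFiniteLength_iff_isNoetherian_isArtinian] at *
  have := fun i => (hU i).1
  have := fun i => (hU i).2
  exact ⟨inferInstance, inferInstance⟩

theorem compMult_pi {ι : Type} [Fintype ι] {U : ι → Type} [∀ i, AddCommGroup (U i)]
    [∀ i, Module R (U i)] (hU : ∀ i, IsFiniteLength R (U i)) :
    compMult R (∀ i, U i) E = ∑ i, compMult R (U i) E := by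
  classical
  -- The family `U` has to vary with the index type for the induction over finite types.
  suffices h : ∀ (ι : Type) [Fintype ι], ∀ (U : ι → Type) [∀ i, AddCommGroup (U i)]
      [∀ i, Module R (U i)], (∀ i, IsFiniteLength R (U i)) →
      compMult R (∀ i, U i) E = ∑ i, compMult R (U i) E from h ι U hU
  intro ι _
  refine Fintype.induction_empty_option (P := fun ι _ => ∀ (U : ι → Type)
    [∀ i, AddCommGroup (U i)] [∀ i, Module R (U i)], (∀ i, IsFiniteLength R (U i)) →
      compMult R (∀ i, U i) E = ∑ i, compMult R (U i) E) ?_ ?_ ?_ ι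
  · intro α β _ e ih U _ _ hU
    let _ : Fintype α := Fintype.ofEquiv β e.symm
    have h := ih (fun i => U (e i)) fun i => hU (e i)
    rw [compMult_congr (LinearEquiv.piCongrLeft' R U e.symm) (isFiniteLength_pi hU)]
    exact h.trans (e.sum_comp fun i => compMult R (U i) E)
  · intro U _ _ hU
    rw [compMult_of_subsingleton]
    rfl
  · intro α _ ih U _ _ hU
    rw [compMult_congr (LinearEquiv.piOptionEquivProd R) (isFiniteLength_pi hU),
      compMult_prod (hU none) (isFiniteLength_pi fun i => hU (some i)),
      ih _ fun i => hU (some i), Fintype.sum_option]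

end CompMult

/-! ### Composition multiplicities under restriction to a subalgebra -/

section Restriction

/-- The multiplicity of a simple module does not change under restriction to a subalgebra that has
the same action on simple modules. -/
theorem compMult_restrict {R : Type*} [Ring R] [Algebra ℂ R] (S : Subalgebra ℂ R) {M E : Type}
    [AddCommGroup M] [Module R M] [AddCommGroup E] [Module R E] [IsSimpleModule R E]
    (hS : ∀ a : R, ∃ b : S, ∀ (X : Type) [AddCommGroup X] [Module R X] [IsSimpleModule R X] (x : X),
      a • x = b • x) (hM : IsFiniteLength R M) : compMult R M E = compMult S M E := by
  -- In a simple module every nonzero vector is a generator, and an element of `R` that carries `x`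
  -- to `y` can be replaced by one of `S`.
  have hsub : ∀ (X : Type) [AddCommGroup X] [Module R X] [IsSimpleModule R X],
      IsSimpleModule S X := by
    intro X _ _ _
    have := IsSimpleModule.nontrivial R X
    rw [isSimpleModule_iff_toSpanSingleton_surjective]
    refine ⟨this, fun x hx y => ?_⟩
    obtain ⟨a, rfl⟩ := IsSimpleModule.toSpanSingleton_surjective R hx y
    obtain ⟨b, hb⟩ := hS a
    exact ⟨b, (hb X x).symm⟩
  obtain ⟨s, h0, h1⟩ := isFiniteLength_iff_exists_compositionSeries.1 hM
  have hq : ∀ A B : Submodule R M, Nonempty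
      ((B.restrictScalars S ⧸ (A.restrictScalars S).submoduleOf (B.restrictScalars S)) ≃ₗ[S]
        (B ⧸ A.submoduleOf B)) := fun A B =>
    ⟨Submodule.Quotient.restrictScalarsEquiv S (A.submoduleOf B)⟩
  -- The composition series over `R` stays one over `S`, so it remains to compare the isomorphism
  -- types of its factors.
  let t : CompositionSeries (Submodule S M) := ⟨s.length, fun i => (s i).restrictScalars S,
    fun i => by
      have hcov : s i.castSucc ⋖ s i.succ := s.step i
      have : IsSimpleModule R (s i.succ ⧸ (s i.castSucc).submoduleOf (s i.succ)) :=
        (covBy_iff_quot_is_simple hcov.le).1 hcov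
      have h2 := hsub (s i.succ ⧸ (s i.castSucc).submoduleOf (s i.succ))
      exact (covBy_iff_quot_is_simple (A := (s i.castSucc).restrictScalars S)
        (B := (s i.succ).restrictScalars S) hcov.le).2 (IsSimpleModule.congr (hq _ _).some)⟩
  have ht0 : t.head = ⊥ := by
    change s.head.restrictScalars S = ⊥
    rw [h0]
    rfl
  have ht1 : t.last = ⊤ := by
    change s.last.restrictScalars S = ⊤
    rw [h1]
    rfl
  rw [compMult_eq_card t ht0 ht1, compMult_eq_card s h0 h1]
  refine Nat.card_congr (Equiv.subtypeEquivRight fun i => ?_)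
  have hcov : s i.castSucc ⋖ s i.succ := s.step i
  have : IsSimpleModule R (s i.succ ⧸ (s i.castSucc).submoduleOf (s i.succ)) :=
    (covBy_iff_quot_is_simple hcov.le).1 hcov
  obtain ⟨c⟩ := hq (s i.castSucc) (s i.succ)
  constructor
  · rintro ⟨e⟩
    exact ⟨c.trans (e.restrictScalars S)⟩
  · rintro ⟨e⟩
    -- An `S`-isomorphism between simple `R`-modules is `R`-linear, because `a` acts on both of them
    -- as one and the same `b` in `S`.
    let e' := c.symm.trans e
    exact ⟨{ e' with
      map_smul' := fun a x => by
        obtain ⟨b, hb⟩ := hS a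
        change e' (a • x) = a • e' x
        rw [hb, hb, map_smul] }⟩

end Restriction
end PartialBrauer

namespace PartialBrauer

/-! ### Simple modules of the partial Brauer algebra -/

section SimpleModules
variable {n : ℕ} {δ : ℂ}

theorem singletons_le (d : Diagram n) : singletons d.rel ≤ 2 * n := by
  have : Nat.card (Fin n ⊕ Fin n) = 2 * n := by
    rw [Nat.card_eq_fintype_card, Fintype.card_sum, Fintype.card_fin, two_mul]
  rw [← this]
  exact Nat.card_le_card_of_injective _ Subtype.val_injective

/-- The span of the diagrams with at least `i` singletons. -/
noncomputable def singletonFilt (n : ℕ) (δ : ℂ) (i : ℕ) : Submodule ℂ (PBAlgebra n δ 0) :=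
  Submodule.span ℂ (PBAlgebra.of '' {d | i ≤ singletons d.rel})

theorem singletonFilt_zero : singletonFilt n δ 0 = ⊤ := by
  rw [eq_top_iff, ← (PBAlgebra.basis n δ 0).span_eq]
  refine Submodule.span_mono ?_
  rintro _ ⟨d, rfl⟩
  exact ⟨d, Nat.zero_le _, rfl⟩

/-- Singletons can disappear in a product only inside open strings, and these carry the factor `0`.
In all other products the numbers of singletons add up. -/
theorem singletonFilt_mul (i j : ℕ) :
    singletonFilt n δ i * singletonFilt n δ j ≤ singletonFilt n δ (i + j) := by
  unfold singletonFilt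
  rw [Submodule.span_mul_span, Submodule.span_le]
  rintro _ ⟨_, ⟨d, hd, rfl⟩, _, ⟨e, he, rfl⟩, rfl⟩
  have hd : i ≤ singletons d.rel := hd
  have he : j ≤ singletons e.rel := he
  change PBAlgebra.of d * PBAlgebra.of e ∈ Submodule.span ℂ _
  rw [PBAlgebra.of_mul_of]
  by_cases hs : strings d.rel e.rel = 0
  · refine Submodule.smul_mem _ _ (Submodule.subset_span ⟨_, ?_, rfl⟩)
    have h := singletons_comp d.thin e.thin
    rw [← Diagram.mul_rel] at h
    change i + j ≤ _
    omega
  · unfold Diagram.factor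
    rw [zero_pow hs, mul_zero, zero_smul]
    exact Submodule.zero_mem _

theorem pow_mem_singletonFilt {a : PBAlgebra n δ 0} (ha : a ∈ singletonFilt n δ 1) (i : ℕ) :
    a ^ i ∈ singletonFilt n δ i := by
  induction i with
  | zero => rw [singletonFilt_zero]; trivial
  | succ i ih =>
    rw [pow_succ]
    exact singletonFilt_mul i 1 (Submodule.mul_mem_mul ih ha)

/-- A diagram has only `2 * n` vertices, so it cannot have `2 * n + 1` singletons. -/
theorem pow_eq_zero_of_mem_singletonFilt {a : PBAlgebra n δ 0} (ha : a ∈ singletonFilt n δ 1) :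
    a ^ (2 * n + 1) = 0 := by
  have h := pow_mem_singletonFilt ha (2 * n + 1)
  have hempty : {d : Diagram n | 2 * n + 1 ≤ singletons d.rel} = ∅ := by
    ext d
    have := singletons_le d
    simp only [Set.mem_ofPred_eq, Set.mem_empty_iff_false, iff_false]
    omega
  rw [singletonFilt, hempty, Set.image_empty, Submodule.span_empty] at h
  exact h

/-- If `d` did not kill `x`, simplicity would provide `a` with `a d x = x`. But `a d` lies in the
ideal spanned by diagrams with singletons and is nilpotent. -/
theorem of_smul_eq_zero {d : Diagram n} (hd : ¬ d.IsBrauer) {X : Type*} [AddCommGroup X]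
    [Module (PBAlgebra n δ 0) X] [IsSimpleModule (PBAlgebra n δ 0) X] (x : X) :
    (PBAlgebra.of d : PBAlgebra n δ 0) • x = 0 := by
  by_contra hx
  obtain ⟨a, ha⟩ := IsSimpleModule.toSpanSingleton_surjective (PBAlgebra n δ 0) hx x
  have ha : (a * PBAlgebra.of d) • x = x := by
    rw [mul_smul]
    exact ha
  have hmem : a * PBAlgebra.of d ∈ singletonFilt n δ 1 := by
    have h1 : a ∈ singletonFilt n δ 0 := by rw [singletonFilt_zero]; trivial
    have h2 : PBAlgebra.of d ∈ singletonFilt n δ 1 := Submodule.subset_span ⟨d, by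
      rw [Diagram.isBrauer_iff] at hd
      exact Nat.one_le_iff_ne_zero.2 hd, rfl⟩
    have := singletonFilt_mul 0 1 (Submodule.mul_mem_mul h1 h2)
    rwa [zero_add] at this
  have hpow : ∀ i, (a * PBAlgebra.of d) ^ i • x = x := by
    intro i
    induction i with
    | zero => rw [pow_zero, one_smul]
    | succ i ih => rw [pow_succ, mul_smul, ha, ih]
  have h0 := hpow (2 * n + 1)
  rw [pow_eq_zero_of_mem_singletonFilt hmem, zero_smul] at h0
  rw [← h0, smul_zero] at hx
  exact hx rfl

/-- Diagrams with a singleton act by zero on simple modules and can be dropped from `a`. The element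
`b` is found before `X` is given, as `compMult_restrict` needs the same `b` on different simple
modules. -/
theorem exists_brauer_smul_eq (a : PBAlgebra n δ 0) : ∃ b : brauer n δ 0,
    ∀ (X : Type) [AddCommGroup X] [Module (PBAlgebra n δ 0) X]
      [IsSimpleModule (PBAlgebra n δ 0) X] (x : X), a • x = b • x := by
  induction a using PBAlgebra.induction with
  | h0 => exact ⟨0, fun X _ _ _ x => by rw [zero_smul, zero_smul]⟩
  | hadd a a' h h' =>
    obtain ⟨b, hb⟩ := h
    obtain ⟨b', hb'⟩ := h'
    exact ⟨b + b', fun X _ _ _ x => by rw [add_smul, add_smul, hb, hb']⟩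
  | hsmul c a h =>
    obtain ⟨b, hb⟩ := h
    refine ⟨algebraMap ℂ _ c * b, fun X _ _ _ x => ?_⟩
    rw [Algebra.smul_def, mul_smul, mul_smul, hb]
    rfl
  | hof d =>
    by_cases hd : d.IsBrauer
    · exact ⟨⟨PBAlgebra.of d, Submodule.subset_span ⟨d, hd, rfl⟩⟩, fun X _ _ _ x => rfl⟩
    · exact ⟨0, fun X _ _ _ x => by rw [zero_smul, of_smul_eq_zero hd]⟩

end SimpleModules
end PartialBrauer

namespace PartialBrauer
open Diagram

/-! ### Ends of propagating lines -/

section Cells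
variable {n : ℕ}

theorem mem_rightEnds_iff {d : Diagram n} {j : Fin n} :
    j ∈ d.rightEnds ↔ ∃ i, d.rel (Sum.inl i) (Sum.inr j) := by
  classical
  unfold rightEnds
  rw [Finset.mem_filter_univ]

theorem eq_of_rel_of_mem_rightEnds {d : Diagram n} {i j : Fin n} (hi : i ∈ d.rightEnds)
    (h : d.rel (Sum.inr i) (Sum.inr j)) : i = j := by
  obtain ⟨a, ha⟩ := mem_rightEnds_iff.1 hi
  rcases d.thin _ _ _ (d.rel.symm ha) h with h | h | h
  · cases h
  · exact Sum.inr_injective h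
  · cases h

theorem left_eq_of_rel {d : Diagram n} {a b j : Fin n} (ha : d.rel (Sum.inl a) (Sum.inr j))
    (hb : d.rel (Sum.inl b) (Sum.inr j)) : a = b := by
  rcases d.thin _ _ _ (d.rel.symm ha) (d.rel.symm hb) with h | h | h
  · cases h
  · cases h
  · exact Sum.inl_injective h

theorem right_eq_of_rel {d : Diagram n} {a i j : Fin n} (ha : d.rel (Sum.inl a) (Sum.inr i))
    (hb : d.rel (Sum.inl a) (Sum.inr j)) : i = j := by
  rcases d.thin _ _ _ ha hb with h | h | h
  · cases h
  · cases h
  · exact Sum.inr_injective h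

theorem mem_classes_of_notMem_rightEnds {d : Diagram n} {j : Fin n} (hj : j ∉ d.rightEnds) :
    Sum.inr '' {i | d.rel (Sum.inr i) (Sum.inr j)} ∈ d.rel.classes := by
  refine ⟨Sum.inr j, ?_⟩
  ext x
  constructor
  · rintro ⟨i, hi, rfl⟩
    exact hi
  · intro hx
    rcases x with x | x
    · exact absurd (mem_rightEnds_iff.2 ⟨x, hx⟩) hj
    · exact ⟨x, hx, rfl⟩

theorem rel_iff_of_mem_classes {d : Diagram n} {X : Set (Fin n)} {j : Fin n} (hj : j ∈ X)
    (hX : Sum.inr '' X ∈ d.rel.classes) (x : Fin n ⊕ Fin n) :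
    d.rel x (Sum.inr j) ↔ x ∈ Sum.inr '' X := by
  obtain ⟨y, hy⟩ := hX
  have h1 : d.rel (Sum.inr j) y := by
    have : (Sum.inr j : Fin n ⊕ Fin n) ∈ Sum.inr '' X := ⟨j, hj, rfl⟩
    rw [hy] at this
    exact this
  rw [hy]
  exact ⟨fun h => d.rel.trans h h1, fun h => d.rel.trans h (d.rel.symm h1)⟩

/-- One inclusion of right parts is enough: a right part of `e` contains no right end of `d`, so
each of its vertices already lies in a right part of `d`. That part survives in `e` and is therefore
the given one. -/
theorem leftCell_of_subset {d e : Diagram n}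
    (h : ∀ X : Set (Fin n), Sum.inr '' X ∈ d.rel.classes → Sum.inr '' X ∈ e.rel.classes)
    (hr : d.rightEnds ⊆ e.rightEnds) : leftCell n d e := by
  intro X
  refine ⟨h X, fun hX => ?_⟩
  obtain ⟨y, hy⟩ := hX
  have hyX : y ∈ Sum.inr '' X := by rw [hy]; exact e.rel.refl y
  obtain ⟨j, hj, rfl⟩ := hyX
  have hX : Sum.inr '' X ∈ e.rel.classes := ⟨_, hy⟩
  have hjd : j ∉ d.rightEnds := fun hj' => mem_rightEnds.1 (hr hj') X hX hj
  have h1 := mem_classes_of_notMem_rightEnds hjd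
  have h2 : X = {i | d.rel (Sum.inr i) (Sum.inr j)} := by
    ext i
    have ha := rel_iff_of_mem_classes hj hX (Sum.inr i)
    have hb := rel_iff_of_mem_classes (d.rel.refl _) (h _ h1) (Sum.inr i)
    rw [ha] at hb
    rw [Sum.inr_injective.mem_set_image, Sum.inr_injective.mem_set_image] at hb
    exact hb
  rw [h2]
  exact h1

/-- The form in which cells are used below: a right vertex is the end of a propagating line or lies
in a part inside the right side, and the parts of the latter kind are read off from the relation
between right vertices. -/
theorem leftCell_iff {d e : Diagram n} : leftCell n d e ↔ e.rightEnds = d.rightEnds ∧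
    ∀ i j, d.rel (Sum.inr i) (Sum.inr j) ↔ e.rel (Sum.inr i) (Sum.inr j) := by
  constructor
  · intro h
    refine ⟨rightEnds_eq h, ?_⟩
    have key : ∀ {d e : Diagram n}, leftCell n d e → ∀ i j, d.rel (Sum.inr i) (Sum.inr j) →
        e.rel (Sum.inr i) (Sum.inr j) := by
      intro d e h i j hij
      by_cases hj : j ∈ d.rightEnds
      · rw [eq_of_rel_of_mem_rightEnds hj (d.rel.symm hij)]
      · have h1 := (h _).1 (mem_classes_of_notMem_rightEnds hj)
        exact (rel_iff_of_mem_classes (d.rel.refl _) h1 _).2 ⟨i, hij, rfl⟩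
    exact fun i j => ⟨key h i j, key ((leftCell n).symm h) i j⟩
  · rintro ⟨hr, h⟩
    refine leftCell_of_subset (fun X hX => ?_) hr.ge
    obtain ⟨y, hy⟩ := hX
    have hyX : y ∈ Sum.inr '' X := by rw [hy]; exact d.rel.refl y
    obtain ⟨j, hj, rfl⟩ := hyX
    have hX : Sum.inr '' X ∈ d.rel.classes := ⟨_, hy⟩
    have hje : j ∉ e.rightEnds := fun hj' => mem_rightEnds.1 (hr ▸ hj') X hX hj
    have h1 := mem_classes_of_notMem_rightEnds hje
    have h2 : X = {i | e.rel (Sum.inr i) (Sum.inr j)} := by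
      ext i
      have ha := rel_iff_of_mem_classes hj hX (Sum.inr i)
      rw [Sum.inr_injective.mem_set_image, h] at ha
      exact ha.symm
    rw [h2]
    exact h1

theorem eq_of_leftCell {d e : Diagram n} (h : leftCell n d e)
    (h1 : ∀ a b, d.rel (Sum.inl a) (Sum.inl b) ↔ e.rel (Sum.inl a) (Sum.inl b))
    (h2 : ∀ a j, d.rel (Sum.inl a) (Sum.inr j) ↔ e.rel (Sum.inl a) (Sum.inr j)) : d = e := by
  apply Diagram.ext
  ext x y
  rcases x with x | x <;> rcases y with y | y
  · exact h1 x y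
  · exact h2 x y
  · rw [Setoid.comm' d.rel, Setoid.comm' e.rel]
    exact h2 y x
  · exact (leftCell_iff.1 h).2 x y

/-- The parts of `d` already have two elements, so they cannot be enlarged within a diagram. -/
theorem IsBrauer.eq_of_le {d e : Diagram n} (hd : d.IsBrauer)
    (h : ∀ x y, d.rel x y → e.rel x y) : d = e := by
  apply Diagram.ext
  ext x y
  refine ⟨h x y, fun hxy => ?_⟩
  have hx := hd x
  unfold IsSingleton at hx
  push Not at hx
  obtain ⟨z, hz, hne⟩ := hx
  rcases e.thin _ _ _ hxy (h _ _ hz) with h1 | h1 | h1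
  · rw [h1]
  · exact absurd h1.symm hne
  · rwa [h1]

open Classical in
/-- The left ends of the propagating lines of `d`. -/
noncomputable def leftEnds (d : Diagram n) : Finset (Fin n) :=
  {i | ∃ j, d.rel (Sum.inl i) (Sum.inr j)}

theorem mem_leftEnds_iff {d : Diagram n} {i : Fin n} :
    i ∈ leftEnds d ↔ ∃ j, d.rel (Sum.inl i) (Sum.inr j) := by
  classical
  unfold leftEnds
  rw [Finset.mem_filter_univ]

theorem card_leftEnds (d : Diagram n) : (leftEnds d).card = d.propNumber := by
  classical
  have h1 : ∀ i ∈ leftEnds d, ∃ j, d.rel (Sum.inl i) (Sum.inr j) := fun i => mem_leftEnds_iff.1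
  choose f hf using h1
  refine Finset.card_bij f (fun i hi => mem_rightEnds_iff.2 ⟨i, hf i hi⟩) ?_ ?_
  · intro i hi i' hi' h
    exact left_eq_of_rel (hf i hi) (h ▸ hf i' hi')
  · intro j hj
    obtain ⟨i, hi⟩ := mem_rightEnds_iff.1 hj
    exact ⟨i, mem_leftEnds_iff.2 ⟨j, hi⟩, right_eq_of_rel (hf i _) hi⟩

theorem leftSingletons_eq_card (d : Diagram n)
    [DecidablePred fun i => IsSingleton d.rel (Sum.inl i)] :
    d.leftSingletons = (Finset.univ.filter fun i => IsSingleton d.rel (Sum.inl i)).card := by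
  rw [leftSingletons, Nat.card_eq_fintype_card, Fintype.card_subtype]

/-- Left vertices that are neither ends of propagating lines nor singletons are paired with one
another. -/
theorem even_sub_propNumber (d : Diagram n) :
    d.propNumber + d.leftSingletons ≤ n ∧ Even (n - (d.propNumber + d.leftSingletons)) := by
  classical
  -- The partner on the left side, with vertices joined to the right side kept fixed. The fixed
  -- points are thus the left ends and the left singletons, and the support of an involution has
  -- even size.
  let f : Fin n → Fin n := fun i => (mate d.rel (Sum.inl i)).elim id fun _ => i
  have hf1 : ∀ i j, mate d.rel (Sum.inl i) = Sum.inl j → f i = j := fun i j h => by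
    simp only [f, h, Sum.elim_inl, id]
  have hf2 : ∀ i j, mate d.rel (Sum.inl i) = Sum.inr j → f i = i := fun i j h => by
    simp only [f, h, Sum.elim_inr]
  have hf : Function.Involutive f := by
    intro i
    rcases h : mate d.rel (Sum.inl i) with j | j
    · rw [hf1 i j h]
      apply hf1
      rw [← h, mate_mate d.thin]
    · rw [hf2 i j h, hf2 i j h]
  let σ : Equiv.Perm (Fin n) := hf.toPerm
  have h2 := Equiv.Perm.two_dvd_card_support (σ := σ) (by
    ext i
    rw [pow_two, Equiv.Perm.mul_apply]
    exact congrArg _ (hf i))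
  have hfix : ∀ i, f i = i ↔ i ∈ leftEnds d ∨ IsSingleton d.rel (Sum.inl i) := by
    intro i
    rw [← mate_fix, mem_leftEnds_iff]
    rcases h : mate d.rel (Sum.inl i) with j | j
    · rw [hf1 i j h]
      constructor
      · rintro rfl
        exact Or.inr rfl
      · rintro (⟨a, ha⟩ | h')
        · have := mate_eq d.thin ha (by simp)
          rw [h] at this
          cases this
        · exact Sum.inl_injective h'
    · rw [hf2 i j h]
      exact ⟨fun _ => Or.inl ⟨j, h ▸ mate_rel d.rel _⟩, fun _ => rfl⟩
  have hcompl : σ.supportᶜ = leftEnds d ∪ Finset.univ.filter fun i =>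
      IsSingleton d.rel (Sum.inl i) := by
    ext i
    rw [Finset.mem_compl, Equiv.Perm.notMem_support, Finset.mem_union, Finset.mem_filter_univ]
    exact hfix i
  have hdisj : Disjoint (leftEnds d) (Finset.univ.filter fun i =>
      IsSingleton d.rel (Sum.inl i)) := by
    rw [Finset.disjoint_left]
    intro i hi hs
    obtain ⟨j, hj⟩ := mem_leftEnds_iff.1 hi
    cases (Finset.mem_filter_univ _).1 hs _ hj
  have hcard := congrArg Finset.card hcompl
  rw [Finset.card_union_of_disjoint hdisj, card_leftEnds, ← leftSingletons_eq_card,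
    Finset.card_compl, Fintype.card_fin] at hcard
  have hle := σ.support.card_le_univ
  rw [Fintype.card_fin] at hle
  refine ⟨by omega, ?_⟩
  rw [show n - (d.propNumber + d.leftSingletons) = σ.support.card by omega]
  exact even_iff_two_dvd.2 h2

theorem rightSingletons_eq {d e : Diagram n} (h : leftCell n d e) :
    Nat.card {j : Fin n // IsSingleton d.rel (Sum.inr j)} =
      Nat.card {j : Fin n // IsSingleton e.rel (Sum.inr j)} := by
  simp only [isSingleton_inr, h _]

end Cells
end PartialBrauer

namespace PartialBrauer
open Diagram

/-! ### Products of diagrams as kernels of functions -/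

section JuxtKer
variable {A B C : Type*}

theorem juxt_left {p : Setoid (A ⊕ B)} {q : Setoid (B ⊕ C)} {x y : A ⊕ B} (h : p x y) :
    juxt p q (Sum.map id Sum.inl x) (Sum.map id Sum.inl y) :=
  Relation.EqvGen.rel _ _ (Or.inl ⟨x, y, h, rfl, rfl⟩)

theorem juxt_right {p : Setoid (A ⊕ B)} {q : Setoid (B ⊕ C)} {x y : B ⊕ C} (h : q x y) :
    juxt p q (Sum.inr x) (Sum.inr y) :=
  Relation.EqvGen.rel _ _ (Or.inr ⟨x, y, h, rfl, rfl⟩)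

/-- The composition of two set partitions is the kernel of `f` if `f` is constant on connected
components and separates those that meet the exterior. -/
theorem compRel_iff {p : Setoid (A ⊕ B)} {q : Setoid (B ⊕ C)} {Y : Type*} (f : A ⊕ B ⊕ C → Y)
    (hp : ∀ x y, p x y → f (Sum.map id Sum.inl x) = f (Sum.map id Sum.inl y))
    (hq : ∀ x y, q x y → f (Sum.inr x) = f (Sum.inr y))
    (h : ∀ x y, f (outer x) = f (outer y) → juxt p q (outer x) (outer y)) (x y : A ⊕ C) :
    compRel p q x y ↔ f (outer x) = f (outer y) :=
  ⟨fun hxy => (juxt_compat f).2 ⟨hp, hq⟩ _ _ hxy, h x y⟩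

end JuxtKer

/-! ### Multiplication by permutations from the left -/

section Perm
variable {n : ℕ}

theorem perm_mul_rel (π : Equiv.Perm (Fin n)) (d : Diagram n) (x y : Fin n ⊕ Fin n) :
    (perm π * d).rel x y ↔ d.rel (Sum.map π.symm id x) (Sum.map π.symm id y) := by
  -- Each vertex of the juxtaposition is sent to the part of `d` with which it is connected.
  let f : Fin n ⊕ Fin n ⊕ Fin n → Quotient d.rel :=
    Sum.elim (fun i => (Quotient.mk _ (Sum.inl (π.symm i)))) fun z => (Quotient.mk _ (z))
  have hf : ∀ z, f (Sum.map id Sum.inl z) = (Quotient.mk _ (Sum.inl (π.symm (Sum.elim id π z)))) := by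
    rintro (z | z)
    · rfl
    · simp [f]
  have hf' : ∀ z : Fin n ⊕ Fin n, f (outer z) = (Quotient.mk _ (Sum.map π.symm id z)) := by
    rintro (z | z) <;> rfl
  have hj : ∀ z : Fin n ⊕ Fin n, juxt (perm π).rel d.rel (outer z)
      (Sum.inr (Sum.map π.symm id z)) := by
    rintro (z | z)
    · exact juxt_left (x := Sum.inl z) (y := Sum.inr (π.symm z)) (by simp [perm_rel_iff])
    · exact Setoid.refl' _ _
  rw [mul_rel, compRel_iff f, hf', hf']
  · exact Quotient.eq
  · intro x y h
    rw [hf, hf, (perm_rel_iff π x y).1 h]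
  · intro x y h
    exact Quotient.sound h
  · intro x y h
    rw [hf', hf'] at h
    exact Setoid.trans' _ (hj x) (Setoid.trans' _ (juxt_right (Quotient.exact h))
      (Setoid.symm' _ (hj y)))

end Perm

/-! ### Cutting propagating lines -/

section Cut
variable {n k l : ℕ}

/-- The right ends of the propagating lines in increasing order. -/
noncomputable def endpt (d : Diagram n) {m : ℕ} (hm : d.propNumber = m) : Fin m ↪o Fin n :=
  d.rightEnds.orderEmbOfFin hm

theorem endpt_mem (d : Diagram n) {m : ℕ} (hm : d.propNumber = m) (t : Fin m) :
    endpt d hm t ∈ d.rightEnds := Finset.orderEmbOfFin_mem _ _ _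

theorem exists_endpt {d : Diagram n} {m : ℕ} (hm : d.propNumber = m) {j : Fin n}
    (hj : j ∈ d.rightEnds) : ∃ t, endpt d hm t = j := by
  have : j ∈ Set.range (d.rightEnds.orderEmbOfFin hm) := by
    rw [Finset.range_orderEmbOfFin]
    exact hj
  exact this

theorem permEnds_endpt (d : Diagram n) {m : ℕ} (hm : d.propNumber = m) (σ : Equiv.Perm (Fin m))
    (t : Fin m) : d.permEnds hm σ (endpt d hm t) = endpt d hm (σ t) :=
  Equiv.Perm.viaEmbedding_apply σ (d.rightEnds.orderEmbOfFin hm).toEmbedding t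

variable (d₀ : Diagram n) (hk : d₀.propNumber = k) (e : Diagram n) (hm : e.propNumber = k + l)

open Classical in
/-- The function whose fibres are the parts of the cut diagram. -/
noncomputable def cutFun : Fin n ⊕ Fin n → Quotient d₀.rel ⊕ Fin n :=
  Sum.elim
    (fun i => if h : ∃ t : Fin k, endpt e hm (Fin.castAdd l t) = i then
      Sum.inl (Quotient.mk _ (Sum.inr (endpt d₀ hk h.choose))) else Sum.inr i)
    (fun j => Sum.inl (Quotient.mk _ (Sum.inr j)))

theorem cutFun_endpt (t : Fin k) : cutFun d₀ hk e hm (Sum.inl (endpt e hm (Fin.castAdd l t))) =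
    Sum.inl (Quotient.mk _ (Sum.inr (endpt d₀ hk t))) := by
  have h : ∃ s : Fin k, endpt e hm (Fin.castAdd l s) = endpt e hm (Fin.castAdd l t) := ⟨t, rfl⟩
  simp only [cutFun, Sum.elim_inl, dif_pos h]
  have := Fin.castAdd_injective k l ((endpt e hm).injective h.choose_spec)
  rw [this]

theorem cutFun_of_forall_ne {i : Fin n} (h : ∀ t : Fin k, endpt e hm (Fin.castAdd l t) ≠ i) :
    cutFun d₀ hk e hm (Sum.inl i) = Sum.inr i := by
  simp only [cutFun, Sum.elim_inl]
  rw [dif_neg (by simpa using h)]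

theorem cutFun_inl_inl {i j : Fin n} :
    cutFun d₀ hk e hm (Sum.inl i) = cutFun d₀ hk e hm (Sum.inl j) ↔ i = j := by
  refine ⟨fun h => ?_, fun h => h ▸ rfl⟩
  by_cases hi : ∃ t : Fin k, endpt e hm (Fin.castAdd l t) = i
  · obtain ⟨t, rfl⟩ := hi
    rw [cutFun_endpt] at h
    by_cases hj : ∃ t : Fin k, endpt e hm (Fin.castAdd l t) = j
    · obtain ⟨s, rfl⟩ := hj
      rw [cutFun_endpt] at h
      have h1 : d₀.rel _ _ := Quotient.exact (Sum.inl_injective h)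
      rw [(endpt d₀ hk).injective (eq_of_rel_of_mem_rightEnds (endpt_mem d₀ hk t) h1)]
    · rw [cutFun_of_forall_ne d₀ hk e hm (by simpa using hj)] at h
      cases h
  · rw [cutFun_of_forall_ne d₀ hk e hm (by simpa using hi)] at h
    by_cases hj : ∃ t : Fin k, endpt e hm (Fin.castAdd l t) = j
    · obtain ⟨s, rfl⟩ := hj
      rw [cutFun_endpt] at h
      cases h
    · rw [cutFun_of_forall_ne d₀ hk e hm (by simpa using hj)] at h
      exact Sum.inr_injective h

theorem cutFun_inl_inr {i j : Fin n} :
    cutFun d₀ hk e hm (Sum.inl i) = cutFun d₀ hk e hm (Sum.inr j) ↔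
      ∃ t : Fin k, i = endpt e hm (Fin.castAdd l t) ∧ j = endpt d₀ hk t := by
  constructor
  · intro h
    by_cases hi : ∃ t : Fin k, endpt e hm (Fin.castAdd l t) = i
    · obtain ⟨t, rfl⟩ := hi
      rw [cutFun_endpt] at h
      have h1 : d₀.rel _ _ := Quotient.exact (Sum.inl_injective h)
      exact ⟨t, rfl, (eq_of_rel_of_mem_rightEnds (endpt_mem d₀ hk t) h1).symm⟩
    · rw [cutFun_of_forall_ne d₀ hk e hm (by simpa using hi)] at h
      cases h
  · rintro ⟨t, rfl, rfl⟩
    exact cutFun_endpt d₀ hk e hm t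

/-- The diagram that connects the first `k` right ends of `e` with the right ends of `d₀`, cuts all
other lines, and has the parts of `d₀` on the right. -/
noncomputable def cut : Diagram n where
  rel := Setoid.ker (cutFun d₀ hk e hm)
  thin := by
    have hend : ∀ {i j : Fin n} {z : Fin n ⊕ Fin n},
        cutFun d₀ hk e hm (Sum.inl i) = cutFun d₀ hk e hm (Sum.inr j) →
        cutFun d₀ hk e hm z = cutFun d₀ hk e hm (Sum.inr j) → z = Sum.inl i ∨ z = Sum.inr j := by
      rintro i j (z | z) h1 h2
      · exact Or.inl (congrArg _ ((cutFun_inl_inl d₀ hk e hm).1 (h2.trans h1.symm)))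
      · right
        obtain ⟨t, rfl, rfl⟩ := (cutFun_inl_inr d₀ hk e hm).1 h1
        have h3 : d₀.rel (Sum.inr z) (Sum.inr (endpt d₀ hk t)) :=
          Quotient.exact (Sum.inl_injective h2)
        rw [eq_of_rel_of_mem_rightEnds (endpt_mem d₀ hk t) (d₀.rel.symm h3)]
    rintro (x | x) (y | y) (z | z) hxy hxz <;> rw [Setoid.ker_def] at hxy hxz
    · exact Or.inl (congrArg _ ((cutFun_inl_inl d₀ hk e hm).1 hxy))
    · exact Or.inl (congrArg _ ((cutFun_inl_inl d₀ hk e hm).1 hxy))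
    · exact Or.inr (Or.inl (congrArg _ ((cutFun_inl_inl d₀ hk e hm).1 hxz)))
    · rcases hend hxy (hxz.symm.trans hxy) with h | h
      · cases h
      · exact Or.inr (Or.inr h.symm)
    · exact Or.inr (Or.inr (congrArg _ ((cutFun_inl_inl d₀ hk e hm).1 (hxy.symm.trans hxz))))
    · rcases hend hxy.symm hxz.symm with h | h
      · cases h
      · exact Or.inr (Or.inl h.symm)
    · rcases hend hxz.symm hxy.symm with h | h
      · cases h
      · exact Or.inl h.symm
    · rcases d₀.thin _ _ _ (Quotient.exact (Sum.inl_injective hxy))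
        (Quotient.exact (Sum.inl_injective hxz)) with h | h | h
      · exact Or.inl h
      · exact Or.inr (Or.inl h)
      · exact Or.inr (Or.inr h)

theorem cut_inl_inl {i j : Fin n} :
    (cut d₀ hk e hm).rel (Sum.inl i) (Sum.inl j) ↔ i = j := cutFun_inl_inl d₀ hk e hm

theorem cut_inl_inr {i j : Fin n} : (cut d₀ hk e hm).rel (Sum.inl i) (Sum.inr j) ↔
    ∃ t : Fin k, i = endpt e hm (Fin.castAdd l t) ∧ j = endpt d₀ hk t :=
  cutFun_inl_inr d₀ hk e hm

theorem cut_inr_inr {i j : Fin n} :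
    (cut d₀ hk e hm).rel (Sum.inr i) (Sum.inr j) ↔ d₀.rel (Sum.inr i) (Sum.inr j) :=
  ⟨fun h => Quotient.exact (Sum.inl_injective h), fun h => congrArg Sum.inl (Quotient.sound h)⟩

/-- Permutations of the ends that do not mix the first `k` with the others pass through the cut. -/
theorem perm_mul_cut (σ : Equiv.Perm (Fin k)) (τ : Equiv.Perm (Fin l)) :
    perm (e.permEnds hm (youngEmb k l (σ, τ))) * cut d₀ hk e hm =
      (cut d₀ hk e hm).relabel (d₀.permEnds hk σ) := by
  have hy : ∀ t, youngEmb k l (σ, τ) (Fin.castAdd l t) = Fin.castAdd l (σ t) := by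
    intro t
    simp [youngEmb, Equiv.permCongrHom]
  have hcell := (leftCell_iff.1 (leftCell_relabel (d := d₀) (π := d₀.permEnds hk σ)
    (permEnds_fix d₀ hk σ))).2
  have key : ∀ i j, (perm (e.permEnds hm (youngEmb k l (σ, τ))) * cut d₀ hk e hm).rel (Sum.inl i)
      (Sum.inr j) ↔ ((cut d₀ hk e hm).relabel (d₀.permEnds hk σ)).rel (Sum.inl i) (Sum.inr j) := by
    intro i j
    rw [perm_mul_rel]
    change (cut d₀ hk e hm).rel (Sum.inl _) (Sum.inr j) ↔
      (cut d₀ hk e hm).rel (Sum.inl i) (Sum.inr (d₀.permEnds hk σ j))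
    rw [cut_inl_inr, cut_inl_inr]
    constructor
    · rintro ⟨t, h1, rfl⟩
      rw [Equiv.symm_apply_eq, permEnds_endpt, hy] at h1
      exact ⟨σ t, h1, permEnds_endpt d₀ hk σ t⟩
    · rintro ⟨t, h1, h2⟩
      refine ⟨σ.symm t, ?_, ?_⟩
      · rw [Equiv.symm_apply_eq, permEnds_endpt, hy, σ.apply_symm_apply]
        exact h1
      · apply (d₀.permEnds hk σ).injective
        rw [h2, permEnds_endpt, σ.apply_symm_apply]
  apply Diagram.ext
  ext x y
  rcases x with i | i <;> rcases y with j | j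
  · rw [perm_mul_rel]
    change (cut d₀ hk e hm).rel (Sum.inl _) (Sum.inl _) ↔
      (cut d₀ hk e hm).rel (Sum.inl i) (Sum.inl j)
    rw [cut_inl_inl, cut_inl_inl]
    exact (Equiv.injective _).eq_iff
  · exact key i j
  · rw [Setoid.comm', key, Setoid.comm']
  · rw [perm_mul_rel]
    change (cut d₀ hk e hm).rel (Sum.inr i) (Sum.inr j) ↔
      (cut d₀ hk e hm).rel (Sum.inr _) (Sum.inr _)
    rw [cut_inr_inr, cut_inr_inr]
    exact hcell i j

variable (h : Diagram n)

open Classical in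
/-- The function whose fibres are the parts of the juxtaposition with the cut diagram. -/
noncomputable def mulCutFun : Fin n ⊕ Fin n ⊕ Fin n → Quotient h.rel ⊕ Quotient d₀.rel :=
  Sum.elim (fun a => Sum.inl (Quotient.mk _ (Sum.inl a))) (Sum.elim (fun b => Sum.inl (Quotient.mk _ (Sum.inr b)))
    fun c => if hc : ∃ t, endpt d₀ hk t = c then
      Sum.inl (Quotient.mk _ (Sum.inr (endpt e hm (Fin.castAdd l hc.choose)))) else Sum.inr (Quotient.mk _ (Sum.inr c)))

theorem mulCutFun_endpt (t : Fin k) :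
    mulCutFun d₀ hk e hm h (Sum.inr (Sum.inr (endpt d₀ hk t))) =
      Sum.inl (Quotient.mk _ (Sum.inr (endpt e hm (Fin.castAdd l t)))) := by
  have hc : ∃ s, endpt d₀ hk s = endpt d₀ hk t := ⟨t, rfl⟩
  simp only [mulCutFun, Sum.elim_inr, dif_pos hc]
  rw [(endpt d₀ hk).injective hc.choose_spec]

theorem mulCutFun_of_notMem {c : Fin n} (hc : c ∉ d₀.rightEnds) :
    mulCutFun d₀ hk e hm h (Sum.inr (Sum.inr c)) = Sum.inr (Quotient.mk _ (Sum.inr c)) := by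
  simp only [mulCutFun, Sum.elim_inr]
  rw [dif_neg]
  rintro ⟨t, rfl⟩
  exact hc (endpt_mem d₀ hk t)

theorem juxt_cut_endpt (t : Fin k) : juxt h.rel (cut d₀ hk e hm).rel
    (Sum.inr (Sum.inr (endpt d₀ hk t))) (Sum.inr (Sum.inl (endpt e hm (Fin.castAdd l t)))) :=
  juxt_right (Setoid.symm' _ ((cut_inl_inr d₀ hk e hm).2 ⟨t, rfl, rfl⟩))

/-- The first summand of the target records the part of `h` with which a vertex is connected. The
second records the parts of `d₀` inside the right side, which are connected with nothing else. -/
theorem mul_cut_rel (x y : Fin n ⊕ Fin n) : (h * cut d₀ hk e hm).rel x y ↔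
    mulCutFun d₀ hk e hm h (outer x) = mulCutFun d₀ hk e hm h (outer y) := by
  rw [mul_rel]
  refine compRel_iff (mulCutFun d₀ hk e hm h) ?_ ?_ ?_ x y
  · have : ∀ z, mulCutFun d₀ hk e hm h (Sum.map id Sum.inl z) = Sum.inl (Quotient.mk _ (z)) := by
      rintro (z | z) <;> rfl
    intro x y hxy
    rw [this, this]
    exact congrArg _ (Quotient.sound hxy)
  · have key : ∀ i j, (cut d₀ hk e hm).rel (Sum.inl i) (Sum.inr j) →
        mulCutFun d₀ hk e hm h (Sum.inr (Sum.inl i)) =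
          mulCutFun d₀ hk e hm h (Sum.inr (Sum.inr j)) := by
      intro i j hij
      obtain ⟨t, rfl, rfl⟩ := (cut_inl_inr d₀ hk e hm).1 hij
      exact (mulCutFun_endpt d₀ hk e hm h t).symm
    rintro (i | i) (j | j) hij
    · rw [(cut_inl_inl d₀ hk e hm).1 hij]
    · exact key i j hij
    · exact (key j i (Setoid.symm' _ hij)).symm
    · have hij := (cut_inr_inr d₀ hk e hm).1 hij
      by_cases hi : i ∈ d₀.rightEnds
      · rw [eq_of_rel_of_mem_rightEnds hi hij]
      · have hj : j ∉ d₀.rightEnds := fun hj =>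
          hi (eq_of_rel_of_mem_rightEnds hj (d₀.rel.symm hij) ▸ hj)
        rw [mulCutFun_of_notMem d₀ hk e hm h hi, mulCutFun_of_notMem d₀ hk e hm h hj]
        exact congrArg _ (Quotient.sound hij)
  -- Every exterior vertex is either connected with a vertex of `h` in the part given by its value,
  -- or is a right vertex that is not the end of a propagating line of `d₀`.
  · have hmid : ∀ x : Fin n ⊕ Fin n, (∃ z : Fin n ⊕ Fin n,
        mulCutFun d₀ hk e hm h (outer x) = Sum.inl (Quotient.mk _ (z)) ∧
          juxt h.rel (cut d₀ hk e hm).rel (outer x) (Sum.map id Sum.inl z)) ∨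
        ∃ c, x = Sum.inr c ∧ mulCutFun d₀ hk e hm h (outer x) = Sum.inr (Quotient.mk _ (Sum.inr c)) := by
      rintro (a | c)
      · exact Or.inl ⟨Sum.inl a, rfl, Setoid.refl' _ _⟩
      · by_cases hc : c ∈ d₀.rightEnds
        · obtain ⟨t, rfl⟩ := exists_endpt hk hc
          exact Or.inl ⟨Sum.inr _, mulCutFun_endpt d₀ hk e hm h t, juxt_cut_endpt d₀ hk e hm h t⟩
        · exact Or.inr ⟨c, rfl, mulCutFun_of_notMem d₀ hk e hm h hc⟩
    intro x y hxy
    rcases hmid x with ⟨z, hz, hz'⟩ | ⟨c, rfl, hc⟩ <;>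
      rcases hmid y with ⟨w, hw, hw'⟩ | ⟨c', rfl, hc'⟩
    · rw [hz, hw] at hxy
      exact Setoid.trans' _ hz' (Setoid.trans' _
        (juxt_left (Quotient.exact (Sum.inl_injective hxy))) (Setoid.symm' _ hw'))
    · rw [hz, hc'] at hxy
      cases hxy
    · rw [hc, hw] at hxy
      cases hxy
    · rw [hc, hc'] at hxy
      exact juxt_right ((cut_inr_inr d₀ hk e hm).2 (Quotient.exact (Sum.inr_injective hxy)))

theorem mul_cut_inl_inl {a b : Fin n} : (h * cut d₀ hk e hm).rel (Sum.inl a) (Sum.inl b) ↔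
    h.rel (Sum.inl a) (Sum.inl b) := by
  rw [mul_cut_rel]
  exact ⟨fun hab => Quotient.exact (Sum.inl_injective hab),
    fun hab => congrArg Sum.inl (Quotient.sound hab)⟩

theorem mul_cut_inl_endpt {a : Fin n} {t : Fin k} :
    (h * cut d₀ hk e hm).rel (Sum.inl a) (Sum.inr (endpt d₀ hk t)) ↔
      h.rel (Sum.inl a) (Sum.inr (endpt e hm (Fin.castAdd l t))) := by
  rw [mul_cut_rel]
  change _ = mulCutFun d₀ hk e hm h (Sum.inr (Sum.inr _)) ↔ _
  rw [mulCutFun_endpt]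
  exact ⟨fun hab => Quotient.exact (Sum.inl_injective hab),
    fun hab => congrArg Sum.inl (Quotient.sound hab)⟩

theorem mul_cut_inl_inr {a c : Fin n} :
    (h * cut d₀ hk e hm).rel (Sum.inl a) (Sum.inr c) ↔ ∃ t, c = endpt d₀ hk t ∧
      h.rel (Sum.inl a) (Sum.inr (endpt e hm (Fin.castAdd l t))) := by
  constructor
  · intro hac
    by_cases hc : c ∈ d₀.rightEnds
    · obtain ⟨t, rfl⟩ := exists_endpt hk hc
      exact ⟨t, rfl, (mul_cut_inl_endpt d₀ hk e hm h).1 hac⟩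
    · rw [mul_cut_rel] at hac
      change _ = mulCutFun d₀ hk e hm h (Sum.inr (Sum.inr _)) at hac
      rw [mulCutFun_of_notMem d₀ hk e hm h hc] at hac
      cases hac
  · rintro ⟨t, rfl, ht⟩
    exact (mul_cut_inl_endpt d₀ hk e hm h).2 ht

variable {h}

/-- `h` has the right ends of `e`, so each of the `k` kept ends is reached from the left and
continues to a right end of `d₀`. The right parts of `d₀` are left untouched by the product. -/
theorem leftCell_mul_cut (hh : leftCell n e h) : leftCell n d₀ (h * cut d₀ hk e hm) := by
  have hr : ∀ t, ∃ a, h.rel (Sum.inl a) (Sum.inr (endpt e hm t)) := fun t =>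
    mem_rightEnds_iff.1 ((rightEnds_eq hh).symm ▸ endpt_mem e hm t)
  have hR : (h * cut d₀ hk e hm).rightEnds = d₀.rightEnds := by
    ext j
    rw [mem_rightEnds_iff]
    constructor
    · rintro ⟨a, ha⟩
      obtain ⟨t, rfl, -⟩ := (mul_cut_inl_inr d₀ hk e hm h).1 ha
      exact endpt_mem d₀ hk t
    · intro hj
      obtain ⟨t, rfl⟩ := exists_endpt hk hj
      obtain ⟨a, ha⟩ := hr (Fin.castAdd l t)
      exact ⟨a, (mul_cut_inl_endpt d₀ hk e hm h).2 ha⟩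
  refine leftCell_iff.2 ⟨hR, fun i j => ⟨fun hij => ?_, fun hij => ?_⟩⟩
  · exact juxt_right ((cut_inr_inr d₀ hk e hm).2 hij)
  · by_cases hi : i ∈ d₀.rightEnds
    · rw [eq_of_rel_of_mem_rightEnds (hR.symm ▸ hi) hij]
    · have hj : j ∉ d₀.rightEnds := fun hj =>
        hi (eq_of_rel_of_mem_rightEnds (hR.symm ▸ hj) (Setoid.symm' _ hij) ▸ hj)
      rw [mul_cut_rel] at hij
      change mulCutFun d₀ hk e hm h (Sum.inr (Sum.inr _)) =
        mulCutFun d₀ hk e hm h (Sum.inr (Sum.inr _)) at hij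
      rw [mulCutFun_of_notMem d₀ hk e hm h hi, mulCutFun_of_notMem d₀ hk e hm h hj] at hij
      exact Quotient.exact (Sum.inr_injective hij)

/-- The left end of a propagating line of `h` either stays a left end or becomes a singleton. No
other left singletons arise, since `h` has none and its pairs on the left side persist. -/
theorem propNumber_mul_cut (hB : h.IsBrauer) : h.propNumber =
    (h * cut d₀ hk e hm).propNumber + (h * cut d₀ hk e hm).leftSingletons := by
  classical
  rw [← card_leftEnds, ← card_leftEnds, leftSingletons_eq_card, ← Finset.card_union_of_disjoint]
  · congr 1
    ext a
    rw [Finset.mem_union, Finset.mem_filter_univ, mem_leftEnds_iff, mem_leftEnds_iff]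
    constructor
    · rintro ⟨j, hj⟩
      by_cases hj' : ∃ c, (h * cut d₀ hk e hm).rel (Sum.inl a) (Sum.inr c)
      · exact Or.inl hj'
      · right
        rintro (b | c) hb
        · rw [mul_cut_inl_inl] at hb
          rcases h.thin _ _ _ hj hb with h1 | h1 | h1
          · cases h1
          · exact h1.symm
          · cases h1
        · exact absurd ⟨c, hb⟩ hj'
    · rintro (⟨c, hc⟩ | hs)
      · obtain ⟨t, -, ht⟩ := (mul_cut_inl_inr d₀ hk e hm h).1 hc
        exact ⟨_, ht⟩
      · have ha := hB (Sum.inl a)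
        unfold IsSingleton at ha
        push Not at ha
        obtain ⟨b | c, hb, hne⟩ := ha
        · exact absurd (hs _ ((mul_cut_inl_inl d₀ hk e hm h).2 hb)) hne
        · exact ⟨c, hb⟩
  · rw [Finset.disjoint_left]
    intro i hi hs
    obtain ⟨j, hj⟩ := mem_leftEnds_iff.1 hi
    cases (Finset.mem_filter_univ _).1 hs _ hj

theorem leftSingletons_mul_cut (hh : leftCell n e h) (hB : h.IsBrauer) :
    (h * cut d₀ hk e hm).leftSingletons = l := by
  have h1 := propNumber_mul_cut d₀ hk e hm hB
  have h2 : h.propNumber = e.propNumber := congrArg Finset.card (rightEnds_eq hh)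
  have h3 : (h * cut d₀ hk e hm).propNumber = d₀.propNumber :=
    congrArg Finset.card (rightEnds_eq (leftCell_mul_cut d₀ hk e hm hh))
  omega

/-- A middle vertex that is a right end of `h` is connected with the exterior. Any other middle
vertex is a singleton of the cut diagram, so its component is not a loop. -/
theorem loops_cut (hh : leftCell n e h) : loops h.rel (cut d₀ hk e hm).rel = 0 := by
  unfold loops
  rw [Nat.card_eq_zero]
  left
  constructor
  rintro ⟨c, hin, hs⟩
  induction c using Quotient.inductionOn with
  | h x =>
    rcases x with a | b | c
    · exact hin (Sum.inl a) rfl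
    · by_cases hb : b ∈ e.rightEnds
      · rw [← rightEnds_eq hh] at hb
        obtain ⟨a, ha⟩ := mem_rightEnds_iff.1 hb
        exact hin (Sum.inl a) (Quotient.sound (juxt_left ha))
      · refine hs (Or.inr ⟨Sum.inl b, ?_, rfl⟩)
        rintro (y | y) hy
        · rw [(cut_inl_inl d₀ hk e hm).1 hy]
        · obtain ⟨t, rfl, -⟩ := (cut_inl_inr d₀ hk e hm).1 hy
          exact absurd (endpt_mem e hm _) hb
    · exact hin (Sum.inr c) rfl

theorem strings_eq_zero_of_isBrauer {d : Diagram n} (hd : d.IsBrauer) (hB : h.IsBrauer) :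
    strings d.rel h.rel = 0 := by
  have h1 := singletons_comp d.thin h.thin
  rw [isBrauer_iff] at hd hB
  omega

/-- A Brauer diagram produces no open string with `x` if and only if it preserves the number of left
singletons. -/
theorem strings_eq_zero_iff {d x : Diagram n} (hd : d.IsBrauer) (hx : leftCell n d₀ x)
    (hdx : leftCell n d₀ (d * x)) :
    strings d.rel x.rel = 0 ↔ (d * x).leftSingletons = x.leftSingletons := by
  have h1 := singletons_comp d.thin x.thin
  have h2 := singletons_eq x
  have h3 := singletons_eq (d * x)
  have h4 := rightSingletons_eq hx
  have h5 := rightSingletons_eq hdx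
  rw [isBrauer_iff] at hd
  rw [← mul_rel] at h1
  omega

/-- The numbers of loops agree by associativity, since the cut diagram creates none on its left. No
open strings occur on either side: both `h * cut` and `d * h * cut` have `l` left singletons. -/
theorem factor_mul_cut (δ : ℂ) {d : Diagram n} (hd : d.IsBrauer) (hh : leftCell n e h)
    (hB : h.IsBrauer) (hdh : leftCell n e (d * h)) :
    factor δ 0 d (h * cut d₀ hk e hm) = factor δ 0 d h := by
  have h1 := loops_assoc d h (cut d₀ hk e hm)
  rw [loops_cut d₀ hk e hm hh, loops_cut d₀ hk e hm hdh] at h1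
  have h2 := (strings_eq_zero_iff d₀ hd (leftCell_mul_cut d₀ hk e hm hh)
    (by rw [← mul_assoc]; exact leftCell_mul_cut d₀ hk e hm hdh)).2 (by
      rw [← mul_assoc, leftSingletons_mul_cut d₀ hk e hm hh hB,
        leftSingletons_mul_cut d₀ hk e hm hdh (hd.mul hB)])
  unfold factor
  rw [h2, strings_eq_zero_of_isBrauer hd hB, show loops d.rel (h * cut d₀ hk e hm).rel =
    loops d.rel h.rel by omega]

/-- Without open strings the product keeps `l` left singletons, and within the cell of `d₀` it keeps
`k` propagating lines. Hence `d * h` has `k + l` lines, so `d` has not lost any line of `h`. In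
other words, when `d * h` leaves the cell of `e`, the product with the cut diagram acts as zero as
well. -/
theorem leftCell_of_mul_cut {d : Diagram n} (hd : d.IsBrauer) (hh : leftCell n e h)
    (hB : h.IsBrauer) (hc : leftCell n d₀ (d * (h * cut d₀ hk e hm)))
    (hs : strings d.rel (h * cut d₀ hk e hm).rel = 0) : leftCell n e (d * h) := by
  have h1 := (strings_eq_zero_iff d₀ hd (leftCell_mul_cut d₀ hk e hm hh) hc).1 hs
  rw [leftSingletons_mul_cut d₀ hk e hm hh hB, ← mul_assoc] at h1
  rw [← mul_assoc] at hc
  have h2 := propNumber_mul_cut d₀ hk e hm (hd.mul hB)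
  have h3 : (d * h * cut d₀ hk e hm).propNumber = d₀.propNumber :=
    congrArg Finset.card (rightEnds_eq hc)
  have hcl : ∀ X : Set (Fin n), Sum.inr '' X ∈ e.rel.classes →
      Sum.inr '' X ∈ (d * h).rel.classes := fun X hX => mem_classes_mul d h ((hh X).1 hX)
  refine leftCell_of_subset hcl ?_
  have hsub : (d * h).rightEnds ⊆ e.rightEnds := fun j hj =>
    mem_rightEnds.2 fun X hX => mem_rightEnds.1 hj X (hcl X hX)
  exact (Finset.eq_of_subset_of_card_le hsub (by change e.propNumber ≤ (d * h).propNumber; omega)).ge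

end Cut
end PartialBrauer

namespace PartialBrauer
open Diagram

/-! ### Surjectivity and fibres of cutting -/

section CutFibres
variable {n k l : ℕ}

/-- The diagram of an involution: its parts are the orbits. -/
def ofInvolution (μ : Fin n ⊕ Fin n → Fin n ⊕ Fin n) (hμ : Function.Involutive μ) :
    Diagram n where
  rel :=
    { r := fun x y => y = x ∨ y = μ x
      iseqv :=
        { refl := fun _ => Or.inl rfl
          symm := by
            rintro x y (rfl | rfl)
            · exact Or.inl rfl
            · exact Or.inr (hμ x).symm
          trans := by
            rintro x y z (rfl | rfl) (rfl | rfl)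
            · exact Or.inl rfl
            · exact Or.inr rfl
            · exact Or.inr rfl
            · exact Or.inl (hμ x) } }
  thin := by
    rintro x y z (rfl | rfl) (rfl | rfl)
    · exact Or.inl rfl
    · exact Or.inl rfl
    · exact Or.inr (Or.inl rfl)
    · exact Or.inr (Or.inr rfl)

theorem youngEmb_castAdd (σ : Equiv.Perm (Fin k)) (τ : Equiv.Perm (Fin l)) (t : Fin k) :
    youngEmb k l (σ, τ) (Fin.castAdd l t) = Fin.castAdd l (σ t) := by
  simp [youngEmb, Equiv.permCongrHom]

theorem youngEmb_natAdd (σ : Equiv.Perm (Fin k)) (τ : Equiv.Perm (Fin l)) (t : Fin l) :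
    youngEmb k l (σ, τ) (Fin.natAdd k t) = Fin.natAdd k (τ t) := by
  simp [youngEmb, Equiv.permCongrHom]

theorem mem_rightEnds_left {d : Diagram n} {i : Fin n} (hd : d.IsBrauer) (hi : i ∉ d.rightEnds) :
    ∃ j, mate d.rel (Sum.inr i) = Sum.inr j ∧ j ≠ i ∧ j ∉ d.rightEnds := by
  have h1 := mate_rel d.rel (Sum.inr i)
  rcases h : mate d.rel (Sum.inr i) with j | j
  · rw [h] at h1
    exact absurd (mem_rightEnds_iff.2 ⟨j, d.rel.symm h1⟩) hi
  · rw [h] at h1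
    have hne : j ≠ i := by
      rintro rfl
      exact hd _ ((mate_fix _ _).1 h)
    exact ⟨j, rfl, hne, fun hj => hne (eq_of_rel_of_mem_rightEnds hj (d.rel.symm h1))⟩

variable (d₀ : Diagram n) (hk : d₀.propNumber = k) (e : Diagram n) (hm : e.propNumber = k + l)

/-- Every diagram with `l` left singletons arises from a Brauer diagram by cutting lines. -/
theorem exists_mul_cut_eq (he : e.IsBrauer) {x : Diagram n} (hx : leftCell n d₀ x)
    (hl : x.leftSingletons = l) :
    ∃ h : Diagram n, leftCell n e h ∧ h.IsBrauer ∧ h * cut d₀ hk e hm = x := by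
  classical
  have hex : ∀ t, ∃ a, x.rel (Sum.inl a) (Sum.inr (endpt d₀ hk t)) := fun t =>
    mem_rightEnds_iff.1 ((rightEnds_eq hx).symm ▸ endpt_mem d₀ hk t)
  choose α₁ hα₁ using hex
  let α₂ : Fin l ≃ {i : Fin n // IsSingleton x.rel (Sum.inl i)} :=
    (Finite.equivFinOfCardEq hl).symm
  -- The left ends of the `k + l` lines to be constructed: first the left ends of the lines of `x`,
  -- in the order of their right ends, then the left singletons of `x` in an arbitrary order.
  let α : Fin (k + l) → Fin n := Fin.addCases α₁ fun s => (α₂ s).1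
  have hαl : ∀ t, α (Fin.castAdd l t) = α₁ t := fun t => Fin.addCases_left t
  have hαr : ∀ t, α (Fin.natAdd k t) = (α₂ t).1 := fun t => Fin.addCases_right t
  have hα : Function.Injective α := by
    intro t s hts
    induction t using Fin.addCases with
    | left t =>
      induction s using Fin.addCases with
      | left s =>
        rw [hαl, hαl] at hts
        rw [(endpt d₀ hk).injective (right_eq_of_rel (hα₁ t) (hts ▸ hα₁ s))]
      | right s =>
        rw [hαl, hαr] at hts
        cases (α₂ s).2 _ (hts ▸ hα₁ t)
    | right t =>
      induction s using Fin.addCases with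
      | left s =>
        rw [hαl, hαr] at hts
        cases (α₂ t).2 _ (hts ▸ hα₁ s)
      | right s =>
        rw [hαr, hαr] at hts
        rw [α₂.injective (Subtype.ext hts)]
  have hαx : ∀ t b, x.rel (Sum.inl (α t)) (Sum.inl b) → b = α t := by
    intro t b hb
    induction t using Fin.addCases with
    | left t =>
      rw [hαl] at hb ⊢
      rcases x.thin _ _ _ (hα₁ t) hb with h1 | h1 | h1
      · cases h1
      · exact (Sum.inl_injective h1).symm
      · cases h1
    | right t =>
      rw [hαr] at hb ⊢
      exact Sum.inl_injective ((α₂ t).2 _ hb)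
  -- The remaining left vertices are paired among themselves in `x`, and these pairs are kept.
  have hnα : ∀ a, (¬ ∃ t, α t = a) →
      ∃ b, mate x.rel (Sum.inl a) = Sum.inl b ∧ b ≠ a ∧ ¬ ∃ t, α t = b := by
    intro a ha
    have h1 := mate_rel x.rel (Sum.inl a)
    rcases h : mate x.rel (Sum.inl a) with b | j
    · rw [h] at h1
      have hne : b ≠ a := by
        rintro rfl
        refine ha ⟨Fin.natAdd k (α₂.symm ⟨b, (mate_fix _ _).1 h⟩), ?_⟩
        rw [hαr, α₂.apply_symm_apply]
      refine ⟨b, rfl, hne, ?_⟩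
      rintro ⟨t, rfl⟩
      exact hne (hαx t a (x.rel.symm h1)).symm
    · rw [h] at h1
      have hj : j ∈ d₀.rightEnds := rightEnds_eq hx ▸ mem_rightEnds_iff.2 ⟨a, h1⟩
      obtain ⟨t, rfl⟩ := exists_endpt hk hj
      exact absurd ⟨Fin.castAdd l t, (hαl t).trans (left_eq_of_rel (hα₁ t) h1)⟩ ha
  -- The partner map of the wanted diagram: lines join `α t` to the `t`-th right end of `e`, left
  -- pairs come from `x`, and right pairs come from `e`.
  let μ : Fin n ⊕ Fin n → Fin n ⊕ Fin n := Sum.elim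
    (fun a => if h : ∃ t, α t = a then Sum.inr (endpt e hm h.choose) else mate x.rel (Sum.inl a))
    (fun b => if h : ∃ t, endpt e hm t = b then Sum.inl (α h.choose) else mate e.rel (Sum.inr b))
  have hμ1 : ∀ t, μ (Sum.inl (α t)) = Sum.inr (endpt e hm t) := by
    intro t
    have h : ∃ s, α s = α t := ⟨t, rfl⟩
    simp only [μ, Sum.elim_inl, dif_pos h]
    rw [hα h.choose_spec]
  have hμ2 : ∀ a, (¬ ∃ t, α t = a) → μ (Sum.inl a) = mate x.rel (Sum.inl a) := by
    intro a h
    simp only [μ, Sum.elim_inl, dif_neg h]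
  have hμ3 : ∀ t, μ (Sum.inr (endpt e hm t)) = Sum.inl (α t) := by
    intro t
    have h : ∃ s, endpt e hm s = endpt e hm t := ⟨t, rfl⟩
    simp only [μ, Sum.elim_inr, dif_pos h]
    rw [(endpt e hm).injective h.choose_spec]
  have hμ4 : ∀ b, b ∉ e.rightEnds → μ (Sum.inr b) = mate e.rel (Sum.inr b) := by
    intro b hb
    have h : ¬ ∃ t, endpt e hm t = b := by
      rintro ⟨t, rfl⟩
      exact hb (endpt_mem e hm t)
    simp only [μ, Sum.elim_inr, dif_neg h]
  have hμ : Function.Involutive μ := by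
    rintro (a | b)
    · by_cases ha : ∃ t, α t = a
      · obtain ⟨t, rfl⟩ := ha
        rw [hμ1, hμ3]
      · obtain ⟨b, hb, -, hb'⟩ := hnα a ha
        rw [hμ2 a ha, hb, hμ2 b hb', ← hb, mate_mate x.thin]
    · by_cases hb : b ∈ e.rightEnds
      · obtain ⟨t, rfl⟩ := exists_endpt hm hb
        rw [hμ3, hμ1]
      · obtain ⟨j, hj, -, hj'⟩ := mem_rightEnds_left he hb
        rw [hμ4 b hb, hj, hμ4 j hj', ← hj, mate_mate e.thin]
  let h := ofInvolution μ hμ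
  have hB : h.IsBrauer := by
    intro z hz
    have h1 : μ z = z := hz _ (Or.inr rfl)
    rcases z with a | b
    · by_cases ha : ∃ t, α t = a
      · obtain ⟨t, rfl⟩ := ha
        rw [hμ1] at h1
        cases h1
      · obtain ⟨b, hb, hne, -⟩ := hnα a ha
        rw [hμ2 a ha, hb] at h1
        exact hne (Sum.inl_injective h1)
    · by_cases hb : b ∈ e.rightEnds
      · obtain ⟨t, rfl⟩ := exists_endpt hm hb
        rw [hμ3] at h1
        cases h1
      · obtain ⟨j, hj, hne, -⟩ := mem_rightEnds_left he hb
        rw [hμ4 b hb, hj] at h1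
        exact hne (Sum.inr_injective h1)
  have hlr : ∀ a j, h.rel (Sum.inl a) (Sum.inr j) ↔ ∃ t, a = α t ∧ j = endpt e hm t := by
    intro a j
    constructor
    · rintro (h1 | h1)
      · cases h1
      · by_cases ha : ∃ t, α t = a
        · obtain ⟨t, rfl⟩ := ha
          rw [hμ1] at h1
          exact ⟨t, rfl, Sum.inr_injective h1⟩
        · obtain ⟨b, hb, -, -⟩ := hnα a ha
          rw [hμ2 a ha, hb] at h1
          cases h1
    · rintro ⟨t, rfl, rfl⟩
      exact Or.inr (hμ1 t).symm
  have hcell : leftCell n e h := by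
    refine leftCell_iff.2 ⟨?_, fun i j => ⟨fun hij => ?_, ?_⟩⟩
    · ext j
      rw [mem_rightEnds_iff]
      constructor
      · rintro ⟨a, ha⟩
        obtain ⟨t, -, rfl⟩ := (hlr a j).1 ha
        exact endpt_mem e hm t
      · intro hj
        obtain ⟨t, rfl⟩ := exists_endpt hm hj
        exact ⟨α t, (hlr _ _).2 ⟨t, rfl, rfl⟩⟩
    · by_cases hne : j = i
      · exact Or.inl (congrArg _ hne)
      · have hi : i ∉ e.rightEnds := fun hi => hne (eq_of_rel_of_mem_rightEnds hi hij).symm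
        exact Or.inr ((hμ4 i hi).trans (mate_eq e.thin hij fun h => hne (Sum.inr_injective h))).symm
    · rintro (h1 | h1)
      · rw [h1]
      · by_cases hi : i ∈ e.rightEnds
        · obtain ⟨t, rfl⟩ := exists_endpt hm hi
          rw [hμ3] at h1
          cases h1
        · rw [h1, hμ4 i hi]
          exact mate_rel _ _
  refine ⟨h, hcell, hB, ?_⟩
  -- Both diagrams lie in the left cell of `d₀`, so only the parts that meet the left side have to
  -- be compared.
  refine eq_of_leftCell ((leftCell n).trans ((leftCell n).symm
    (leftCell_mul_cut d₀ hk e hm hcell)) hx) (fun a b => ?_) fun a j => ?_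
  · rw [mul_cut_inl_inl]
    constructor
    · rintro (h1 | h1)
      · rw [h1]
      · by_cases ha : ∃ t, α t = a
        · obtain ⟨t, rfl⟩ := ha
          rw [hμ1] at h1
          cases h1
        · rw [h1, hμ2 a ha]
          exact mate_rel _ _
    · intro hab
      by_cases hne : b = a
      · exact Or.inl (congrArg _ hne)
      · have ha : ¬ ∃ t, α t = a := by
          rintro ⟨t, rfl⟩
          exact hne (hαx t b hab)
        exact Or.inr ((hμ2 a ha).trans (mate_eq x.thin hab fun h => hne (Sum.inl_injective h))).symm
  · rw [mul_cut_inl_inr]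
    constructor
    · rintro ⟨t, rfl, ht⟩
      obtain ⟨s, rfl, hs⟩ := (hlr _ _).1 ht
      rw [← (endpt e hm).injective hs, hαl]
      exact hα₁ t
    · intro haj
      have hj : j ∈ d₀.rightEnds := rightEnds_eq hx ▸ mem_rightEnds_iff.2 ⟨a, haj⟩
      obtain ⟨t, rfl⟩ := exists_endpt hk hj
      exact ⟨t, rfl, (hlr _ _).2 ⟨_, (left_eq_of_rel haj (hα₁ t)).trans (hαl t).symm, rfl⟩⟩

/-- Brauer diagrams that become equal by cutting lines differ by a permutation of these lines. -/
theorem exists_eq_relabel {h h' : Diagram n} (hh : leftCell n e h) (hB : h.IsBrauer)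
    (hh' : leftCell n e h') (hB' : h'.IsBrauer)
    (heq : h * cut d₀ hk e hm = h' * cut d₀ hk e hm) :
    ∃ τ : Equiv.Perm (Fin l), h' = h.relabel (e.permEnds hm (youngEmb k l (1, τ))) := by
  have hll : ∀ a b, h.rel (Sum.inl a) (Sum.inl b) ↔ h'.rel (Sum.inl a) (Sum.inl b) := by
    intro a b
    rw [← mul_cut_inl_inl d₀ hk e hm h, heq, mul_cut_inl_inl]
  have hlr : ∀ a t, h.rel (Sum.inl a) (Sum.inr (endpt e hm (Fin.castAdd l t))) ↔
      h'.rel (Sum.inl a) (Sum.inr (endpt e hm (Fin.castAdd l t))) := by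
    intro a t
    rw [← mul_cut_inl_endpt d₀ hk e hm h, heq, mul_cut_inl_endpt]
  -- Let `a` be the left end of the line of `h'` at the cut position `s`. In `h` it cannot be joined
  -- to a left vertex or to one of the first `k` ends, because there `h` and `h'` agree. So its line
  -- in `h` ends at some cut position `s'`, and `s ↦ s'` is the wanted permutation.
  have hex : ∀ s : Fin l, ∃ s' : Fin l, ∃ a,
      h'.rel (Sum.inl a) (Sum.inr (endpt e hm (Fin.natAdd k s))) ∧
        h.rel (Sum.inl a) (Sum.inr (endpt e hm (Fin.natAdd k s'))) := by
    intro s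
    obtain ⟨a, ha⟩ := mem_rightEnds_iff.1
      ((rightEnds_eq hh').symm ▸ endpt_mem e hm (Fin.natAdd k s))
    have h1 := hB (Sum.inl a)
    unfold IsSingleton at h1
    push Not at h1
    obtain ⟨b | j, hb, hne⟩ := h1
    · rw [hll] at hb
      rcases h'.thin _ _ _ hb ha with h2 | h2 | h2
      · exact absurd h2.symm hne
      · cases h2
      · cases h2
    · have hj : j ∈ e.rightEnds := rightEnds_eq hh ▸ mem_rightEnds_iff.2 ⟨a, hb⟩
      obtain ⟨t, rfl⟩ := exists_endpt hm hj
      induction t using Fin.addCases with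
      | left t =>
        rw [hlr] at hb
        have h2 := congrArg Fin.val ((endpt e hm).injective (right_eq_of_rel hb ha))
        rw [Fin.val_castAdd, Fin.val_natAdd] at h2
        have := t.2
        omega
      | right t => exact ⟨t, a, ha, hb⟩
  choose f a ha' ha using hex
  have hinj : Function.Injective f := by
    intro s s' hs
    have h1 : a s = a s' := left_eq_of_rel (ha s) (hs ▸ ha s')
    have h2 := (endpt e hm).injective (right_eq_of_rel (ha' s) (h1 ▸ ha' s'))
    exact Fin.natAdd_injective l k h2
  let τ : Equiv.Perm (Fin l) := Equiv.ofBijective f (Finite.injective_iff_bijective.1 hinj)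
  refine ⟨τ, IsBrauer.eq_of_le hB' ?_⟩
  have hcell := leftCell_permEnds hh hm (youngEmb k l (1, τ))
  have key : ∀ b j, h'.rel (Sum.inl b) (Sum.inr j) →
      (h.relabel (e.permEnds hm (youngEmb k l (1, τ)))).rel (Sum.inl b) (Sum.inr j) := by
    intro b j hb
    have hj : j ∈ e.rightEnds := rightEnds_eq hh' ▸ mem_rightEnds_iff.2 ⟨b, hb⟩
    obtain ⟨t, rfl⟩ := exists_endpt hm hj
    change h.rel (Sum.inl b) (Sum.inr (e.permEnds hm _ _))
    rw [permEnds_endpt]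
    induction t using Fin.addCases with
    | left t =>
      rw [youngEmb_castAdd]
      exact (hlr b t).2 hb
    | right t =>
      rw [youngEmb_natAdd, left_eq_of_rel hb (ha' t)]
      exact ha t
  rintro (b | i) (c | j) hij
  · exact (hll b c).2 hij
  · exact key b j hij
  · exact Setoid.symm' _ (key c i (Setoid.symm' _ hij))
  · exact ((leftCell_iff.1 hcell).2 i j).1 (((leftCell_iff.1 hh').2 i j).2 hij)

end CutFibres
end PartialBrauer

namespace PartialBrauer

open TensorProduct

/-! ### Universal property of the balanced tensor product -/

namespace BalancedTensor

section Basic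
variable {A : Type} [Ring A] [Algebra ℂ A] {M : Type} [AddCommGroup M] [Module ℂ M]
  [Module A M] [IsScalarTower ℂ A M] {G : Type} [Group G] (act : G → M →ₗ[A] M)
  {S : Type} [AddCommGroup S] [Module ℂ S] (rho : Representation ℂ G S)

/-- The balanced bilinear map from `M × S` to the balanced tensor product. -/
noncomputable def mk : M →ₗ[ℂ] S →ₗ[ℂ] BalancedTensor A act rho :=
  (TensorProduct.mk ℂ M S).compr₂ ((Submodule.mkQ _).restrictScalars ℂ)

theorem mk_act (g : G) (m : M) (v : S) : mk act rho (act g m) v = mk act rho m (rho g v) :=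
  (Submodule.Quotient.eq _).2 (Submodule.subset_span ⟨g, m, v, rfl⟩)

theorem smul_mk (a : A) (m : M) (v : S) : a • mk act rho m v = mk act rho (a • m) v := rfl

theorem subalgebra_smul_mk (B : Subalgebra ℂ A) (b : B) (m : M) (v : S) :
    b • mk act rho m v = mk act rho (b • m) v := rfl

variable {act rho} in
@[elab_as_elim]
theorem induction {motive : BalancedTensor A act rho → Prop} (x : BalancedTensor A act rho)
    (mk : ∀ m v, motive (mk act rho m v)) (zero : motive 0)
    (add : ∀ x y, motive x → motive y → motive (x + y)) : motive x := by
  obtain ⟨x, rfl⟩ := Submodule.Quotient.mk_surjective _ x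
  induction x using TensorProduct.induction_on with
  | zero => exact zero
  | tmul m v => exact mk m v
  | add x y hx hy => exact add _ _ hx hy

/-- `f` is only ℂ-bilinear, while the relations are divided out by their `A`-span. Since `act g` is
`A`-linear, the set of relations is stable under `A`, so the additive group it generates is already
this span. -/
theorem span_le_ker {W : Type} [AddCommGroup W] [Module ℂ W] (f : M →ₗ[ℂ] S →ₗ[ℂ] W)
    (hf : ∀ g m v, f (act g m) v = f m (rho g v)) :
    (Submodule.span A {z : M ⊗[ℂ] S | ∃ g m v, z = act g m ⊗ₜ[ℂ] v - m ⊗ₜ[ℂ] rho g v}).restrictScalars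
      ℂ ≤ LinearMap.ker (TensorProduct.lift f) := by
  set X : Set (M ⊗[ℂ] S) := {z | ∃ g m v, z = act g m ⊗ₜ[ℂ] v - m ⊗ₜ[ℂ] rho g v} with hX
  let N : Submodule A (M ⊗[ℂ] S) :=
    { AddSubgroup.closure X with
      smul_mem' := by
        intro a x hx
        change a • x ∈ AddSubgroup.closure X
        change x ∈ AddSubgroup.closure X at hx
        induction hx using AddSubgroup.closure_induction with
        | mem x hx =>
          obtain ⟨g, m, v, rfl⟩ := hx
          refine AddSubgroup.subset_closure ⟨g, a • m, v, ?_⟩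
          rw [smul_sub, map_smul]
          rfl
        | zero => rw [smul_zero]; exact zero_mem _
        | add x y _ _ hx hy => rw [smul_add]; exact add_mem hx hy
        | neg x _ hx => rw [smul_neg]; exact neg_mem hx }
  have hN : Submodule.span A X ≤ N := Submodule.span_le.2 AddSubgroup.subset_closure
  have key : ∀ x ∈ AddSubgroup.closure X, x ∈ LinearMap.ker (TensorProduct.lift f) := by
    intro x hx
    induction hx using AddSubgroup.closure_induction with
    | mem x hx =>
      obtain ⟨g, m, v, rfl⟩ := hx
      rw [LinearMap.mem_ker, map_sub, TensorProduct.lift.tmul, TensorProduct.lift.tmul, hf,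
        sub_self]
    | zero => exact zero_mem _
    | add x y _ _ hx hy => exact add_mem hx hy
    | neg x _ hx => exact neg_mem hx
  exact fun x hx => key x (hN hx)

/-- The linear map on the balanced tensor product given by a balanced bilinear map. -/
noncomputable def lift {W : Type} [AddCommGroup W] [Module ℂ W] (f : M →ₗ[ℂ] S →ₗ[ℂ] W)
    (hf : ∀ g m v, f (act g m) v = f m (rho g v)) : BalancedTensor A act rho →ₗ[ℂ] W :=
  (Submodule.liftQ _ _ (span_le_ker act rho f hf)) ∘ₗ
    (Submodule.Quotient.restrictScalarsEquiv ℂ _).symm.toLinearMap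

end Basic

section Pi
variable {A : Type} [Ring A] [Algebra ℂ A] {M : Type} [AddCommGroup M] [Module ℂ M]
  [Module A M] [IsScalarTower ℂ A M] {G : Type} [Group G] (act : G → M →ₗ[A] M)
  {V : Type} [AddCommGroup V] [Module ℂ V] (rho : Representation ℂ G V)
  {ι : Type} [Fintype ι] {U : ι → Type} [∀ i, AddCommGroup (U i)] [∀ i, Module ℂ (U i)]
  (tau : ∀ i, Representation ℂ G (U i))

/-- The balanced tensor product commutes with finite products in the second variable. -/
theorem nonempty_equiv_pi (e : V ≃ₗ[ℂ] ∀ i, U i) (he : ∀ g v i, e (rho g v) i = tau i g (e v i)) :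
    Nonempty (BalancedTensor A act rho ≃ₗ[A] ∀ i, BalancedTensor A act (tau i)) := by
  classical
  let F : BalancedTensor A act rho →ₗ[ℂ] ∀ i, BalancedTensor A act (tau i) :=
    LinearMap.pi fun i => lift act rho
      ((mk act (tau i)).compl₂ (LinearMap.proj i ∘ₗ e.toLinearMap)) fun g m v => by
        simp only [LinearMap.compl₂_apply, LinearMap.comp_apply, LinearMap.proj_apply,
          LinearEquiv.coe_coe, mk_act, he]
  have hF : ∀ m v i, F (mk act rho m v) i = mk act (tau i) m (e v i) := fun m v i => rfl
  -- The inverse map needs equivariance of the inclusions of the factors, which follows from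
  -- equivariance of the projections.
  have he' : ∀ g i (u : U i), e.symm (Pi.single i (tau i g u)) =
      rho g (e.symm (Pi.single i u)) := by
    intro g i u
    rw [LinearEquiv.symm_apply_eq]
    funext j
    rw [he, e.apply_symm_apply]
    by_cases h : j = i
    · subst h; simp
    · simp [Pi.single_eq_of_ne h]
  let Gm : (∀ i, BalancedTensor A act (tau i)) →ₗ[ℂ] BalancedTensor A act rho :=
    ∑ i, (lift act (tau i)
      ((mk act rho).compl₂ (e.symm.toLinearMap ∘ₗ LinearMap.single ℂ U i)) fun g m v => by
        simp only [LinearMap.compl₂_apply, LinearMap.comp_apply, LinearMap.single_apply,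
          LinearEquiv.coe_coe, mk_act, he']) ∘ₗ LinearMap.proj i
  have hG : ∀ i m u, Gm (Pi.single i (mk act (tau i) m u)) =
      mk act rho m (e.symm (Pi.single i u)) := by
    intro i m u
    simp only [Gm, LinearMap.sum_apply, LinearMap.comp_apply, LinearMap.proj_apply]
    rw [Finset.sum_eq_single i]
    · rw [Pi.single_eq_same]; rfl
    · intro j _ hj
      rw [Pi.single_eq_of_ne hj, map_zero]
    · simp
  have hGF : ∀ x, Gm (F x) = x := by
    intro x
    induction x using induction with
    | zero => rw [map_zero, map_zero]
    | add x y hx hy => rw [map_add, map_add, hx, hy]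
    | mk m v =>
      have : F (mk act rho m v) = ∑ i, Pi.single i (mk act (tau i) m (e v i)) := by
        rw [Finset.univ_sum_single]; rfl
      rw [this, map_sum]
      simp only [hG]
      rw [← map_sum, ← map_sum, Finset.univ_sum_single, e.symm_apply_apply]
  have hFG : ∀ y, F (Gm y) = y := by
    intro y
    rw [← Finset.univ_sum_single y, map_sum, map_sum]
    refine Finset.sum_congr rfl fun i _ => ?_
    generalize y i = z
    induction z using induction with
    | zero => simp
    | add x y hx hy => rw [Pi.single_add, map_add, map_add, hx, hy]
    | mk m u =>
      rw [hG]
      funext j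
      rw [hF, e.apply_symm_apply]
      by_cases h : j = i
      · subst h; simp
      · simp [Pi.single_eq_of_ne h]
  refine ⟨{ F with map_smul' := ?_, invFun := Gm, left_inv := hGF, right_inv := hFG }⟩
  intro a x
  change F (a • x) = a • F x
  induction x using induction with
  | zero => simp
  | add x y hx hy => rw [smul_add, map_add, map_add, hx, hy, smul_add]
  | mk m v =>
    rw [smul_mk]
    funext i
    rfl

end Pi

end BalancedTensor

/-! ### Coinvariants under S_l and induced representations -/

section Induction
variable {k : ℕ} {R : Type} [Ring R] [Algebra ℂ R] {B : Subalgebra ℂ R}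
  {P : Type} [AddCommGroup P] [Module ℂ P] [Module R P] [IsScalarTower ℂ R P]
  (actP : Equiv.Perm (Fin k) → P →ₗ[R] P)
  {S : Type} [AddCommGroup S] [Module ℂ S] (rho : Representation ℂ (Equiv.Perm (Fin k)) S)

theorem rid_outerRep (l : ℕ) (x : Equiv.Perm (Fin k) × Equiv.Perm (Fin l)) (a : S ⊗[ℂ] ℂ) :
    TensorProduct.rid ℂ S (outerRep rho l x a) = rho x.1 (TensorProduct.rid ℂ S a) := by
  induction a using TensorProduct.induction_on with
  | zero => simp
  | add a b ha hb => simp only [map_add, ha, hb]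
  | tmul v z =>
    change TensorProduct.rid ℂ S (rho x.1 v ⊗ₜ[ℂ] z) = _
    simp

section Single
variable {l : ℕ} {C : Type} [AddCommGroup C] [Module ℂ C] [Module B C] [IsScalarTower ℂ B C]
  (act : Equiv.Perm (Fin (k + l)) → C →ₗ[B] C)
  (f : C →ₗ[B] P)

/-- The map from the balanced tensor product with an induced representation. -/
theorem exists_map_of_ind (hmul : ∀ g h c, act (g * h) c = act h (act g c))
    (hf : ∀ x c, f (act (youngEmb k l x) c) = actP x.1 (f c)) :
    ∃ F : BalancedTensor B act (Representation.ind (youngEmb k l) (outerRep rho l)) →ₗ[B]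
        BalancedTensor R actP rho,
      ∀ c g a, F (BalancedTensor.mk act _ c (Representation.IndV.mk _ _ g a)) =
        BalancedTensor.mk actP rho (f (act g⁻¹ c)) (TensorProduct.rid ℂ S a) := by
  -- Complex scalars act through `z • 1` in `B`, so a `B`-linear map is ℂ-linear.
  let f' : C →ₗ[ℂ] P :=
    { toFun := f
      map_add' := map_add f
      map_smul' := fun z c => by
        have h1 : z • c = (z • (1 : B)) • c := by rw [smul_assoc, one_smul]
        have h2 : z • f c = (z • (1 : B)) • f c := by
          change _ = (z • (1 : R)) • f c
          rw [smul_assoc, one_smul]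
        rw [h1, map_smul, RingHom.id_apply, h2] }
  let act' : Equiv.Perm (Fin (k + l)) → C →ₗ[ℂ] C := fun g => (act g).restrictScalars ℂ
  let T := BalancedTensor R actP rho
  -- The vector of the induced representation represented by `g` and `a` is `g⁻¹` applied to the
  -- vector `a` at the identity. Tensored with `c` it can be rewritten with `c · g⁻¹` on the left,
  -- which is then mapped by `f`.
  let q : Equiv.Perm (Fin (k + l)) → (S ⊗[ℂ] ℂ) →ₗ[ℂ] C →ₗ[ℂ] T := fun g =>
    ((BalancedTensor.mk actP rho).flip ∘ₗ (TensorProduct.rid ℂ S).toLinearMap).compl₂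
      (f' ∘ₗ act' g⁻¹)
  have hq : ∀ g a c, q g a c = BalancedTensor.mk actP rho (f (act g⁻¹ c))
      (TensorProduct.rid ℂ S a) := fun g a c => rfl
  let q' : MonoidAlgebra ℂ (Equiv.Perm (Fin (k + l))) →ₗ[ℂ] (S ⊗[ℂ] ℂ) →ₗ[ℂ] C →ₗ[ℂ] T :=
    (Finsupp.lift _ ℂ _ q) ∘ₗ (MonoidAlgebra.coeffLinearEquiv ℂ).toLinearMap
  have hq' : ∀ g, q' (MonoidAlgebra.single g 1) = q g := by
    intro g
    simp [q', Finsupp.lift_apply]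
  let J : Representation.IndV (youngEmb k l) (outerRep rho l) →ₗ[ℂ] C →ₗ[ℂ] T :=
    -- Independence of the representative: `x` changes `g` to `youngEmb k l x * g` and applies `x.1`
    -- to `a`. By `hf` the inverse of `x` comes out of `f` as the action of `x.1⁻¹`; moving `x.1`
    -- across the tensor sign cancels it.
    Representation.Coinvariants.lift _ (TensorProduct.lift q') fun x => by
      refine TensorProduct.ext (MonoidAlgebra.lhom_ext' fun g => LinearMap.ext_ring ?_)
      refine LinearMap.ext fun a => LinearMap.ext fun c => ?_
      change q' ((Representation.leftRegular ℂ _ (youngEmb k l x)) (MonoidAlgebra.single g 1))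
        (outerRep rho l x a) c = q' (MonoidAlgebra.single g 1) a c
      have h1 : (Representation.leftRegular ℂ _ (youngEmb k l x)) (MonoidAlgebra.single g (1 : ℂ)) =
          MonoidAlgebra.single (youngEmb k l x * g) 1 := by simp
      rw [h1, hq', hq', hq, hq, rid_outerRep, mul_inv_rev, hmul, ← map_inv, hf,
        ← BalancedTensor.mk_act, ← hf, ← hf, ← hmul, ← map_mul, inv_mul_cancel, map_one, ← hmul,
        mul_one]
  have hJ : ∀ g a c, J (Representation.IndV.mk _ _ g a) c =
      BalancedTensor.mk actP rho (f (act g⁻¹ c)) (TensorProduct.rid ℂ S a) := by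
    intro g a c
    change q' (MonoidAlgebra.single g 1) a c = _
    rw [hq', hq]
  let F := BalancedTensor.lift act (Representation.ind (youngEmb k l) (outerRep rho l)) J.flip
    fun h c v => by
      -- The action of `h` on the induced representation replaces `g` by `g * h⁻¹`. The inverse is
      -- `h * g⁻¹`, which acts from the right first by `h` and then by `g⁻¹`.
      have : J.flip (act h c) = J.flip c ∘ₗ
          Representation.ind (youngEmb k l) (outerRep rho l) h := by
        refine Representation.IndV.hom_ext _ _ fun g => LinearMap.ext fun a => ?_
        change J (Representation.IndV.mk _ _ g a) (act h c) =
          J (Representation.ind (youngEmb k l) (outerRep rho l) h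
            (Representation.IndV.mk _ _ g a)) c
        rw [Representation.ind_mk, hJ, hJ, mul_inv_rev, inv_inv, hmul]
      rw [this, LinearMap.comp_apply]
  have hFJ : ∀ c v, F (BalancedTensor.mk act _ c v) = J v c := fun c v => rfl
  refine ⟨{ F with map_smul' := ?_ }, fun c g a => hJ g a c⟩
  intro b x
  change F (b • x) = b • F x
  induction x using BalancedTensor.induction with
  | zero => simp
  | add x y hx hy => rw [smul_add, map_add, map_add, hx, hy, smul_add]
  | mk c v =>
    rw [BalancedTensor.smul_mk, hFJ, hFJ]
    have : J.flip (b • c) = (Module.toModuleEnd ℂ (S := B) T b) ∘ₗ J.flip c := by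
      refine Representation.IndV.hom_ext _ _ fun g => LinearMap.ext fun a => ?_
      change J (Representation.IndV.mk _ _ g a) (b • c) =
        b • J (Representation.IndV.mk _ _ g a) c
      rw [hJ, hJ, map_smul, map_smul, BalancedTensor.subalgebra_smul_mk]
    exact LinearMap.congr_fun this v

/-- Elements of S_k × S_l pass across the tensor sign at the identity coset, where S_k acts on `S`
and S_l acts trivially. In particular the map `c ↦ c ⊗ v` at this coset factors through the
S_l-coinvariants. -/
theorem mk_ind_one (c : C) (v : S) (x : Equiv.Perm (Fin k) × Equiv.Perm (Fin l)) :
    BalancedTensor.mk act (Representation.ind (youngEmb k l) (outerRep rho l))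
        (act (youngEmb k l x) c) (Representation.IndV.mk _ _ 1 ((TensorProduct.rid ℂ S).symm v)) =
      BalancedTensor.mk act (Representation.ind (youngEmb k l) (outerRep rho l)) c
        (Representation.IndV.mk _ _ 1 ((TensorProduct.rid ℂ S).symm (rho x.1 v))) := by
  rw [BalancedTensor.mk_act, Representation.ind_mk, one_mul, ← map_inv]
  congr 1
  have h := Representation.Coinvariants.mk_self_apply
    (Representation.tprod ((Representation.leftRegular ℂ (Equiv.Perm (Fin (k + l)))).comp
      (youngEmb k l)) (outerRep rho l)) x
    (MonoidAlgebra.single (youngEmb k l x⁻¹) 1 ⊗ₜ[ℂ] (TensorProduct.rid ℂ S).symm v)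
  refine h.symm.trans ?_
  change Representation.Coinvariants.mk _ ((Representation.leftRegular ℂ _ (youngEmb k l x))
    (MonoidAlgebra.single (youngEmb k l x⁻¹) 1) ⊗ₜ[ℂ]
      outerRep rho l x ((TensorProduct.rid ℂ S).symm v)) = _
  have h1 : (Representation.leftRegular ℂ _ (youngEmb k l x))
      (MonoidAlgebra.single (youngEmb k l x⁻¹) (1 : ℂ)) = MonoidAlgebra.single 1 1 := by simp
  have h2 : outerRep rho l x ((TensorProduct.rid ℂ S).symm v) =
      (TensorProduct.rid ℂ S).symm (rho x.1 v) := by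
    rw [LinearEquiv.eq_symm_apply, rid_outerRep, LinearEquiv.apply_symm_apply]
  rw [h1, h2]
  rfl

end Single

variable {I : Type} [Fintype I] (l : I → ℕ) (C : I → Type) [∀ i, AddCommGroup (C i)]
  [∀ i, Module ℂ (C i)] [∀ i, Module B (C i)] [∀ i, IsScalarTower ℂ B (C i)]
  (act : ∀ i, Equiv.Perm (Fin (k + l i)) → C i →ₗ[B] C i)

set_option maxHeartbeats 1600000 in
/-- A balanced tensor product over `S_k` with a module that is the direct sum of the spaces of
coinvariants of the `C i` under the groups `S_(l i)` is a product of balanced tensor products with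
induced representations. -/
theorem nonempty_pi_ind_equiv (hact_one : ∀ i c, act i 1 c = c)
    (hmul : ∀ i g h c, act i (g * h) c = act i h (act i g c))
    (f : ∀ i, C i →ₗ[B] P)
    (hf : ∀ i x c, f i (act i (youngEmb k (l i) x) c) = actP x.1 (f i c))
    (s : ∀ i, P →ₗ[ℂ] C i) (hfs : ∀ p, ∑ i, f i (s i p) = p)
    (hne : ∀ i j, i ≠ j → ∀ c, s i (f j c) = 0)
    (hsf : ∀ i c, s i (f i c) - c ∈ Submodule.span ℂ
      {z | ∃ τ c', z = act i (youngEmb k (l i) (1, τ)) c' - c'}) :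
    Nonempty ((∀ i, BalancedTensor B (act i)
      (Representation.ind (youngEmb k (l i)) (outerRep rho (l i)))) ≃ₗ[B]
        BalancedTensor R actP rho) := by
  classical
  choose F hF using fun i => exists_map_of_ind actP rho (act i) (f i) (hmul i) (hf i)
  -- The copy of `S` at the identity coset of the induced representation.
  let one : ∀ i, S →ₗ[ℂ] Representation.IndV (youngEmb k (l i)) (outerRep rho (l i)) := fun i =>
    Representation.IndV.mk _ _ 1 ∘ₗ (TensorProduct.rid ℂ S).symm.toLinearMap
  have hone : ∀ i c v x, BalancedTensor.mk (act i) _ (act i (youngEmb k (l i) x) c) (one i v) =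
      BalancedTensor.mk (act i) (Representation.ind (youngEmb k (l i)) (outerRep rho (l i))) c
        (one i (rho x.1 v)) := fun i c v x => mk_ind_one rho (act i) c v x
  have hspan : ∀ i c c' v, c - c' ∈ Submodule.span ℂ
      {z | ∃ τ c', z = act i (youngEmb k (l i) (1, τ)) c' - c'} →
      BalancedTensor.mk (act i) (Representation.ind (youngEmb k (l i)) (outerRep rho (l i)))
        c (one i v) = BalancedTensor.mk (act i) _ c' (one i v) := by
    intro i c c' v h
    have hle : Submodule.span ℂ {z | ∃ τ c', z = act i (youngEmb k (l i) (1, τ)) c' - c'} ≤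
        LinearMap.ker ((BalancedTensor.mk (act i)
          (Representation.ind (youngEmb k (l i)) (outerRep rho (l i)))).flip (one i v)) := by
      rw [Submodule.span_le]
      rintro _ ⟨τ, c, rfl⟩
      rw [SetLike.mem_coe, LinearMap.mem_ker, LinearMap.flip_apply, map_sub, LinearMap.sub_apply,
        hone, map_one, Module.End.one_apply, sub_self]
    have := hle h
    rwa [LinearMap.mem_ker, LinearMap.flip_apply, map_sub, LinearMap.sub_apply, sub_eq_zero] at this
  have hsum : ∀ i (u : ∀ j, C j), s i (∑ j, f j (u j)) = s i (f i (u i)) := by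
    intro i u
    rw [map_sum]
    exact Finset.sum_eq_single i (fun j _ hj => hne i j hj.symm _) (by simp)
  -- The sections `s i` come from choices and need not be equivariant; they are so modulo the
  -- coinvariant relations, which `one` does not see.
  have hequiv : ∀ i σ p, s i (actP σ p) - act i (youngEmb k (l i) (σ, 1)) (s i p) ∈
      Submodule.span ℂ {z | ∃ τ c', z = act i (youngEmb k (l i) (1, τ)) c' - c'} := by
    intro i σ p
    have h1 : actP σ p = ∑ j, f j (act j (youngEmb k (l j) (σ, 1)) (s j p)) := by
      conv_lhs => rw [← hfs p, map_sum]
      exact Finset.sum_congr rfl fun j _ => (hf j (σ, 1) _).symm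
    rw [h1, hsum]
    exact hsf i _
  let Φ : BalancedTensor R actP rho →ₗ[ℂ] ∀ i, BalancedTensor B (act i)
      (Representation.ind (youngEmb k (l i)) (outerRep rho (l i))) :=
    LinearMap.pi fun i => BalancedTensor.lift actP rho
      ((BalancedTensor.mk (act i) _).compl₁₂ (s i) (one i)) fun σ p v => by
        simp only [LinearMap.compl₁₂_apply]
        rw [hspan i _ _ v (hequiv i σ p), hone]
  have hΦ : ∀ p v i, Φ (BalancedTensor.mk actP rho p v) i =
      BalancedTensor.mk (act i) _ (s i p) (one i v) := fun p v i => rfl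
  let Ψ : (∀ i, BalancedTensor B (act i)
      (Representation.ind (youngEmb k (l i)) (outerRep rho (l i)))) →ₗ[B]
        BalancedTensor R actP rho := ∑ i, F i ∘ₗ LinearMap.proj i
  have hΨ : ∀ y, Ψ y = ∑ i, F i (y i) := fun y => by simp [Ψ]
  have hΨs : ∀ i y, Ψ (Pi.single i y) = F i y := by
    intro i y
    rw [hΨ, Finset.sum_eq_single i]
    · rw [Pi.single_eq_same]
    · intro j _ hj
      rw [Pi.single_eq_of_ne hj, map_zero]
    · simp
  have hΨΦ : ∀ x, Ψ (Φ x) = x := by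
    intro x
    induction x using BalancedTensor.induction with
    | zero => rw [map_zero, map_zero]
    | add x y hx hy => rw [map_add, map_add, hx, hy]
    | mk p v =>
      rw [hΨ]
      simp only [hΦ]
      have : ∀ i, F i (BalancedTensor.mk (act i) _ (s i p) (one i v)) =
          BalancedTensor.mk actP rho (f i (s i p)) v := by
        intro i
        change F i (BalancedTensor.mk (act i) _ (s i p)
          (Representation.IndV.mk _ _ 1 ((TensorProduct.rid ℂ S).symm v))) = _
        rw [hF, LinearEquiv.apply_symm_apply, inv_one, hact_one]
      simp only [this]
      rw [← LinearMap.sum_apply, ← map_sum, hfs]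
  have hΦΨ : ∀ y, Φ (Ψ y) = y := by
    intro y
    rw [← Finset.univ_sum_single y, map_sum, map_sum]
    refine Finset.sum_congr rfl fun i _ => ?_
    rw [hΨs]
    generalize y i = z
    induction z using BalancedTensor.induction with
    | zero => simp
    | add x y hx hy => rw [Pi.single_add, map_add, map_add, hx, hy]
    | mk c w =>
      have : Φ.restrictScalars ℂ ∘ₗ (F i).restrictScalars ℂ ∘ₗ BalancedTensor.mk (act i) _ c =
          LinearMap.single ℂ _ i ∘ₗ BalancedTensor.mk (act i) _ c := by
        refine Representation.IndV.hom_ext _ _ fun g => LinearMap.ext fun a => ?_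
        change Φ (F i (BalancedTensor.mk (act i) _ c (Representation.IndV.mk _ _ g a))) =
          Pi.single i (BalancedTensor.mk (act i) _ c (Representation.IndV.mk _ _ g a))
        rw [hF]
        funext j
        rw [hΦ]
        -- In component `i`, `s i` undoes `f i` modulo the relations. This leaves `c · g⁻¹` tensored
        -- with the identity coset, and moving `g⁻¹` across turns it into the coset of `g`. The
        -- other components vanish by `hne`.
        by_cases h : j = i
        · subst h
          rw [Pi.single_eq_same, hspan j _ _ _ (hsf j _), BalancedTensor.mk_act]
          change BalancedTensor.mk (act j) _ c (Representation.ind _ _ _ (Representation.IndV.mk _ _ 1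
            ((TensorProduct.rid ℂ S).symm (TensorProduct.rid ℂ S a)))) = _
          rw [Representation.ind_mk, LinearEquiv.symm_apply_apply, one_mul, inv_inv]
        · rw [Pi.single_eq_of_ne h, hne j i h, map_zero, LinearMap.zero_apply]
      exact LinearMap.congr_fun this w
  exact ⟨{ Ψ with invFun := Φ, left_inv := hΦΨ, right_inv := hΨΦ }⟩

end Induction

end PartialBrauer

namespace PartialBrauer
open Diagram

/-! ### The right action on the Brauer cell module -/

section RightAction
variable {n k : ℕ} (δ ε : ℂ) (d : Diagram n) (hk : d.propNumber = k)

theorem permEnds_mul (σ τ : Equiv.Perm (Fin k)) :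
    d.permEnds hk (σ * τ) = d.permEnds hk σ * d.permEnds hk τ :=
  map_mul (Equiv.Perm.viaEmbeddingHom (d.rightEnds.orderEmbOfFin hk).toEmbedding) σ τ

theorem permEnds_one : d.permEnds hk 1 = 1 :=
  map_one (Equiv.Perm.viaEmbeddingHom (d.rightEnds.orderEmbOfFin hk).toEmbedding)

/-- A Brauer diagram of the left cell as an element of the cell module of the Brauer algebra. -/
noncomputable def brauerBasis (x : {x : Diagram n // leftCell n d x}) (hx : x.1.IsBrauer) :
    brauerCell δ ε d :=
  ⟨CellModule.basis δ ε d x, Submodule.subset_span ⟨x, hx, rfl⟩⟩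

variable {δ ε d} in
@[elab_as_elim]
theorem brauerCell_induction {motive : brauerCell δ ε d → Prop} (c : brauerCell δ ε d)
    (zero : motive 0) (add : ∀ a b, motive a → motive b → motive (a + b))
    (smul : ∀ (z : ℂ) a, motive a → motive (z • a))
    (basis : ∀ x hx, motive (brauerBasis δ ε d x hx)) : motive c := by
  obtain ⟨c, hc⟩ := c
  have hc' : c ∈ Submodule.span ℂ (CellModule.basis δ ε d '' {x | x.1.IsBrauer}) := hc
  suffices h : ∃ h : c ∈ brauerCell δ ε d, motive ⟨c, h⟩ from h.2
  clear hc
  induction hc' using Submodule.span_induction with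
  | zero => exact ⟨zero_mem _, zero⟩
  | add x y _ _ hx hy =>
    obtain ⟨hx, hx'⟩ := hx
    obtain ⟨hy, hy'⟩ := hy
    exact ⟨add_mem hx hy, add _ _ hx' hy'⟩
  | smul z x _ hx =>
    obtain ⟨hx, hx'⟩ := hx
    exact ⟨Submodule.smul_of_tower_mem _ z hx, smul z _ hx'⟩
  | mem x hx =>
    obtain ⟨x, hx, rfl⟩ := hx
    exact ⟨_, basis x hx⟩

theorem brauerRightAct_basis (σ : Equiv.Perm (Fin k)) (x : {x : Diagram n // leftCell n d x})
    (hx : x.1.IsBrauer) : brauerRightAct δ ε d hk σ (brauerBasis δ ε d x hx) =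
      brauerBasis δ ε d ⟨x.1.relabel (d.permEnds hk σ), leftCell_permEnds x.2 hk σ⟩
        (IsBrauer.relabel hx _) :=
  Subtype.ext (CellModule.rightAct_basis hk σ x)

theorem brauerRightAct_smul (σ : Equiv.Perm (Fin k)) (z : ℂ) (c : brauerCell δ ε d) :
    brauerRightAct δ ε d hk σ (z • c) = z • brauerRightAct δ ε d hk σ c :=
  LinearMap.map_smul_of_tower _ _ _

theorem brauerRightAct_one (c : brauerCell δ ε d) : brauerRightAct δ ε d hk 1 c = c := by
  induction c using brauerCell_induction with
  | zero => exact map_zero _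
  | add a b ha hb => rw [map_add, ha, hb]
  | smul z a ha => rw [brauerRightAct_smul, ha]
  | basis x hx =>
    rw [brauerRightAct_basis]
    simp only [permEnds_one, relabel_one]

theorem brauerRightAct_mul (σ τ : Equiv.Perm (Fin k)) (c : brauerCell δ ε d) :
    brauerRightAct δ ε d hk (σ * τ) c =
      brauerRightAct δ ε d hk τ (brauerRightAct δ ε d hk σ c) := by
  induction c using brauerCell_induction with
  | zero => simp only [map_zero]
  | add a b ha hb => simp only [map_add, ha, hb]
  | smul z a ha => simp only [brauerRightAct_smul, ha]
  | basis x hx =>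
    simp only [brauerRightAct_basis, permEnds_mul, relabel_relabel]

end RightAction

/-! ### The Brauer cell module mapped to the cell module by cutting lines -/

section Gluing
variable {n k l : ℕ} (δ : ℂ) (d₀ : Diagram n) (hk : d₀.propNumber = k) (e : Diagram n)
  (hm : e.propNumber = k + l)

/-- Right multiplication by the cut diagram. -/
noncomputable def glueHom : CellModule δ 0 e →ₗ[ℂ] CellModule δ 0 d₀ :=
  (CellModule.basis δ 0 e).constr ℂ fun y =>
    CellModule.basis δ 0 d₀ ⟨y.1 * cut d₀ hk e hm, leftCell_mul_cut d₀ hk e hm y.2⟩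

theorem glueHom_basis (y : {y : Diagram n // leftCell n e y}) :
    glueHom δ d₀ hk e hm (CellModule.basis δ 0 e y) =
      CellModule.basis δ 0 d₀ ⟨y.1 * cut d₀ hk e hm, leftCell_mul_cut d₀ hk e hm y.2⟩ :=
  (CellModule.basis δ 0 e).constr_basis ℂ _ y

/-- If `d * y` stays in the cell of `e`, the straightening factors agree. If it leaves the cell, the
left side is zero; on the right the product either leaves the cell of `d₀` or contains an open
string, whose factor is `0`. -/
theorem glueHom_smul {d : Diagram n} (hd : d.IsBrauer) (y : {y : Diagram n // leftCell n e y})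
    (hy : y.1.IsBrauer) :
    glueHom δ d₀ hk e hm ((PBAlgebra.of d : PBAlgebra n δ 0) • CellModule.basis δ 0 e y) =
      (PBAlgebra.of d : PBAlgebra n δ 0) •
        glueHom δ d₀ hk e hm (CellModule.basis δ 0 e y) := by
  rw [glueHom_basis, CellModule.of_smul_basis, CellModule.of_smul_basis]
  unfold CellModule.actBasis
  by_cases h : leftCell n e (d * y.1)
  · have h' : leftCell n d₀ (d * (y.1 * cut d₀ hk e hm)) := by
      rw [← mul_assoc]; exact leftCell_mul_cut d₀ hk e hm h
    rw [dif_pos h, dif_pos h', map_smul, glueHom_basis, factor_mul_cut d₀ hk e hm δ hd y.2 hy h]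
    simp only [mul_assoc]
  · rw [dif_neg h, map_zero]
    split_ifs with h'
    · have hs : strings d.rel (y.1 * cut d₀ hk e hm).rel ≠ 0 := fun hs =>
        h (leftCell_of_mul_cut d₀ hk e hm hd y.2 hy h' hs)
      simp only [factor]
      rw [zero_pow hs, mul_zero, zero_smul]
    · rfl

/-- Right multiplication by the cut diagram, as a map of modules over the Brauer algebra. -/
noncomputable def glue : brauerCell δ 0 e →ₗ[brauer n δ 0] CellModule δ 0 d₀ where
  toFun c := glueHom δ d₀ hk e hm c.1
  map_add' a b := map_add _ a.1 b.1
  map_smul' a c := by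
    obtain ⟨a, ha⟩ := a
    change glueHom δ d₀ hk e hm (a • c.1) = a • glueHom δ d₀ hk e hm c.1
    change a ∈ Submodule.span ℂ (PBAlgebra.of '' {d : Diagram n | d.IsBrauer}) at ha
    induction ha using Submodule.span_induction with
    | zero => rw [zero_smul, zero_smul, map_zero]
    | add a a' _ _ h h' => rw [add_smul, add_smul, map_add, h, h']
    | smul r a _ h => rw [smul_assoc, smul_assoc, map_smul, h]
    | mem d hd =>
      obtain ⟨d, hd, rfl⟩ := hd
      induction c using brauerCell_induction with
      | zero => simp
      | add a b ha hb =>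
        change glueHom δ d₀ hk e hm (_ • (a.1 + b.1)) = _ • glueHom δ d₀ hk e hm (a.1 + b.1)
        rw [smul_add, map_add, ha, hb, map_add, smul_add]
      | smul z a ha =>
        change glueHom δ d₀ hk e hm (_ • (z • a.1)) = _ • glueHom δ d₀ hk e hm (z • a.1)
        rw [smul_comm, map_smul, ha, map_smul, smul_comm]
      | basis y hy => exact glueHom_smul δ d₀ hk e hm hd y hy

theorem glue_basis (y : {y : Diagram n // leftCell n e y}) (hy : y.1.IsBrauer) :
    glue δ d₀ hk e hm (brauerBasis δ 0 e y hy) =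
      CellModule.basis δ 0 d₀ ⟨y.1 * cut d₀ hk e hm, leftCell_mul_cut d₀ hk e hm y.2⟩ :=
  glueHom_basis δ d₀ hk e hm y

theorem glue_smul (z : ℂ) (c : brauerCell δ 0 e) :
    glue δ d₀ hk e hm (z • c) = z • glue δ d₀ hk e hm c := map_smul (glueHom δ d₀ hk e hm) z c.1

/-- Permutations of the kept ends pass through the cut diagram, and permutations of the cut ends are
absorbed by it. -/
theorem glue_rightAct (x : Equiv.Perm (Fin k) × Equiv.Perm (Fin l)) (c : brauerCell δ 0 e) :
    glue δ d₀ hk e hm (brauerRightAct δ 0 e hm (youngEmb k l x) c) =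
      CellModule.rightAct δ 0 d₀ hk x.1 (glue δ d₀ hk e hm c) := by
  induction c using brauerCell_induction with
  | zero => simp only [map_zero]
  | add a b ha hb => simp only [map_add, ha, hb]
  | smul z a ha =>
    rw [brauerRightAct_smul, glue_smul, glue_smul, ha, LinearMap.map_smul_of_tower]
  | basis y hy =>
    rw [brauerRightAct_basis, glue_basis, glue_basis, CellModule.rightAct_basis]
    congr 2
    change y.1.relabel _ * _ = (y.1 * _).relabel _
    rw [← mul_perm, mul_assoc, perm_mul_cut d₀ hk e hm x.1 x.2, mul_relabel]

theorem glue_mem_filt (c : brauerCell δ 0 e) : glue δ d₀ hk e hm c ∈ filt δ d₀ l := by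
  induction c using brauerCell_induction with
  | zero => rw [map_zero]; exact zero_mem _
  | add a b ha hb => rw [map_add]; exact add_mem ha hb
  | smul z a ha => rw [glue_smul]; exact Submodule.smul_of_tower_mem _ z ha
  | basis y hy =>
    rw [glue_basis]
    exact Submodule.subset_span ⟨_, (leftSingletons_mul_cut d₀ hk e hm y.2 hy).ge, rfl⟩

variable (he : e.IsBrauer)

open Classical in
/-- A linear map that picks a preimage under `glue` for each diagram with `l` left singletons. -/
noncomputable def unglue : CellModule δ 0 d₀ →ₗ[ℂ] brauerCell δ 0 e :=
  (CellModule.basis δ 0 d₀).constr ℂ fun x =>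
    if h : x.1.leftSingletons = l then
      brauerBasis δ 0 e ⟨_, (exists_mul_cut_eq d₀ hk e hm he x.2 h).choose_spec.1⟩
        (exists_mul_cut_eq d₀ hk e hm he x.2 h).choose_spec.2.1
    else 0

theorem unglue_basis_of_ne {x : {x : Diagram n // leftCell n d₀ x}} (h : x.1.leftSingletons ≠ l) :
    unglue δ d₀ hk e hm he (CellModule.basis δ 0 d₀ x) = 0 := by
  unfold unglue
  rw [Module.Basis.constr_basis, dif_neg h]

theorem exists_unglue_basis {x : {x : Diagram n // leftCell n d₀ x}} (h : x.1.leftSingletons = l) :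
    ∃ y hy, y.1 * cut d₀ hk e hm = x.1 ∧
      unglue δ d₀ hk e hm he (CellModule.basis δ 0 d₀ x) = brauerBasis δ 0 e y hy := by
  have hex := exists_mul_cut_eq d₀ hk e hm he x.2 h
  refine ⟨⟨_, hex.choose_spec.1⟩, hex.choose_spec.2.1, hex.choose_spec.2.2, ?_⟩
  unfold unglue
  rw [Module.Basis.constr_basis, dif_pos h]

theorem glue_unglue_basis {x : {x : Diagram n // leftCell n d₀ x}} (h : x.1.leftSingletons = l) :
    glue δ d₀ hk e hm (unglue δ d₀ hk e hm he (CellModule.basis δ 0 d₀ x)) =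
      CellModule.basis δ 0 d₀ x := by
  obtain ⟨y, hy, h1, h2⟩ := exists_unglue_basis δ d₀ hk e hm he h
  rw [h2, glue_basis]
  simp only [h1]

/-- The chosen preimage of a glued diagram need not be the original one, but the two differ by a
permutation of the `l` cut lines. -/
theorem unglue_glue_sub_mem (c : brauerCell δ 0 e) :
    unglue δ d₀ hk e hm he (glue δ d₀ hk e hm c) - c ∈ Submodule.span ℂ
      {z | ∃ τ c', z = brauerRightAct δ 0 e hm (youngEmb k l (1, τ)) c' - c'} := by
  induction c using brauerCell_induction with
  | zero => rw [map_zero, map_zero, sub_zero]; exact zero_mem _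
  | add a b ha hb =>
    rw [map_add, map_add, add_sub_add_comm]
    exact add_mem ha hb
  | smul z a ha =>
    rw [glue_smul, map_smul]
    have h := Submodule.smul_mem _ z ha
    rw [smul_sub] at h
    exact h
  | basis y hy =>
    rw [glue_basis]
    obtain ⟨y', hy', h1, h2⟩ := exists_unglue_basis δ d₀ hk e hm he
      (x := ⟨y.1 * cut d₀ hk e hm, leftCell_mul_cut d₀ hk e hm y.2⟩)
      (leftSingletons_mul_cut d₀ hk e hm y.2 hy)
    obtain ⟨τ, hτ⟩ := exists_eq_relabel d₀ hk e hm y.2 hy y'.2 hy' h1.symm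
    refine Submodule.subset_span ⟨τ, brauerBasis δ 0 e y hy, ?_⟩
    rw [h2, brauerRightAct_basis]
    congr 2
    exact Subtype.ext hτ

/-- Glued diagrams from `e'` have exactly `l'` left singletons, so the degrees do not mix. -/
theorem unglue_glue_of_ne {l' : ℕ} (hl : l ≠ l') (e' : Diagram n) (hm' : e'.propNumber = k + l')
    (c : brauerCell δ 0 e') : unglue δ d₀ hk e hm he (glue δ d₀ hk e' hm' c) = 0 := by
  induction c using brauerCell_induction with
  | zero => rw [map_zero, map_zero]
  | add a b ha hb => rw [map_add, map_add, ha, hb, add_zero]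
  | smul z a ha => rw [glue_smul, map_smul, ha, smul_zero]
  | basis y hy =>
    rw [glue_basis]
    exact unglue_basis_of_ne δ d₀ hk e hm he
      (by rw [leftSingletons_mul_cut d₀ hk e' hm' y.2 hy]; exact hl.symm)

end Gluing

/-! ### The cell module and its sections as modules over the Brauer algebra -/

section Sections
variable {n k : ℕ} (δ : ℂ) (d₀ : Diagram n) (hk : d₀.propNumber = k)

theorem mem_sectionIndices {x : Diagram n} (hx : leftCell n d₀ x) (hk : d₀.propNumber = k) :
    x.leftSingletons ∈ sectionIndices n k := by
  have h1 : x.propNumber = k := (congrArg Finset.card (rightEnds_eq hx)).trans hk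
  have h2 := even_sub_propNumber x
  rw [h1] at h2
  simp only [sectionIndices, Finset.mem_filter, Finset.mem_range]
  exact ⟨by omega, h2⟩

/-- The cell module of the partial Brauer algebra, tensored with a representation of `S_k`, in
terms of the cell modules of the Brauer algebra. -/
theorem nonempty_pi_equiv_cell (e : ℕ → Diagram n) (he : ∀ l ∈ sectionIndices n k, (e l).IsBrauer)
    (hek : ∀ l ∈ sectionIndices n k, (e l).propNumber = k + l)
    {S : Type} [AddCommGroup S] [Module ℂ S] (rho : Representation ℂ (Equiv.Perm (Fin k)) S) :
    Nonempty ((∀ l : {l // l ∈ sectionIndices n k}, BalancedTensor (brauer n δ 0)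
      (brauerRightAct δ 0 (e l.1) (hek l.1 l.2))
      (Representation.ind (youngEmb k l.1) (outerRep rho l.1))) ≃ₗ[brauer n δ 0]
        BalancedTensor (PBAlgebra n δ 0) (CellModule.rightAct δ 0 d₀ hk) rho) := by
  refine nonempty_pi_ind_equiv (CellModule.rightAct δ 0 d₀ hk) rho
    (fun l : {l // l ∈ sectionIndices n k} => l.1) (fun l => brauerCell δ 0 (e l.1))
    (fun l => brauerRightAct δ 0 (e l.1) (hek l.1 l.2))
    (fun l => brauerRightAct_one δ 0 (e l.1) (hek l.1 l.2))
    (fun l => brauerRightAct_mul δ 0 (e l.1) (hek l.1 l.2))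
    (fun l => glue δ d₀ hk (e l.1) (hek l.1 l.2))
    (fun l => glue_rightAct δ d₀ hk (e l.1) (hek l.1 l.2))
    (fun l => unglue δ d₀ hk (e l.1) (hek l.1 l.2) (he l.1 l.2)) (fun p => ?_)
    (fun i j hij c => unglue_glue_of_ne δ d₀ hk _ _ _ (fun h => hij (Subtype.ext h)) _ _ c)
    (fun l c => unglue_glue_sub_mem δ d₀ hk (e l.1) (hek l.1 l.2) _ c)
  induction p using CellModule.induction with
  | h0 => simp only [map_zero, Finset.sum_const_zero]
  | hadd a b ha hb => simp only [map_add, Finset.sum_add_distrib, ha, hb]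
  | hsmul z a ha => simp only [map_smul, glue_smul, ← Finset.smul_sum, ha]
  | hof x =>
    -- A basis diagram is recovered from the summand given by its number of left singletons; all
    -- other summands vanish on it.
    rw [Finset.sum_eq_single ⟨x.1.leftSingletons, mem_sectionIndices d₀ x.2 hk⟩]
    · exact glue_unglue_basis δ d₀ hk _ _ _ rfl
    · intro l _ hl
      rw [unglue_basis_of_ne, map_zero]
      exact fun h => hl (Subtype.ext h.symm)
    · simp

variable {l : ℕ} (e : Diagram n) (hm : e.propNumber = k + l)

/-- The map `glue` to a section of the filtration. -/
noncomputable def glueSection : brauerCell δ 0 e →ₗ[brauer n δ 0] CellSection δ d₀ l where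
  toFun c := Submodule.Quotient.mk ⟨glue δ d₀ hk e hm c, glue_mem_filt δ d₀ hk e hm c⟩
  map_add' a b := by
    rw [← Submodule.Quotient.mk_add]
    congr 1
    exact Subtype.ext (map_add _ a b)
  map_smul' a c := by
    rw [RingHom.id_apply, ← Submodule.Quotient.mk_smul]
    congr 1
    exact Subtype.ext (map_smul (glue δ d₀ hk e hm) a c)

theorem unglue_eq_zero_of_mem_filt (he : e.IsBrauer) {l' : ℕ} (hl : l < l') {x : CellModule δ 0 d₀}
    (hx : x ∈ filt δ d₀ l') : unglue δ d₀ hk e hm he x = 0 := by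
  change x ∈ Submodule.span ℂ (CellModule.basis δ 0 d₀ '' {x | l' ≤ x.1.leftSingletons}) at hx
  induction hx using Submodule.span_induction with
  | zero => exact map_zero _
  | add x y _ _ hx hy => rw [map_add, hx, hy, add_zero]
  | smul c x _ hx => rw [map_smul, hx, smul_zero]
  | mem x hx =>
    obtain ⟨x, hx, rfl⟩ := hx
    exact unglue_basis_of_ne δ d₀ hk e hm he (lt_of_lt_of_le hl hx).ne'

/-- Diagrams with exactly `l` left singletons are recovered. The number of left singletons has a
fixed parity in the cell, so all others in this step of the filtration have at least `l + 2`. -/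
theorem glue_unglue_sub_mem_filt (he : e.IsBrauer) (hl : l ∈ sectionIndices n k)
    {x : CellModule δ 0 d₀} (hx : x ∈ filt δ d₀ l) :
    glue δ d₀ hk e hm (unglue δ d₀ hk e hm he x) - x ∈ filt δ d₀ (l + 2) := by
  change x ∈ Submodule.span ℂ (CellModule.basis δ 0 d₀ '' {x | l ≤ x.1.leftSingletons}) at hx
  induction hx using Submodule.span_induction with
  | zero => rw [map_zero, map_zero, sub_zero]; exact zero_mem _
  | add x y _ _ hx hy => rw [map_add, map_add, add_sub_add_comm]; exact add_mem hx hy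
  | smul z x _ hx =>
    rw [map_smul, glue_smul, ← smul_sub]
    exact Submodule.smul_of_tower_mem _ z hx
  | mem x hx =>
    obtain ⟨x, hx, rfl⟩ := hx
    by_cases h : x.1.leftSingletons = l
    · rw [glue_unglue_basis δ d₀ hk e hm he h, sub_self]
      exact zero_mem _
    · rw [unglue_basis_of_ne δ d₀ hk e hm he h, map_zero, zero_sub]
      refine neg_mem (Submodule.subset_span ⟨x, ?_, rfl⟩)
      have h1 := mem_sectionIndices d₀ x.2 hk
      simp only [sectionIndices, Finset.mem_filter] at h1 hl
      obtain ⟨a, ha⟩ := h1.2.2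
      obtain ⟨b, hb⟩ := hl.2.2
      have h2 : l ≤ x.1.leftSingletons := hx
      change l + 2 ≤ x.1.leftSingletons
      omega

/-- The map `unglue` on a section of the filtration. -/
noncomputable def unglueSection (he : e.IsBrauer) : CellSection δ d₀ l →ₗ[ℂ] brauerCell δ 0 e :=
  (Submodule.liftQ (((filt δ d₀ (l + 2)).submoduleOf (filt δ d₀ l)).restrictScalars ℂ)
    (unglue δ d₀ hk e hm he ∘ₗ (filt δ d₀ l).subtype.restrictScalars ℂ) fun x hx =>
      unglue_eq_zero_of_mem_filt δ d₀ hk e hm he (by omega : l < l + 2)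
        (show x.1 ∈ filt δ d₀ (l + 2) from hx)) ∘ₗ
    (Submodule.Quotient.restrictScalarsEquiv ℂ _).symm.toLinearMap

theorem unglueSection_mk (he : e.IsBrauer) (x : filt δ d₀ l) :
    unglueSection δ d₀ hk e hm he (Submodule.Quotient.mk x) = unglue δ d₀ hk e hm he x.1 := rfl

/-- A section of the filtration, tensored with a representation of `S_k`, in terms of the cell
module of the Brauer algebra. -/
theorem nonempty_equiv_section (he : e.IsBrauer) (hl : l ∈ sectionIndices n k)
    {S : Type} [AddCommGroup S] [Module ℂ S] (rho : Representation ℂ (Equiv.Perm (Fin k)) S) :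
    Nonempty (BalancedTensor (brauer n δ 0) (brauerRightAct δ 0 e hm)
      (Representation.ind (youngEmb k l) (outerRep rho l)) ≃ₗ[brauer n δ 0]
        BalancedTensor (PBAlgebra n δ 0) (sectionRightAct δ d₀ hk l) rho) := by
  -- The case of a single summand: modulo diagrams with at least `l + 2` left singletons only those
  -- with exactly `l` remain.
  have h := nonempty_pi_ind_equiv (sectionRightAct δ d₀ hk l) rho
    (fun _ : Unit => l) (fun _ => brauerCell δ 0 e) (fun _ => brauerRightAct δ 0 e hm)
    (fun _ => brauerRightAct_one δ 0 e hm) (fun _ => brauerRightAct_mul δ 0 e hm)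
    (fun _ => glueSection δ d₀ hk e hm)
    (fun _ x c => by
      change Submodule.Quotient.mk _ = Submodule.Quotient.mk _
      congr 1
      exact Subtype.ext (glue_rightAct δ d₀ hk e hm x c))
    (fun _ => unglueSection δ d₀ hk e hm he)
    (fun p => by
      obtain ⟨x, rfl⟩ := Submodule.Quotient.mk_surjective _ p
      rw [Fintype.sum_unique, unglueSection_mk]
      refine (Submodule.Quotient.eq _).2 ?_
      exact glue_unglue_sub_mem_filt δ d₀ hk e hm he hl x.2)
    (fun i j hij => absurd rfl hij)
    (fun _ c => unglue_glue_sub_mem δ d₀ hk e hm he c)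
  obtain ⟨E⟩ := h
  exact ⟨(LinearEquiv.funUnique Unit (brauer n δ 0) _).symm.trans E⟩

end Sections

end PartialBrauer

namespace PartialBrauer
open Diagram TensorProduct

instance (n : ℕ) : Finite (Diagram n) :=
  Finite.of_injective (fun d : Diagram n => fun x y => d.rel x y) fun _ _ h =>
    Diagram.ext (Setoid.ext fun x y => iff_of_eq (congrFun (congrFun h x) y))

instance {n : ℕ} (δ ε : ℂ) (d : Diagram n) : Module.Finite ℂ (CellModule δ ε d) :=
  Module.Finite.of_basis (CellModule.basis δ ε d)

instance {n : ℕ} (δ ε : ℂ) (d : Diagram n) : Module.Finite ℂ (brauerCell δ ε d) :=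
  Module.Finite.of_injective ((brauerCell δ ε d).subtype.restrictScalars ℂ)
    Subtype.val_injective

theorem isFiniteLength_of_finite (A X : Type) [Ring A] [Algebra ℂ A] [AddCommGroup X] [Module ℂ X]
    [Module A X] [IsScalarTower ℂ A X] [Module.Finite ℂ X] : IsFiniteLength A X :=
  isFiniteLength_iff_isNoetherian_isArtinian.2
    ⟨isNoetherian_of_tower ℂ inferInstance, isArtinian_of_tower ℂ inferInstance⟩

theorem BalancedTensor.isFiniteLength {A : Type} [Ring A] [Algebra ℂ A] {M : Type}
    [AddCommGroup M] [Module ℂ M] [Module A M] [IsScalarTower ℂ A M] [Module.Finite ℂ M]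
    {G : Type} [Group G] (act : G → M →ₗ[A] M) {S : Type} [AddCommGroup S] [Module ℂ S]
    [Module.Finite ℂ S] (rho : Representation ℂ G S) :
    IsFiniteLength A (BalancedTensor A act rho) := by
  have h := isFiniteLength_iff_isNoetherian_isArtinian.1 (isFiniteLength_of_finite A (M ⊗[ℂ] S))
  have := h.1
  have := h.2
  exact isFiniteLength_iff_isNoetherian_isArtinian.2
    ⟨isNoetherian_quotient _, isArtinian_of_quotient_of_artinian _⟩

/-! ### Decomposition into Brauer–Specht modules and the main theorem -/

section Main
variable {n k l : ℕ} (δ : ℂ) (e : Diagram n) (hm : e.propNumber = k + l) (lam : k.Partition)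

/-- The tensor product of a cell module of the Brauer algebra with the representation induced from
a Specht module and a trivial representation. -/
theorem nonempty_equiv_pi_brauerSpecht :
    Nonempty (BalancedTensor (brauer n δ 0) (brauerRightAct δ 0 e hm)
      (Representation.ind (youngEmb k l) (outerRep (spechtRep lam) l)) ≃ₗ[brauer n δ 0]
        ∀ i : Σ mu : (k + l).Partition, Fin (mult lam mu), BrauerSpecht δ e hm i.1) := by
  obtain ⟨E, hE⟩ := exists_specht_decomposition
    (Representation.ind (youngEmb k l) (outerRep (spechtRep lam) l))
  exact BalancedTensor.nonempty_equiv_pi (brauerRightAct δ 0 e hm) _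
    (fun i : Σ mu : (k + l).Partition, Fin (mult lam mu) => spechtRep i.1) E hE

/-- Multiplicities add up over the Brauer–Specht summands of the decomposition. -/
theorem compMult_ind (E : Type) [AddCommGroup E] [Module (brauer n δ 0) E] :
    compMult (brauer n δ 0) (BalancedTensor (brauer n δ 0) (brauerRightAct δ 0 e hm)
      (Representation.ind (youngEmb k l) (outerRep (spechtRep lam) l))) E =
      ∑ mu : (k + l).Partition, mult lam mu * compMult (brauer n δ 0) (BrauerSpecht δ e hm mu) E := by
  obtain ⟨F⟩ := nonempty_equiv_pi_brauerSpecht δ e hm lam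
  refine (compMult_congr F (BalancedTensor.isFiniteLength _ _)).trans ?_
  refine (compMult_pi fun i => BalancedTensor.isFiniteLength _ _).trans ?_
  rw [Fintype.sum_sigma]
  refine Finset.sum_congr rfl fun mu _ => ?_
  change ∑ _y : Fin (mult lam mu), compMult (brauer n δ 0) (BrauerSpecht δ e hm mu) E = _
  rw [Finset.sum_const, Finset.card_univ, Fintype.card_fin, smul_eq_mul]

end Main

end PartialBrauer

theorem theorem505 (n k : ℕ) (δ : ℂ)
    -- a left cell of partial Brauer diagrams with propagating number `k`, given by an element
    (d₀ : PartialBrauer.Diagram n) (hd₀ : d₀.propNumber = k)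
    -- for each `l`, a left cell of Brauer diagrams with propagating number `k + l`
    (e : ℕ → PartialBrauer.Diagram n)
    (he : ∀ l ∈ PartialBrauer.sectionIndices n k, (e l).IsBrauer)
    (hek : ∀ l ∈ PartialBrauer.sectionIndices n k, (e l).propNumber = k + l)
    (lam : k.Partition) :
    (∀ (l : ℕ) (hl : l ∈ PartialBrauer.sectionIndices n k),
      Nonempty (PartialBrauer.DeltaSection δ d₀ hd₀ l lam ≃ₗ[PartialBrauer.brauer n δ 0]
        DirectSum (Σ mu : (k + l).Partition, Fin (PartialBrauer.mult lam mu))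
          fun i => PartialBrauer.BrauerSpecht δ (e l) (hek l hl) i.1)) ∧
    (∀ (E : Type) [AddCommGroup E] [Module (PartialBrauer.PBAlgebra n δ 0) E]
      [IsSimpleModule (PartialBrauer.PBAlgebra n δ 0) E],
      PartialBrauer.compMult (PartialBrauer.PBAlgebra n δ 0)
          (PartialBrauer.Delta δ d₀ hd₀ lam) E =
        ∑ l : {l // l ∈ PartialBrauer.sectionIndices n k}, ∑ mu : (k + l.1).Partition,
          PartialBrauer.mult lam mu *
            PartialBrauer.compMult (PartialBrauer.brauer n δ 0)
              (PartialBrauer.BrauerSpecht δ (e l.1) (hek l.1 l.2) mu) E) := by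
  classical
  constructor
  · intro l hl
    obtain ⟨E₁⟩ := PartialBrauer.nonempty_equiv_section δ d₀ hd₀ (e l) (hek l hl) (he l hl) hl
      (PartialBrauer.spechtRep lam)
    obtain ⟨E₂⟩ := PartialBrauer.nonempty_equiv_pi_brauerSpecht δ (e l) (hek l hl) lam
    exact ⟨(E₁.symm.trans E₂).trans (DirectSum.linearEquivFunOnFintype _ _ _).symm⟩
  · intro E _ _ _
    obtain ⟨E₁⟩ := PartialBrauer.nonempty_pi_equiv_cell δ d₀ hd₀ e he hek
      (PartialBrauer.spechtRep lam)
    have hind : ∀ l : {l // l ∈ PartialBrauer.sectionIndices n k},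
        IsFiniteLength (PartialBrauer.brauer n δ 0)
          (PartialBrauer.BalancedTensor (PartialBrauer.brauer n δ 0)
            (PartialBrauer.brauerRightAct δ 0 (e l.1) (hek l.1 l.2))
            (Representation.ind (PartialBrauer.youngEmb k l.1)
              (PartialBrauer.outerRep (PartialBrauer.spechtRep lam) l.1))) := fun l =>
      PartialBrauer.BalancedTensor.isFiniteLength _ _
    -- Over the Brauer algebra the whole of Δ(λ) is a direct sum over `l`, so the multiplicities can
    -- be added up without passing through the filtration.
    refine (PartialBrauer.compMult_restrict (PartialBrauer.brauer n δ 0)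
      PartialBrauer.exists_brauer_smul_eq
      (PartialBrauer.BalancedTensor.isFiniteLength _ _)).trans ?_
    refine (PartialBrauer.compMult_congr E₁ (PartialBrauer.isFiniteLength_pi hind)).symm.trans ?_
    refine (PartialBrauer.compMult_pi hind).trans ?_
    exact Finset.sum_congr rfl fun l _ =>
      PartialBrauer.compMult_ind δ (e l.1) (hek l.1 l.2) lam E
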